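/- **Setting.** Let $n,l,m,d_\varphi,d_\eta\ge 0$ be integers, $T>0$, and let $f_i:\mathbb R^{n}\times\mathbb R^{l}\to\mathbb R^n$ ($0\le i\le m$), $\varphi_i:\mathbb R^{2n}\to\mathbb R$ ($0\le i\le d_\varphi$) and $\eta_j:\mathbb R^{2n}\to\mathbb R$ ($1\le j\le d_\eta$) be $C^2$ functions with Lipschitz continuous second derivatives. Put $F(x,u,v)=f_0(x,u)+\sum_{i=1}^m v_i f_i(x,u)$. Consider the problem (P) of minimizing $\varphi_0(x_0,x_T)$ over $w=(x,u,v)\in\mathcal W=W^{1,\infty}(0,T;\mathbb R^n)\times L^\infty(0,T;\mathbb R^l)\times L^\infty(0,T;\mathbb R^m)$ subject to $\dot x_t=F(x_t,u_t,v_t)$ for a.e. $t\in[0,T]$, $\eta_j(x_0,x_T)=0$ for $1\le j\le d_\eta$ and $\varphi_i(x_0,x_T)\le 0$ for $1\le i\le d_\varphi$. Elements of $\mathcal W$ satisfying these constraints are called feasible. A feasible $\hat w=(\hat x,\hat u,\hat v)$ is a *weak minimum* if for some $\varepsilon>0$ it minimizes $\varphi_0(x_0,x_T)$ among the feasible $w$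 with $\|x-\hat x\|_\infty<\varepsilon$, $\|u-\hat u\|_\infty<\varepsilon$, $\|v-\hat v\|_\infty<\varepsilon$. Assume that all inequality constraints are active: $\varphi_i(\hat x_0,\hat x_T)=0$ for $1\le i\le d_\varphi$. **Multipliers.** For $\lambda=(\alpha,\beta,p)\in\mathbb R^{d_\varphi+1}\times\mathbb R^{d_\eta}\times W^{1,\infty}(0,T;\mathbb R^{n,*})$ put $H[\lambda](x,u,v,t)=p_tF(x,u,v)$ and $\ell[\lambda]=\sum_{i=0}^{d_\varphi}\alpha_i\varphi_i+\sum_{j=1}^{d_\eta}\beta_j\eta_j$. The set $\Lambda$ consists of the $\lambda$ with $\sum_i|\alpha_i|+\sum_j|\beta_j|=1$, $\alpha\ge 0$, $-\dot p_t=H_x[\lambda](\hat w_t,t)$ a.e., $p_0=-D_{x_0}\ell[\lambda](\hat x_0,\hat x_T)$, $p_T=D_{x_T}\ell[\lambda](\hat x_0,\hat x_T)$, and $H_u[\lambda](\hat w_t,t)=0$, $H_v[\lambda](\hat w_t,t)=0$ a.e. on $[0,T]$. **Second variation and critical cone.** Let $\mathcal W_2=W^{1,2}(0,T;\mathbb R^n)\times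 L^2(0,T;\mathbb R^l)\times L^2(0,T;\mathbb R^m)$, let $\mathcal H_2$ be the set of $\bar w=(\bar x,\bar u,\bar v)\in\mathcal W_2$ with $\dot{\bar x}_t=DF(\hat w_t)\bar w_t$ a.e. on $[0,T]$, and let $\mathcal C_2$ be the set of $\bar w\in\mathcal H_2$ with $D\eta_j(\hat x_0,\hat x_T)(\bar x_0,\bar x_T)=0$ for $1\le j\le d_\eta$ and $D\varphi_i(\hat x_0,\hat x_T)(\bar x_0,\bar x_T)\le 0$ for $0\le i\le d_\varphi$. For $\bar w\in\mathcal W_2$ put $$\Omega[\lambda](\bar w)=\tfrac12D^2\ell[\lambda](\hat x_0,\hat x_T)(\bar x_0,\bar x_T)^2+\int_0^T\Big[\tfrac12\bar x^\top H_{xx}\bar x+\bar u^\top H_{ux}\bar x+\bar v^\top H_{vx}\bar x+\tfrac12\bar u^\top H_{uu}\bar u+\bar v^\top H_{vu}\bar u\Big]dt,$$ where the derivatives of $H=H[\lambda]$ are evaluated at $(\hat w_t,t)$. Let $\Lambda^{\#}$ be the set of $\lambda\in\Lambda$ for which $\Omega[\lambda]$ is sequentially weakly lower semicontinuous on $\mathcal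 H_2$. **Theorem.** If $\hat w$ is a weak minimum of (P), then $$\Lambda^{\#}=\{\lambda\in\Lambda:\ H_{uu}[\lambda](\hat w_t,t)\succeq 0\ \text{and}\ H_{vu}[\lambda](\hat w_t,t)=0\ \text{for a.e. }t\in[0,T]\},$$ and for every $\bar w\in\mathcal C_2$ the maximum of $\Omega[\lambda](\bar w)$ over $\lambda\in\Lambda^{\#}$ is attained (in particular $\Lambda^{\#}\neq\emptyset$) and $$\max_{\lambda\in\Lambda^{\#}}\Omega[\lambda](\bar w)\ge 0.$$ -/

import Mathlib

open MeasureTheory Filter Topology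
open scoped ENNReal

noncomputable section

namespace PartiallyAffine

/-- `ℝᵏ` with the Euclidean norm. -/
abbrev Vec (k : ℕ) : Type := EuclideanSpace ℝ (Fin k)

/-- Lebesgue measure on the time interval `[0, T]`. -/
def timeMeasure (T : ℝ) : Measure ℝ := volume.restrict (Set.Icc 0 T)

/-- The Sobolev space `W^{1,q}(0,T;E)`: on `[0,T]` the function `x` is the primitive of a
function of class `L^q` (its weak derivative, which is a.e. equal to `deriv x`). Functions are
defined on all of `ℝ`, but only their values on `[0,T]` matter. -/
def MemW1 {E : Type*} [NormedAddCommGroup E] [NormedSpace ℝ E]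
    (q : ℝ≥0∞) (T : ℝ) (x : ℝ → E) : Prop :=
  ∃ y : ℝ → E, MemLp y q (timeMeasure T) ∧
    ∀ t ∈ Set.Icc (0 : ℝ) T, x t = x 0 + ∫ s in (0 : ℝ)..t, y s

/-- A triple `w = (x,u,v)` of a state, a nonlinear control and an affine control. -/
structure Triple (n l m : ℕ) where
  x : ℝ → Vec n
  u : ℝ → Vec l
  v : ℝ → Vec m

variable {n l m dφ dη : ℕ}

/-- The point `(x_t, u_t, v_t)`. -/
def Triple.at (w : Triple n l m) (t : ℝ) : Vec n × Vec l × Vec m := (w.x t, w.u t, w.v t)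

/-- The space `W^{1,q} × L^q × L^q`: it is `𝒲` for `q = ∞` and `𝒲₂` for `q = 2`. -/
def MemW (q : ℝ≥0∞) (T : ℝ) (w : Triple n l m) : Prop :=
  MemW1 q T w.x ∧ MemLp w.u q (timeMeasure T) ∧ MemLp w.v q (timeMeasure T)

/-- The inner product of the Hilbert space `𝒲₂ = W^{1,2} × L² × L²`. -/
def innerW2 (T : ℝ) (w z : Triple n l m) : ℝ :=
  (∫ t, inner ℝ (w.x t) (z.x t) ∂(timeMeasure T)) +
  (∫ t, inner ℝ (deriv w.x t) (deriv z.x t) ∂(timeMeasure T)) +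
  (∫ t, inner ℝ (w.u t) (z.u t) ∂(timeMeasure T)) +
  (∫ t, inner ℝ (w.v t) (z.v t) ∂(timeMeasure T))

/-- Weak convergence of a sequence in the Hilbert space `𝒲₂`. -/
def WeakConvW2 (T : ℝ) (ws : ℕ → Triple n l m) (w : Triple n l m) : Prop :=
  ∀ z : Triple n l m, MemW 2 T z →
    Tendsto (fun k => innerW2 T (ws k) z) atTop (𝓝 (innerW2 T w z))

/-- `Φ` is (sequentially) weakly lower semicontinuous on the set `S ⊆ 𝒲₂`, i.e.
`Φ w ≤ liminf Φ (ws k)` whenever `ws k ⇀ w` in `S`. -/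
def WeaklyLSCOn (T : ℝ) (Φ : Triple n l m → ℝ) (S : Set (Triple n l m)) : Prop :=
  ∀ w ∈ S, ∀ ws : ℕ → Triple n l m, (∀ k, ws k ∈ S) → WeakConvW2 T ws w →
    ∀ c : ℝ, c < Φ w → ∀ᶠ k in atTop, c < Φ (ws k)

/-- The data of the partially affine Mayer problem. The vector fields are `f₀, …, f_m`, the
cost is `φ₀`, the inequality constraints are `φ₁, …, φ_{dφ}`, the equality constraints are
`η₁, …, η_{dη}`. -/
structure MayerProblem (n l m dφ dη : ℕ) where
  T : ℝ
  f : Fin (m + 1) → Vec n × Vec l → Vec n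
  φ : Fin (dφ + 1) → Vec n × Vec n → ℝ
  η : Fin dη → Vec n × Vec n → ℝ

/-- `g` is twice continuously differentiable with Lipschitz continuous second derivative. -/
def LipschitzSecondDeriv {E G : Type*} [NormedAddCommGroup E] [NormedSpace ℝ E]
    [NormedAddCommGroup G] [NormedSpace ℝ G] (g : E → G) : Prop :=
  ContDiff ℝ 2 g ∧ ∃ K : NNReal, LipschitzWith K (fderiv ℝ (fderiv ℝ g))

/-- An element `(α, β, p)` of `ℝ^{dφ+1,*} × ℝ^{dη,*} × {functions of time into ℝ^{n,*}}`. -/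
structure Multiplier (n dφ dη : ℕ) where
  α : Fin (dφ + 1) → ℝ
  β : Fin dη → ℝ
  p : ℝ → StrongDual ℝ (Vec n)

namespace MayerProblem

variable (P : MayerProblem n l m dφ dη)

/-- All data functions have Lipschitz continuous second derivatives. -/
def Regular : Prop :=
  (∀ i, LipschitzSecondDeriv (P.f i)) ∧ (∀ i, LipschitzSecondDeriv (P.φ i)) ∧
    ∀ j, LipschitzSecondDeriv (P.η j)

/-- `F(x,u,v) = f₀(x,u) + ∑ᵢ vᵢ fᵢ(x,u)`. -/
def F (z : Vec n × Vec l × Vec m) : Vec n :=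
  P.f 0 (z.1, z.2.1) + ∑ i : Fin m, z.2.2 i • P.f i.succ (z.1, z.2.1)

/-- The endpoints `(x_0, x_T)`. -/
def endpoints (w : Triple n l m) : Vec n × Vec n := (w.x 0, w.x P.T)

/-- Trajectories: elements of `𝒲` that satisfy the state equation. -/
def IsTrajectory (w : Triple n l m) : Prop :=
  MemW ∞ P.T w ∧ ∀ᵐ t ∂(timeMeasure P.T), HasDerivAt w.x (P.F (w.at t)) t

def IsFeasible (w : Triple n l m) : Prop :=
  P.IsTrajectory w ∧ (∀ j, P.η j (P.endpoints w) = 0) ∧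
    ∀ i : Fin dφ, P.φ i.succ (P.endpoints w) ≤ 0

def cost (w : Triple n l m) : ℝ := P.φ 0 (P.endpoints w)

def IsWeakMinimum (ŵ : Triple n l m) : Prop :=
  P.IsFeasible ŵ ∧ ∃ ε : ℝ, 0 < ε ∧ ∀ w : Triple n l m, P.IsFeasible w →
    eLpNorm (w.x - ŵ.x) ∞ (timeMeasure P.T) < ENNReal.ofReal ε →
    eLpNorm (w.u - ŵ.u) ∞ (timeMeasure P.T) < ENNReal.ofReal ε →
    eLpNorm (w.v - ŵ.v) ∞ (timeMeasure P.T) < ENNReal.ofReal ε →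
    P.cost ŵ ≤ P.cost w

/-- The pre-Hamiltonian `H[λ](x,u,v,t) = p_t F(x,u,v)`; time enters through `p = p_t` only. -/
def H (p : StrongDual ℝ (Vec n)) (z : Vec n × Vec l × Vec m) : ℝ := p (P.F z)

/-- The endpoint Lagrangian. -/
def ell (lam : Multiplier n dφ dη) (q : Vec n × Vec n) : ℝ :=
  ∑ i, lam.α i * P.φ i q + ∑ j, lam.β j * P.η j q

/-- The gradient of `H[λ](·,t)` in `(x,u,v)` at the point `ŵ_t`. -/
def DH (ŵ : Triple n l m) (lam : Multiplier n dφ dη) (t : ℝ) :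
    StrongDual ℝ (Vec n × Vec l × Vec m) :=
  fderiv ℝ (P.H (lam.p t)) (ŵ.at t)

/-- The second derivative of `H[λ](·,t)` in `(x,u,v)` at the point `ŵ_t`, as a bilinear form. -/
def D2H (ŵ : Triple n l m) (lam : Multiplier n dφ dη) (t : ℝ)
    (a b : Vec n × Vec l × Vec m) : ℝ :=
  fderiv ℝ (fderiv ℝ (P.H (lam.p t))) (ŵ.at t) a b

/-- The blocks of the second derivative of `H`, as bilinear forms:
`Hvu ŵ λ t b a` is `bᵀ H_vu[λ] a`, and so on. -/
def Hxx (ŵ : Triple n l m) (lam : Multiplier n dφ dη) (t : ℝ) (a b : Vec n) : ℝ :=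
  P.D2H ŵ lam t (a, 0, 0) (b, 0, 0)

def Hux (ŵ : Triple n l m) (lam : Multiplier n dφ dη) (t : ℝ) (a : Vec l) (b : Vec n) : ℝ :=
  P.D2H ŵ lam t (0, a, 0) (b, 0, 0)

def Hvx (ŵ : Triple n l m) (lam : Multiplier n dφ dη) (t : ℝ) (a : Vec m) (b : Vec n) : ℝ :=
  P.D2H ŵ lam t (0, 0, a) (b, 0, 0)

def Huu (ŵ : Triple n l m) (lam : Multiplier n dφ dη) (t : ℝ) (a b : Vec l) : ℝ :=
  P.D2H ŵ lam t (0, a, 0) (0, b, 0)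

def Hvu (ŵ : Triple n l m) (lam : Multiplier n dφ dη) (t : ℝ) (a : Vec m) (b : Vec l) : ℝ :=
  P.D2H ŵ lam t (0, 0, a) (0, b, 0)

/-- The Lagrange multipliers associated with `ŵ`. -/
structure IsLagrangeMultiplier (ŵ : Triple n l m) (lam : Multiplier n dφ dη) : Prop where
  memW1 : MemW1 ∞ P.T lam.p
  nontrivial : ∑ i, |lam.α i| + ∑ j, |lam.β j| = 1
  nonneg : ∀ i, 0 ≤ lam.α i
  costate : ∀ᵐ t ∂(timeMeasure P.T),
    HasDerivAt lam.p (-(P.DH ŵ lam t ∘L ContinuousLinearMap.inl ℝ (Vec n) (Vec l × Vec m))) t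
  transversality_zero : lam.p 0 =
    -(fderiv ℝ (P.ell lam) (P.endpoints ŵ) ∘L ContinuousLinearMap.inl ℝ (Vec n) (Vec n))
  transversality_T : lam.p P.T =
    fderiv ℝ (P.ell lam) (P.endpoints ŵ) ∘L ContinuousLinearMap.inr ℝ (Vec n) (Vec n)
  stationarity_u : ∀ᵐ t ∂(timeMeasure P.T), ∀ a : Vec l, P.DH ŵ lam t (0, a, 0) = 0
  stationarity_v : ∀ᵐ t ∂(timeMeasure P.T), ∀ a : Vec m, P.DH ŵ lam t (0, 0, a) = 0

/-- The set `Λ` of Lagrange multipliers. -/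
def multipliers (ŵ : Triple n l m) : Set (Multiplier n dφ dη) :=
  {lam | P.IsLagrangeMultiplier ŵ lam}

/-- The space `ℋ₂` of elements of `𝒲₂` that solve the linearized state equation
`ẋ̄ = F_x x̄ + F_u ū + F_v v̄` along `ŵ`. -/
def linearized (ŵ : Triple n l m) : Set (Triple n l m) :=
  {w | MemW 2 P.T w ∧
    ∀ᵐ t ∂(timeMeasure P.T), HasDerivAt w.x (fderiv ℝ P.F (ŵ.at t) (w.at t)) t}

/-- The critical cone `𝒞₂` in `𝒲₂`. -/
def criticalCone (ŵ : Triple n l m) : Set (Triple n l m) :=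
  {w | w ∈ P.linearized ŵ ∧
    (∀ j, fderiv ℝ (P.η j) (P.endpoints ŵ) (P.endpoints w) = 0) ∧
    ∀ i, fderiv ℝ (P.φ i) (P.endpoints ŵ) (P.endpoints w) ≤ 0}

/-- The second variation `Ω[λ](x̄,ū,v̄)`. -/
def Omega (ŵ : Triple n l m) (lam : Multiplier n dφ dη) (w : Triple n l m) : ℝ :=
  1 / 2 * fderiv ℝ (fderiv ℝ (P.ell lam)) (P.endpoints ŵ) (P.endpoints w) (P.endpoints w) +
  ∫ t, (1 / 2 * P.Hxx ŵ lam t (w.x t) (w.x t) + P.Hux ŵ lam t (w.u t) (w.x t) +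
    P.Hvx ŵ lam t (w.v t) (w.x t) + 1 / 2 * P.Huu ŵ lam t (w.u t) (w.u t) +
    P.Hvu ŵ lam t (w.v t) (w.u t)) ∂(timeMeasure P.T)

/-- The set `Λ^#` of the multipliers for which `Ω[λ]` is weakly l.s.c. on `ℋ₂`. -/
def multipliersSharp (ŵ : Triple n l m) : Set (Multiplier n dφ dη) :=
  {lam | lam ∈ P.multipliers ŵ ∧ WeaklyLSCOn P.T (P.Omega ŵ lam) (P.linearized ŵ)}

end MayerProblem

end PartiallyAffine

end

/-! Optimality is read as a property of one map J, from initial states and bounded controls to the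
finitely many endpoint values: near the reference point u₀ no point satisfies the equalities and
strictly decreases all other components. The implicit function theorem in L^∞ makes J of class C²
near u₀ (`exists_isReduction`). With A = J'(u₀) and Q = J''(u₀), A gives the linearized endpoint
variation, and Q becomes, after duality with the costates, a vector of second variations.

The usual second-order argument yields, for a critical direction h, a multiplier with nonnegative
second variation, but not one in Λ^#. The missing information is in the curvature cone: the values
of Q(ξ,ξ) attainable, up to small errors, by ξ in ker A that are Q-orthogonal to any prescribed
finite set. Adding mutually orthogonal ξ of this kind to h leaves the first-order term alone and
adds an element of the cone at second order. Hence 0 is not interior to the convex set of all Az +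
½Q(h,h) + a + (positive slack), with a in the cone: otherwise a fixed point argument produces a
forbidden point (`exists_decrease_of_mem_interior`). Separation gives a multiplier that is also
nonnegative on the cone (`exists_multiplier_of_local_min`).

Controls concentrating at a time t show that for a.e. t the values of the Hessian on pure control
vectors lie in the cone (`hess_mem_curvatureCone`). Since H is affine in v, its vv block is zero, so
nonnegativity on these values says exactly H_uu ⪰ 0 and H_vu = 0. The same concentrations show that
this pointwise condition is necessary for weak lower semicontinuity. It is sufficient because states
converge uniformly boundedly and pointwise along weakly convergent sequences, so only the pure
control block survives in the limit (`multipliersSharp_eq`).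

Critical directions with L² controls are approximated by bounded ones with exactly the same first
variation (`exists_approx_direction`). A multiplier is determined by its coefficients (α, β), and
the admissible coefficients form a compact set (`isCompact_coefficients`). This allows the passage
to the limit (`exists_coefficients`) and gives attainment of the maximum. -/

open MeasureTheory Filter Topology
open scoped ENNReal

noncomputable section

namespace PartiallyAffine

/-! ### Curvature cones and second-order expansions along curves -/

section SecondOrderConditions

variable {U : Type*} [NormedAddCommGroup U] [NormedSpace ℝ U]
  {E : Type*} [NormedAddCommGroup E] [NormedSpace ℝ E]

/-- The asymptotic cone of values of the quadratic map `ξ ↦ Q ξ ξ` on the kernel of `A`: the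
vectors that can be approximated by values of `Q` on the kernel of `A` and of finitely many
functionals `Q ζ`. -/
def curvatureCone (A : U →L[ℝ] E) (Q : U →L[ℝ] U →L[ℝ] E) : Set E :=
  {s | ∀ (Z : Finset U) (δ : ℝ), 0 < δ →
    ∃ ξ : U, A ξ = 0 ∧ (∀ ζ ∈ Z, Q ζ ξ = 0) ∧ ‖Q ξ ξ - s‖ < δ}

variable {A : U →L[ℝ] E} {Q : U →L[ℝ] U →L[ℝ] E}

lemma curvatureCone_zero : (0 : E) ∈ curvatureCone A Q := fun _ δ hδ =>
  ⟨0, by simp, by simp, by simpa using hδ⟩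

lemma curvatureCone_smul {s : E} (hs : s ∈ curvatureCone A Q) {t : ℝ} (ht : 0 ≤ t) :
    t • s ∈ curvatureCone A Q := by
  intro Z δ hδ
  -- Dividing by t + 1 rather than t covers t = 0 as well.
  obtain ⟨ξ, h1, h2, h3⟩ := hs Z (δ / (t + 1)) (by positivity)
  refine ⟨√t • ξ, by simp [h1], fun ζ hζ => by simp [h2 ζ hζ], ?_⟩
  have : Q (√t • ξ) (√t • ξ) - t • s = t • (Q ξ ξ - s) := by
    simp only [map_smul, smul_sub, smul_apply, smul_smul, Real.mul_self_sqrt ht]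
  rw [this, norm_smul, Real.norm_of_nonneg ht]
  rw [lt_div_iff₀ (by positivity)] at h3
  nlinarith [norm_nonneg (Q ξ ξ - s)]

/-- The second approximant is taken Q-orthogonal to the first by adding the first to the test set,
so the cross term vanishes. This is why membership in the cone quantifies over all finite sets of
test vectors. -/
lemma curvatureCone_add (hQ : ∀ a b, Q a b = Q b a) {s s' : E} (hs : s ∈ curvatureCone A Q)
    (hs' : s' ∈ curvatureCone A Q) : s + s' ∈ curvatureCone A Q := by
  classical
  intro Z δ hδ
  obtain ⟨ξ, h1, h2, h3⟩ := hs Z (δ / 2) (by positivity)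
  obtain ⟨ξ', h1', h2', h3'⟩ := hs' (insert ξ Z) (δ / 2) (by positivity)
  refine ⟨ξ + ξ', by simp [h1, h1'], fun ζ hζ => by
    simp [h2 ζ hζ, h2' ζ (Finset.mem_insert_of_mem hζ)], ?_⟩
  have hx : Q ξ ξ' = 0 := h2' ξ (Finset.mem_insert_self _ _)
  have : Q (ξ + ξ') (ξ + ξ') - (s + s') = (Q ξ ξ - s) + (Q ξ' ξ' - s') := by
    simp only [map_add, add_apply, hQ ξ' ξ, hx]; abel
  rw [this]
  exact (norm_add_le _ _).trans_lt (by linarith)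

/-- Limits of `Q (ξ k) (ξ k)` along sequences that are asymptotically in the kernel of `A` and
of all functionals `Q ζ` belong to the asymptotic cone. -/
lemma mem_curvatureCone_of_tendsto [FiniteDimensional ℝ E] (hQ : ∀ a b, Q a b = Q b a)
    {ξ : ℕ → U} {s : E}
    (h1 : Tendsto (fun k => A (ξ k)) atTop (𝓝 0))
    (h2 : ∀ ζ, Tendsto (fun k => Q ζ (ξ k)) atTop (𝓝 0))
    (h3 : Tendsto (fun k => Q (ξ k) (ξ k)) atTop (𝓝 s)) : s ∈ curvatureCone A Q := by
  intro Z δ hδ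
  -- F collects all the conditions that must hold exactly. Its range is finite dimensional, so a
  -- linear right inverse g on the range turns the small defects F (ξ k) into small corrections, and
  -- ξ k − g (F (ξ k)) lies in ker F.
  let F : U →ₗ[ℝ] E × (Z → E) :=
    (A : U →ₗ[ℝ] E).prod (LinearMap.pi fun ζ : Z => ((Q ζ : U →L[ℝ] E) : U →ₗ[ℝ] E))
  have hF : Tendsto (fun k => F (ξ k)) atTop (𝓝 0) := by
    have : Tendsto (fun k => (A (ξ k), fun ζ : Z => Q ζ (ξ k))) atTop
        (𝓝 ((0 : E), (0 : Z → E))) :=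
      h1.prodMk_nhds (tendsto_pi_nhds.2 fun ζ => h2 ζ)
    exact this
  obtain ⟨g, hg⟩ := F.rangeRestrict.exists_rightInverse_of_surjective
    (LinearMap.range_rangeRestrict F)
  have hgF : ∀ y, F (g y) = y := fun y => by
    have := congrArg (fun L => ((L y : LinearMap.range F) : E × (Z → E))) hg
    simpa using this
  let b := Module.finBasis ℝ (LinearMap.range F)
  let y : ℕ → LinearMap.range F := fun k => F.rangeRestrict (ξ k)
  have hy : Tendsto y atTop (𝓝 0) := by
    rw [tendsto_subtype_rng]; simpa [y] using hF
  have hcoord : ∀ i, Tendsto (fun k => b.coord i (y k)) atTop (𝓝 0) := fun i => by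
    have := ((b.coord i).continuous_of_finiteDimensional.tendsto 0).comp hy
    simpa using! this
  have hgy : ∀ k, g (y k) = ∑ i, b.coord i (y k) • g (b i) := fun k => by
    conv_lhs => rw [← b.sum_repr (y k), map_sum]
    simp only [map_smul, Module.Basis.coord_apply]
  have hgc : Tendsto (fun k => g (y k)) atTop (𝓝 0) := by
    have := (g.continuous_of_finiteDimensional.tendsto 0).comp hy
    simpa using! this
  -- No bound on ‖ξ k‖ is available, so the cross term is expanded over the finitely many fixed
  -- vectors g (b i), where `h2` applies.
  have hcross : Tendsto (fun k => Q (g (y k)) (ξ k)) atTop (𝓝 0) := by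
    have : ∀ k, Q (g (y k)) (ξ k) = ∑ i, b.coord i (y k) • Q (g (b i)) (ξ k) := fun k => by
      rw [hgy]; simp [map_sum]
    simp_rw [this]
    have := tendsto_finsetSum (Finset.univ) fun i (_ : i ∈ Finset.univ) =>
      (hcoord i).smul (h2 (g (b i)))
    simpa using this
  have hsq : Tendsto (fun k => Q (g (y k)) (g (y k))) atTop (𝓝 0) := by
    have := ((by fun_prop : Continuous fun x => Q x x).tendsto 0).comp hgc
    simpa using! this
  have hlim : Tendsto (fun k => Q (ξ k - g (y k)) (ξ k - g (y k))) atTop (𝓝 s) := by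
    have := ((h3.sub hcross).sub hcross).add hsq
    simp only [sub_zero, add_zero] at this
    refine this.congr fun k => ?_
    simp only [map_sub, sub_apply, hQ (ξ k) (g (y k))]
    abel
  have := (Metric.tendsto_nhds.1 hlim δ hδ).exists
  obtain ⟨k, hk⟩ := this
  have hker : F (ξ k - g (y k)) = 0 := by
    rw [map_sub, hgF]; simp [y]
  refine ⟨ξ k - g (y k), congrArg Prod.fst hker, fun ζ hζ => ?_, by rwa [dist_eq_norm] at hk⟩
  exact congrFun (congrArg Prod.snd hker) ⟨ζ, hζ⟩

/-- Mutually `Q`-orthogonal realizations of a finite family in the asymptotic cone. -/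
lemma exists_orthogonal_family {ι : Type*} [Fintype ι] (hQ : ∀ a b, Q a b = Q b a)
    (s : ι → E) (hs : ∀ i, s i ∈ curvatureCone A Q) (h : U) {δ : ℝ} (hδ : 0 < δ) :
    ∃ ξ : ι → U, (∀ i, A (ξ i) = 0 ∧ Q h (ξ i) = 0 ∧ ‖Q (ξ i) (ξ i) - s i‖ < δ) ∧
      ∀ i j, i ≠ j → Q (ξ i) (ξ j) = 0 := by
  classical
  suffices H : ∀ S : Finset ι, ∃ ξ : ι → U,
      (∀ i ∈ S, A (ξ i) = 0 ∧ Q h (ξ i) = 0 ∧ ‖Q (ξ i) (ξ i) - s i‖ < δ) ∧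
      ∀ i ∈ S, ∀ j ∈ S, i ≠ j → Q (ξ i) (ξ j) = 0 by
    obtain ⟨ξ, h1, h2⟩ := H Finset.univ
    exact ⟨ξ, fun i => h1 i (Finset.mem_univ _),
      fun i j => h2 i (Finset.mem_univ _) j (Finset.mem_univ _)⟩
  intro S
  induction S using Finset.induction_on with
  | empty => exact ⟨0, by simp, by simp⟩
  | insert a S ha ih =>
    obtain ⟨ξ, h1, h2⟩ := ih
    -- The new realization is tested against h and all earlier ones.
    obtain ⟨x, hx1, hx2, hx3⟩ := hs a (insert h (S.image ξ)) δ hδ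
    have hne : ∀ i ∈ S, i ≠ a := fun i hi e => ha (e ▸ hi)
    have hxS : ∀ i ∈ S, Q (ξ i) x = 0 := fun i hi =>
      hx2 _ (Finset.mem_insert_of_mem (Finset.mem_image_of_mem ξ hi))
    refine ⟨Function.update ξ a x, fun i hi => ?_, fun i hi j hj hij => ?_⟩
    · rcases Finset.mem_insert.1 hi with rfl | hi
      · simpa using ⟨hx1, hx2 h (Finset.mem_insert_self _ _), hx3⟩
      · simpa [Function.update_of_ne (hne i hi)] using h1 i hi
    · rcases Finset.mem_insert.1 hi with rfl | hi <;> rcases Finset.mem_insert.1 hj with rfl | hj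
      · exact absurd rfl hij
      · simpa [Function.update_of_ne (hne j hj), hQ x] using hxS j hj
      · rename_i hi'
        simpa [Function.update_of_ne (hne i hi')] using hxS i hi'
      · simpa [Function.update_of_ne (hne i hi), Function.update_of_ne (hne j hj)]
          using h2 i hi j hj hij

/-- The second order Taylor remainder is Lipschitz with a small constant near the base point. -/
lemma taylorRemainder_lipschitz {J : U → E} {u₀ : U} (hJ : ContDiffAt ℝ 2 J u₀) {κ : ℝ}
    (hκ : 0 < κ) : ∃ r > 0, ∀ ρ ≤ r, ∀ d d' : U, ‖d‖ ≤ ρ → ‖d'‖ ≤ ρ →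
      ‖(J (u₀ + d) - fderiv ℝ J u₀ d - (1 / 2 : ℝ) • fderiv ℝ (fderiv ℝ J) u₀ d d) -
        (J (u₀ + d') - fderiv ℝ J u₀ d' - (1 / 2 : ℝ) • fderiv ℝ (fderiv ℝ J) u₀ d' d')‖
        ≤ κ * ρ * ‖d - d'‖ := by
  set A := fderiv ℝ J u₀ with hA
  set Q := fderiv ℝ (fderiv ℝ J) u₀ with hQdef
  have hsymm : ∀ a b, Q a b = Q b a := fun a b =>
    (hJ.isSymmSndFDerivAt (by simp)) a b
  have hd1 : ∀ᶠ u in 𝓝 u₀, DifferentiableAt ℝ J u :=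
    (hJ.eventually (by simp)).mono fun u hu => hu.differentiableAt (by simp)
  have hd2 : HasFDerivAt (fderiv ℝ J) Q u₀ :=
    ((hJ.fderiv_right (m := 1) (by norm_num)).differentiableAt (by simp)).hasFDerivAt
  have hlo := (hasFDerivAt_iff_isLittleO_nhds_zero.1 hd2).def hκ
  have hd1' : ∀ᶠ d in 𝓝 (0 : U), DifferentiableAt ℝ J (u₀ + d) := by
    have : Tendsto (fun d : U => u₀ + d) (𝓝 0) (𝓝 u₀) := by
      have := (continuous_const.add continuous_id : Continuous fun d : U => u₀ + d).tendsto 0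
      simpa using! this
    exact this.eventually hd1
  obtain ⟨r, hr, hball⟩ := Metric.eventually_nhds_iff_ball.1 (hlo.and hd1')
  refine ⟨r / 2, by positivity, fun ρ hρ d d' hd hd' => ?_⟩
  -- Differentiability of J' at u₀ alone gives ‖R'(x)‖ = ‖J'(u₀ + x) − A − Qx‖ ≤ κ‖x‖; the mean
  -- value inequality on the ball of radius ρ turns this into the Lipschitz constant κρ.
  let R : U → E := fun d => J (u₀ + d) - A d - (1 / 2 : ℝ) • Q d d
  have hder : ∀ x ∈ Metric.closedBall (0 : U) ρ, HasFDerivWithinAt R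
      (fderiv ℝ J (u₀ + x) - A - Q x) (Metric.closedBall (0 : U) ρ) x := by
    intro x hx
    have hx' : x ∈ Metric.ball (0 : U) r :=
      Metric.closedBall_subset_ball (by linarith) hx
    have h1 : HasFDerivAt (fun d => J (u₀ + d)) (fderiv ℝ J (u₀ + x)) x := by
      have := (hball x hx').2.hasFDerivAt.comp x ((hasFDerivAt_id x).const_add u₀)
      simpa using! this
    have h2 : HasFDerivAt (fun d => Q d d) ((2 : ℝ) • Q x) x := by
      have := Q.hasFDerivAt (x := x) |>.clm_apply (hasFDerivAt_id x)
      refine this.congr_fderiv ?_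
      ext y
      simp [two_smul, hsymm y x]
    have := ((h1.sub A.hasFDerivAt).sub (h2.const_smul (1 / 2 : ℝ))).hasFDerivWithinAt
      (s := Metric.closedBall (0 : U) ρ)
    refine this.congr_fderiv ?_
    simp [smul_smul]
  have hbound : ∀ x ∈ Metric.closedBall (0 : U) ρ, ‖fderiv ℝ J (u₀ + x) - A - Q x‖ ≤ κ * ρ := by
    intro x hx
    have hx' : x ∈ Metric.ball (0 : U) r :=
      Metric.closedBall_subset_ball (by linarith) hx
    refine (hball x hx').1.trans ?_
    gcongr
    simpa using hx
  exact (convex_closedBall (0 : U) ρ).norm_image_sub_le_of_norm_hasFDerivWithin_le hder hbound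
    (by simpa using hd') (by simpa using hd)

/-- Along the curve `u₀ + ε (h + ∑ √cᵢ ξᵢ) + ε² ∑ cᵢ zᵢ`, with `Q`-orthogonal `ξᵢ` in the kernel
of `A`, the map `J` is an affine function of the weights up to an error that is small in
Lipschitz norm. -/
lemma exists_curve_expansion {J : U → E} {u₀ : U} (hJ : ContDiffAt ℝ 2 J u₀)
    (hA : A = fderiv ℝ J u₀) (hQ : Q = fderiv ℝ (fderiv ℝ J) u₀)
    {V : Set U} (hV : V ∈ 𝓝 u₀) {ι P : Type*} [Fintype ι] [NormedAddCommGroup P]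
    {B : Set P} {c : ι → P → ℝ}
    (hc0 : ∀ i, ∀ τ ∈ B, 0 ≤ c i τ ∧ c i τ ≤ 1) (hc1 : ∀ τ ∈ B, ∑ i, c i τ = 1)
    (hcL : ∀ i, ∀ τ ∈ B, ∀ τ' ∈ B, |c i τ - c i τ'| ≤ ‖τ - τ'‖)
    (hsL : ∀ i, ∀ τ ∈ B, ∀ τ' ∈ B, |√(c i τ) - √(c i τ')| ≤ ‖τ - τ'‖)
    (h : U) (ξ z : ι → U) (hAξ : ∀ i, A (ξ i) = 0) (hhξ : ∀ i, Q h (ξ i) = 0)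
    (hξξ : ∀ i j, i ≠ j → Q (ξ i) (ξ j) = 0) {η : ℝ} (hη : 0 < η) :
    ∃ (ε : ℝ) (u : P → U) (ρ : P → E), 0 < ε ∧ (∀ τ ∈ B, u τ ∈ V) ∧
      (∀ τ ∈ B, J (u τ) = J u₀ + ε • A h + ε ^ 2 •
        (∑ i, c i τ • (A (z i) + (1 / 2 : ℝ) • Q h h + (1 / 2 : ℝ) • Q (ξ i) (ξ i)) + ρ τ)) ∧
      (∀ τ ∈ B, ‖ρ τ‖ ≤ η) ∧ ∀ τ ∈ B, ∀ τ' ∈ B, ‖ρ τ - ρ τ'‖ ≤ η * ‖τ - τ'‖ := by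
  have hsymm : ∀ a b, Q a b = Q b a := fun a b => by
    rw [hQ]; exact (hJ.isSymmSndFDerivAt (by simp)) a b
  set C : ℝ := ‖h‖ + ∑ i, ‖ξ i‖ + ∑ i, ‖z i‖ + 1 with hC
  have hC1 : 1 ≤ C := by
    have := Finset.sum_nonneg fun i (_ : i ∈ Finset.univ) => norm_nonneg (ξ i)
    have := Finset.sum_nonneg fun i (_ : i ∈ Finset.univ) => norm_nonneg (z i)
    have := norm_nonneg h
    linarith
  -- The square roots make Q(g,g) affine in the weights: by orthogonality it equals Q(h,h) + ∑ cᵢ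
  -- Q(ξᵢ,ξᵢ), while A g = A h does not depend on τ.
  let g : P → U := fun τ => h + ∑ i, √(c i τ) • ξ i
  let y : P → U := fun τ => ∑ i, c i τ • z i
  have hs1 : ∀ i, ∀ τ ∈ B, |√(c i τ)| ≤ 1 := fun i τ hτ => by
    rw [abs_of_nonneg (Real.sqrt_nonneg _)]
    exact Real.sqrt_le_one.2 (hc0 i τ hτ).2
  have hcomb : ∀ (b : ι → ℝ) (w : ι → U) (L : ℝ), (∀ i, |b i| ≤ L) →
      ‖∑ i, b i • w i‖ ≤ L * ∑ i, ‖w i‖ := fun b w L hb => by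
    refine (norm_sum_le _ _).trans ?_
    rw [Finset.mul_sum]
    refine Finset.sum_le_sum fun i _ => ?_
    rw [norm_smul]
    exact mul_le_mul_of_nonneg_right (hb i) (norm_nonneg _)
  have hnn1 := Finset.sum_nonneg fun i (_ : i ∈ Finset.univ) => norm_nonneg (ξ i)
  have hnn2 := Finset.sum_nonneg fun i (_ : i ∈ Finset.univ) => norm_nonneg (z i)
  have hg : ∀ τ ∈ B, ‖g τ‖ ≤ C := fun τ hτ => by
    have := hcomb (fun i => √(c i τ)) ξ 1 fun i => hs1 i τ hτ
    have := norm_add_le h (∑ i, √(c i τ) • ξ i)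
    linarith
  have hy : ∀ τ ∈ B, ‖y τ‖ ≤ C := fun τ hτ => by
    have := hcomb (fun i => c i τ) z 1 fun i => by
      rw [abs_of_nonneg (hc0 i τ hτ).1]; exact (hc0 i τ hτ).2
    have := norm_nonneg h
    linarith
  have hgL : ∀ τ ∈ B, ∀ τ' ∈ B, ‖g τ - g τ'‖ ≤ C * ‖τ - τ'‖ := fun τ hτ τ' hτ' => by
    have h1 : g τ - g τ' = ∑ i, (√(c i τ) - √(c i τ')) • ξ i := by
      simp only [g, sub_smul, Finset.sum_sub_distrib]; abel
    rw [h1, mul_comm]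
    refine (hcomb _ ξ _ fun i => hsL i τ hτ τ' hτ').trans ?_
    gcongr
    linarith [norm_nonneg h]
  have hyL : ∀ τ ∈ B, ∀ τ' ∈ B, ‖y τ - y τ'‖ ≤ C * ‖τ - τ'‖ := fun τ hτ τ' hτ' => by
    have h1 : y τ - y τ' = ∑ i, (c i τ - c i τ') • z i := by
      simp only [y, sub_smul, Finset.sum_sub_distrib]
    rw [h1, mul_comm]
    refine (hcomb _ z _ fun i => hcL i τ hτ τ' hτ').trans ?_
    gcongr
    linarith [norm_nonneg h]
  -- The displacement d and its Lipschitz constant are both at most 2Cε, so this κ gives κ(2Cε)² =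
  -- ε²η/2, half of the allowed error after division by ε².
  obtain ⟨r, hr, hrem⟩ := taylorRemainder_lipschitz hJ (κ := η / (8 * C ^ 2)) (by positivity)
  obtain ⟨r', hr', hball⟩ := Metric.mem_nhds_iff.1 hV
  -- ε ≤ 1 absorbs ε² into ε; the two bounds on 2Cε keep the curve in the Taylor ball and in V; the
  -- last one spends the other half of η on the terms containing Q(g,y) and Q(y,y).
  obtain ⟨ε, hε, hε1, hεr, hεr', hεη⟩ : ∃ ε : ℝ, 0 < ε ∧ ε ≤ 1 ∧ 2 * C * ε ≤ r ∧
      2 * C * ε < r' ∧ ε * (3 * (‖Q‖ * C ^ 2)) ≤ η / 2 := by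
    have ev : ∀ᶠ ε : ℝ in 𝓝[>] 0, ε ≤ 1 ∧ 2 * C * ε ≤ r ∧ 2 * C * ε < r' ∧
        ε * (3 * (‖Q‖ * C ^ 2)) ≤ η / 2 := by
      have t1 : Tendsto (fun ε : ℝ => 2 * C * ε) (𝓝[>] 0) (𝓝 0) := by
        refine tendsto_nhdsWithin_of_tendsto_nhds ?_
        simpa using (by fun_prop : Continuous fun ε : ℝ => 2 * C * ε).tendsto 0
      have t2 : Tendsto (fun ε : ℝ => ε * (3 * (‖Q‖ * C ^ 2))) (𝓝[>] 0) (𝓝 0) := by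
        refine tendsto_nhdsWithin_of_tendsto_nhds ?_
        simpa using (by fun_prop : Continuous fun ε : ℝ => ε * (3 * (‖Q‖ * C ^ 2))).tendsto 0
      have t3 : ∀ᶠ ε : ℝ in 𝓝[>] 0, ε ≤ 1 :=
        (eventually_le_nhds (show (0 : ℝ) < 1 by norm_num)).filter_mono nhdsWithin_le_nhds
      filter_upwards [t3, t1.eventually (eventually_le_nhds hr),
        t1.eventually (eventually_lt_nhds hr'),
        t2.eventually (eventually_le_nhds (half_pos hη))] with ε a b c d
      exact ⟨a, b, c, d⟩
    obtain ⟨ε, h1, h2⟩ := (ev.and self_mem_nhdsWithin).exists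
    exact ⟨ε, h2, h1⟩
  let d : P → U := fun τ => ε • g τ + ε ^ 2 • y τ
  have hεsq : ε ^ 2 ≤ ε := by nlinarith
  have hd : ∀ τ ∈ B, ‖d τ‖ ≤ 2 * C * ε := fun τ hτ => by
    have h1 := norm_add_le (ε • g τ) (ε ^ 2 • y τ)
    rw [norm_smul, norm_smul, Real.norm_of_nonneg hε.le, Real.norm_of_nonneg (by positivity)] at h1
    have h2 : ε ^ 2 * ‖y τ‖ ≤ ε * C := mul_le_mul hεsq (hy τ hτ) (norm_nonneg _) hε.le
    have h3 : ε * ‖g τ‖ ≤ ε * C := mul_le_mul_of_nonneg_left (hg τ hτ) hε.le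
    exact h1.trans (by linarith)
  have hdL : ∀ τ ∈ B, ∀ τ' ∈ B, ‖d τ - d τ'‖ ≤ 2 * C * ε * ‖τ - τ'‖ := fun τ hτ τ' hτ' => by
    have h0 : d τ - d τ' = ε • (g τ - g τ') + ε ^ 2 • (y τ - y τ') := by
      simp only [d, smul_sub]; abel
    have h1 := norm_add_le (ε • (g τ - g τ')) (ε ^ 2 • (y τ - y τ'))
    rw [norm_smul, norm_smul, Real.norm_of_nonneg hε.le, Real.norm_of_nonneg (by positivity)] at h1
    have h2 : ε ^ 2 * ‖y τ - y τ'‖ ≤ ε * (C * ‖τ - τ'‖) :=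
      mul_le_mul hεsq (hyL τ hτ τ' hτ') (norm_nonneg _) hε.le
    have h3 : ε * ‖g τ - g τ'‖ ≤ ε * (C * ‖τ - τ'‖) :=
      mul_le_mul_of_nonneg_left (hgL τ hτ τ' hτ') hε.le
    rw [h0]
    exact h1.trans (by linarith)
  let R : U → E := fun d => J (u₀ + d) - A d - (1 / 2 : ℝ) • Q d d
  have hQb : ∀ a b, ‖Q a b‖ ≤ ‖Q‖ * (‖a‖ * ‖b‖) := fun a b => by
    rw [← mul_assoc]; exact Q.le_opNorm₂ a b
  have hQB : ∀ a : P → U, (∀ τ ∈ B, ‖a τ‖ ≤ C) → ∀ τ ∈ B, ‖Q (a τ) (y τ)‖ ≤ ‖Q‖ * C ^ 2 := by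
    intro a ha τ hτ
    refine (hQb _ _).trans ?_
    rw [sq]
    gcongr
    exacts [ha τ hτ, hy τ hτ]
  have hQL : ∀ a : P → U, (∀ τ ∈ B, ‖a τ‖ ≤ C) →
      (∀ τ ∈ B, ∀ τ' ∈ B, ‖a τ - a τ'‖ ≤ C * ‖τ - τ'‖) → ∀ τ ∈ B, ∀ τ' ∈ B,
      ‖Q (a τ) (y τ) - Q (a τ') (y τ')‖ ≤ 2 * (‖Q‖ * C ^ 2) * ‖τ - τ'‖ := by
    intro a ha haL τ hτ τ' hτ'
    have h1 : Q (a τ) (y τ) - Q (a τ') (y τ') = Q (a τ - a τ') (y τ) + Q (a τ') (y τ - y τ') := by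
      simp only [map_sub, sub_apply]; abel
    rw [h1]
    refine (norm_add_le _ _).trans ?_
    have h2 : ‖Q (a τ - a τ') (y τ)‖ ≤ ‖Q‖ * (C * ‖τ - τ'‖ * C) := by
      refine (hQb _ _).trans ?_
      gcongr
      exacts [haL τ hτ τ' hτ', hy τ hτ]
    have h3 : ‖Q (a τ') (y τ - y τ')‖ ≤ ‖Q‖ * (C * (C * ‖τ - τ'‖)) := by
      refine (hQb _ _).trans ?_
      gcongr
      exacts [ha τ' hτ', hyL τ hτ τ' hτ']
    nlinarith
  -- The Taylor remainder and the cubic and quartic parts of ½Q(d,d), all divided by ε².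
  let ρ : P → E := fun τ =>
    (ε ^ 2)⁻¹ • (R (d τ) - R 0) + (ε • Q (g τ) (y τ) + (ε ^ 2 / 2) • Q (y τ) (y τ))
  have hR0 : R 0 = J u₀ := by simp [R]
  have hQn : 0 ≤ ‖Q‖ * C ^ 2 := by positivity
  have hκ : η / (8 * C ^ 2) * (2 * C * ε) * (2 * C * ε) = ε ^ 2 * (η / 2) := by
    field_simp; ring
  have hinv : ∀ (v : E) (b : ℝ), ‖v‖ ≤ ε ^ 2 * (η / 2) * b → ‖(ε ^ 2)⁻¹ • v‖ ≤ η / 2 * b := by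
    intro v b hv
    rw [norm_smul, norm_inv, Real.norm_of_nonneg (by positivity), inv_mul_le_iff₀ (by positivity)]
    linarith
  refine ⟨ε, fun τ => u₀ + d τ, ρ, hε, fun τ hτ => hball ?_, fun τ hτ => ?_, fun τ hτ => ?_,
    fun τ hτ τ' hτ' => ?_⟩
  · rw [mem_ball_iff_norm]
    simpa using (hd τ hτ).trans_lt hεr'
  · have hAg : A (g τ) = A h := by simp [g, map_sum, hAξ]
    have hAy : A (y τ) = ∑ i, c i τ • A (z i) := by simp [y, map_sum]
    have hQg : Q (g τ) (g τ) = Q h h + ∑ i, c i τ • Q (ξ i) (ξ i) := by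
      have h1 : Q h (∑ i, √(c i τ) • ξ i) = 0 := by simp [map_sum, hhξ]
      have h2 : Q (∑ i, √(c i τ) • ξ i) (∑ i, √(c i τ) • ξ i) = ∑ i, c i τ • Q (ξ i) (ξ i) := by
        simp only [map_sum, map_smul, _root_.sum_apply, smul_apply]
        refine Finset.sum_congr rfl fun i _ => ?_
        rw [Finset.sum_eq_single i]
        · rw [smul_smul, Real.mul_self_sqrt (hc0 i τ hτ).1]
        · intro j _ hj; simp [hξξ j i hj]
        · simp
      simp only [g, map_add, add_apply, h1, h2]
      rw [hsymm (∑ i, √(c i τ) • ξ i) h, h1]; simp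
    have hsum : ∑ i, c i τ • (A (z i) + (1 / 2 : ℝ) • Q h h + (1 / 2 : ℝ) • Q (ξ i) (ξ i)) =
        A (y τ) + (1 / 2 : ℝ) • Q (g τ) (g τ) := by
      rw [hAy, hQg, smul_add, Finset.smul_sum]
      simp only [smul_add, Finset.sum_add_distrib, smul_comm (c _ τ) (1 / 2 : ℝ)]
      rw [← Finset.smul_sum, ← Finset.sum_smul, hc1 τ hτ, one_smul]
      abel
    have hJR : J (u₀ + d τ) = R (d τ) + A (d τ) + (1 / 2 : ℝ) • Q (d τ) (d τ) := by
      simp only [R]; abel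
    have hQd : Q (d τ) (d τ) = ε ^ 2 • Q (g τ) (g τ) + (2 * ε ^ 3) • Q (g τ) (y τ)
        + ε ^ 4 • Q (y τ) (y τ) := by
      simp only [d, map_add, map_smul, add_apply, smul_apply, hsymm (y τ) (g τ)]
      module
    have hAd : A (d τ) = ε • A h + ε ^ 2 • A (y τ) := by
      simp only [d, map_add, map_smul, hAg]
    have hρ : ε ^ 2 • ρ τ = (R (d τ) - J u₀) + ε ^ 3 • Q (g τ) (y τ)
        + (ε ^ 4 / 2) • Q (y τ) (y τ) := by
      simp only [ρ, smul_add, smul_smul, hR0]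
      rw [mul_inv_cancel₀ (by positivity), one_smul]
      module
    rw [hsum, smul_add, hρ, hJR, hQd, hAd]
    module
  · have h1 := hrem (2 * C * ε) hεr (d τ) 0 (hd τ hτ) (by simp; positivity)
    rw [← hA, ← hQ] at h1
    have h2 : ‖R (d τ) - R 0‖ ≤ ε ^ 2 * (η / 2) * 1 := by
      refine h1.trans ?_
      rw [sub_zero, mul_one, ← hκ]
      gcongr
      exact hd τ hτ
    have h3 := hinv _ _ h2
    have h4 : ‖ε • Q (g τ) (y τ) + (ε ^ 2 / 2) • Q (y τ) (y τ)‖ ≤ η / 2 := by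
      refine (norm_add_le _ _).trans ?_
      rw [norm_smul, norm_smul, Real.norm_of_nonneg hε.le, Real.norm_of_nonneg (by positivity)]
      have e1 := mul_le_mul_of_nonneg_left (hQB g hg τ hτ) hε.le
      have e2 := mul_le_mul (show ε ^ 2 / 2 ≤ ε by linarith) (hQB y hy τ hτ) (norm_nonneg _) hε.le
      linarith [mul_nonneg hε.le hQn]
    exact (norm_add_le _ _).trans (by linarith)
  · have h1 := hrem (2 * C * ε) hεr (d τ) (d τ') (hd τ hτ) (hd τ' hτ')
    rw [← hA, ← hQ] at h1
    have h2 : ‖R (d τ) - R (d τ')‖ ≤ ε ^ 2 * (η / 2) * ‖τ - τ'‖ := by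
      refine h1.trans ?_
      rw [← hκ, mul_assoc _ _ ‖τ - τ'‖]
      gcongr
      exact hdL τ hτ τ' hτ'
    have h3 := hinv _ _ h2
    have h4 : ‖ε • (Q (g τ) (y τ) - Q (g τ') (y τ')) +
        (ε ^ 2 / 2) • (Q (y τ) (y τ) - Q (y τ') (y τ'))‖ ≤ η / 2 * ‖τ - τ'‖ := by
      refine (norm_add_le _ _).trans ?_
      rw [norm_smul, norm_smul, Real.norm_of_nonneg hε.le, Real.norm_of_nonneg (by positivity)]
      have e1 := mul_le_mul_of_nonneg_left (hQL g hg hgL τ hτ τ' hτ') hε.le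
      have e2 := mul_le_mul (show ε ^ 2 / 2 ≤ ε / 2 by linarith) (hQL y hy hyL τ hτ τ' hτ')
        (norm_nonneg _) (by positivity)
      have e3 := mul_le_mul_of_nonneg_right hεη (norm_nonneg (τ - τ'))
      calc _ ≤ _ := add_le_add e1 e2
        _ = ε * (3 * (‖Q‖ * C ^ 2)) * ‖τ - τ'‖ := by ring
        _ ≤ _ := e3
    have h5 : ρ τ - ρ τ' = (ε ^ 2)⁻¹ • (R (d τ) - R (d τ')) +
        (ε • (Q (g τ) (y τ) - Q (g τ') (y τ')) +
        (ε ^ 2 / 2) • (Q (y τ) (y τ) - Q (y τ') (y τ'))) := by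
      simp only [ρ, smul_sub]; abel
    rw [h5]
    exact (norm_add_le _ _).trans (by linarith)

end SecondOrderConditions

/-! ### Supporting functionals and zeros of perturbed identities -/

/-- A convex set of a finite dimensional space that does not contain a point in its interior is
supported at that point. -/
lemma exists_support_of_notMem_interior {E : Type*} [NormedAddCommGroup E] [NormedSpace ℝ E]
    [FiniteDimensional ℝ E] {S : Set E} (hS : Convex ℝ S) (hne : S.Nonempty)
    (h0 : (0 : E) ∉ interior S) : ∃ f : E →L[ℝ] ℝ, f ≠ 0 ∧ ∀ s ∈ S, 0 ≤ f s := by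
  by_cases hint : (interior S).Nonempty
  · obtain ⟨f, hf⟩ := geometric_hahn_banach_open_point hS.interior isOpen_interior h0
    simp only [map_zero] at hf
    refine ⟨-f, ?_, fun s hs => ?_⟩
    · rintro h
      obtain ⟨x, hx⟩ := hint
      have := hf x hx
      rw [neg_eq_zero.1 h] at this
      simp at this
    · have hcl : s ∈ closure (interior S) := by
        rw [hS.closure_interior_eq_closure_of_nonempty_interior hint]
        exact subset_closure hs
      have : closure (interior S) ⊆ {x | f x ≤ 0} :=
        closure_minimal (fun x hx => (hf x hx).le) (isClosed_le f.continuous continuous_const)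
      simpa using this hcl
  -- With empty interior, S lies in a proper affine subspace. A nonzero functional vanishing on its
  -- direction is constant on S, and its sign can be chosen.
  · rw [hS.interior_nonempty_iff_affineSpan_eq_top] at hint
    obtain ⟨s₀, hs₀⟩ := hne
    have hdir : (affineSpan ℝ S).direction < ⊤ := by
      rw [lt_top_iff_ne_top]
      intro h
      exact hint ((AffineSubspace.direction_eq_top_iff_of_nonempty
        ⟨s₀, subset_affineSpan ℝ S hs₀⟩).1 h)
    obtain ⟨f, hf, hker⟩ := Submodule.exists_le_ker_of_lt_top _ hdir
    have hconst : ∀ s ∈ S, f s = f s₀ := fun s hs => by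
      have : s -ᵥ s₀ ∈ (affineSpan ℝ S).direction :=
        AffineSubspace.vsub_mem_direction (subset_affineSpan ℝ S hs) (subset_affineSpan ℝ S hs₀)
      have := hker this
      rw [LinearMap.mem_ker, vsub_eq_sub, map_sub, sub_eq_zero] at this
      exact this
    have hne' : LinearMap.toContinuousLinearMap f ≠ 0 := by
      simpa using hf
    rcases le_total 0 (f s₀) with h | h
    · exact ⟨LinearMap.toContinuousLinearMap f, hne', fun s hs => by simpa [hconst s hs] using h⟩
    · exact ⟨-LinearMap.toContinuousLinearMap f, neg_ne_zero.2 hne', fun s hs => by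
        simpa [hconst s hs] using h⟩

/-- A small Lipschitz perturbation of a nonzero multiple of the identity has a zero. -/
lemma exists_zero_of_lipschitz_perturbation {P : Type*} [NormedAddCommGroup P] [NormedSpace ℝ P]
    [CompleteSpace P] {c r : ℝ} (hc : 0 < c) (hr : 0 ≤ r) (ρ : P → P)
    (h1 : ∀ τ ∈ Metric.closedBall (0 : P) r, ‖ρ τ‖ ≤ c * r)
    (h2 : ∀ τ ∈ Metric.closedBall (0 : P) r, ∀ τ' ∈ Metric.closedBall (0 : P) r,
      ‖ρ τ - ρ τ'‖ ≤ c / 2 * ‖τ - τ'‖) :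
    ∃ τ ∈ Metric.closedBall (0 : P) r, c • τ + ρ τ = 0 := by
  -- The zeros sought are the fixed points of G, a ½-contraction of the closed ball.
  let G : P → P := fun τ => -(c⁻¹ • ρ τ)
  have hmaps : Set.MapsTo G (Metric.closedBall 0 r) (Metric.closedBall 0 r) := fun τ hτ => by
    rw [mem_closedBall_zero_iff, norm_neg, norm_smul, norm_inv, Real.norm_of_nonneg hc.le,
      inv_mul_le_iff₀ hc]
    exact h1 τ hτ
  have hcontr : ContractingWith (1 / 2) (hmaps.restrict G _ _) := by
    refine ⟨by rw [← NNReal.coe_lt_coe]; norm_num, LipschitzWith.of_dist_le_mul fun x y => ?_⟩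
    rw [Subtype.dist_eq, Subtype.dist_eq, dist_eq_norm, dist_eq_norm]
    have : G x.1 - G y.1 = -(c⁻¹ • (ρ x - ρ y)) := by simp only [G, smul_sub]; abel
    rw [Set.MapsTo.val_restrict_apply, Set.MapsTo.val_restrict_apply, this, norm_neg, norm_smul,
      norm_inv, Real.norm_of_nonneg hc.le, inv_mul_le_iff₀ hc]
    have := h2 x x.2 y y.2
    push_cast
    linarith
  obtain ⟨τ, hτ, hfix, -⟩ := hcontr.exists_fixedPoint' Metric.isClosed_closedBall.isComplete hmaps
    (x := 0) (by simpa using hr) (edist_ne_top _ _)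
  refine ⟨τ, hτ, ?_⟩
  have h : c • (-(c⁻¹ • ρ τ)) = c • τ := congrArg (c • ·) hfix
  rw [smul_neg, smul_smul, mul_inv_cancel₀ hc.ne', one_smul] at h
  rw [← h]; abel

/-! ### Abstract multiplier rule with curvature -/

section MultiplierRule

variable {U : Type*} [NormedAddCommGroup U] [NormedSpace ℝ U]
  {I K : Type*} [Fintype I] [Fintype K]

/-- The pairing of a multiplier `(α, β)` with a vector of constraint values. -/
def pairing (α : I → ℝ) (β : K → ℝ) (s : (I → ℝ) × (K → ℝ)) : ℝ :=
  ∑ i, α i * s.1 i + ∑ j, β j * s.2 j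

lemma exists_pairing_eq (f : (I → ℝ) × (K → ℝ) →L[ℝ] ℝ) :
    ∃ (α : I → ℝ) (β : K → ℝ), ∀ s, f s = pairing α β s := by
  classical
  refine ⟨fun i => f (Pi.single i 1, 0), fun j => f (0, Pi.single j 1), fun s => ?_⟩
  have h1 : s = ∑ i, s.1 i • ((Pi.single i 1, 0) : (I → ℝ) × (K → ℝ)) +
      ∑ j, s.2 j • ((0, Pi.single j 1) : (I → ℝ) × (K → ℝ)) := by
    refine Prod.ext (funext fun i => ?_) (funext fun j => ?_)
    · simp [Prod.fst_sum, Finset.sum_apply, Pi.single_apply]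
    · simp [Prod.snd_sum, Finset.sum_apply, Pi.single_apply]
  conv_lhs => rw [h1]
  simp only [map_add, map_sum, map_smul, smul_eq_mul, pairing, mul_comm]

/-- The set of second order variations of the constraint values, enlarged by the cone of
increasing directions. -/
def variationSet (A : U →L[ℝ] (I → ℝ) × (K → ℝ)) (Q : U →L[ℝ] U →L[ℝ] (I → ℝ) × (K → ℝ)) (h : U) :
    Set ((I → ℝ) × (K → ℝ)) :=
  {s | ∃ z, ∃ a ∈ curvatureCone A Q, (∀ i, (A z + (1 / 2 : ℝ) • Q h h + a).1 i < s.1 i) ∧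
    s.2 = (A z + (1 / 2 : ℝ) • Q h h + a).2}

/-- z and a enter linearly, a ranges over a convex cone, and the fixed term ½Q(h,h) is reproduced
because the weights sum to one. -/
lemma convex_variationSet {A : U →L[ℝ] (I → ℝ) × (K → ℝ)}
    {Q : U →L[ℝ] U →L[ℝ] (I → ℝ) × (K → ℝ)} (hQ : ∀ a b, Q a b = Q b a) (h : U) :
    Convex ℝ (variationSet A Q h) := by
  rintro s ⟨z, a, ha, h1, h2⟩ s' ⟨z', a', ha', h1', h2'⟩ p q hp hq hpq
  refine ⟨p • z + q • z', p • a + q • a', curvatureCone_add hQ (curvatureCone_smul ha hp)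
    (curvatureCone_smul ha' hq), ?_⟩
  have key : A (p • z + q • z') + (1 / 2 : ℝ) • Q h h + (p • a + q • a') =
      p • (A z + (1 / 2 : ℝ) • Q h h + a) + q • (A z' + (1 / 2 : ℝ) • Q h h + a') := by
    obtain rfl : q = 1 - p := by linarith
    simp only [map_add, map_smul]
    module
  rw [key]
  refine ⟨fun i => ?_, by simp [h2, h2']⟩
  simp only [Prod.fst_add, Prod.smul_fst, Pi.add_apply, Pi.smul_apply, smul_eq_mul] at h1 h1' ⊢
  rcases hp.eq_or_lt with rfl | hp
  · obtain rfl : q = 1 := by linarith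
    simpa using h1' i
  · have e1 := mul_lt_mul_of_pos_left (h1 i) hp
    have e2 := mul_le_mul_of_nonneg_left (h1' i).le hq
    linarith

/-- Weights of a convex combination with barycenter proportional to `τ`. -/
def simplexWeight (K : Type*) [Fintype K] : Option (K × Bool) → (K → ℝ) → ℝ
  | none, _ => 1 / (2 * Fintype.card K + 1)
  | some (k, b), τ => 1 / (2 * Fintype.card K + 1) * (1 + (if b then 1 else -1) * τ k)

/-- On the ball of radius 1/2 the factors 1 ± τ_k lie in [1/2, 3/2], and the denominator is at least
3 as soon as some k exists. The extra index `none` keeps the family nonempty, and carries all the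
weight, when K is empty. -/
lemma simplexWeight_props (i : Option (K × Bool)) {τ : K → ℝ}
    (hτ : τ ∈ Metric.closedBall (0 : K → ℝ) (1 / 2)) :
    0 ≤ simplexWeight K i τ ∧ simplexWeight K i τ ≤ 1 := by
  have hτk : ∀ k, |τ k| ≤ 1 / 2 := fun k => by
    rw [mem_closedBall_zero_iff] at hτ
    exact (norm_le_pi_norm τ k).trans hτ
  have hn : (0 : ℝ) < 2 * Fintype.card K + 1 := by positivity
  rcases i with _ | ⟨k, b⟩
  · simp only [simplexWeight]
    exact ⟨by positivity, by rw [div_le_one hn]; linarith [Nat.cast_nonneg (α := ℝ) (Fintype.card K)]⟩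
  · have hK : (1 : ℝ) ≤ Fintype.card K := by
      exact_mod_cast Fintype.card_pos_iff.2 ⟨k⟩
    have := abs_le.1 (hτk k)
    simp only [simplexWeight]
    rw [one_div, inv_mul_eq_div]
    constructor
    · apply div_nonneg _ hn.le
      cases b <;> simp <;> linarith
    · rw [div_le_one hn]
      cases b <;> simp <;> linarith

/-- The two signs at k combine to a sum independent of τ plus τ_k times a difference. For points
±e_k the sums cancel and the barycenter is a multiple of τ. -/
lemma sum_simplexWeight_smul {V : Type*} [AddCommGroup V] [Module ℝ V]
    (w : Option (K × Bool) → V) (τ : K → ℝ) :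
    ∑ i, simplexWeight K i τ • w i = (1 / (2 * Fintype.card K + 1) : ℝ) • (w none +
      ∑ k, ((w (some (k, true)) + w (some (k, false))) +
        τ k • (w (some (k, true)) - w (some (k, false))))) := by
  rw [Fintype.sum_option, Fintype.sum_prod_type]
  simp only [Fintype.sum_bool, simplexWeight, smul_add, Finset.smul_sum]
  congr 1
  refine Finset.sum_congr rfl fun k _ => ?_
  simp only [if_true, Bool.false_eq_true, if_false]
  module

lemma sum_simplexWeight (τ : K → ℝ) : ∑ i, simplexWeight K i τ = 1 := by
  have := sum_simplexWeight_smul (K := K) (fun _ => (1 : ℝ)) τ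
  simp only [smul_eq_mul, mul_one, sub_self, mul_zero, add_zero, Finset.sum_const,
    Finset.card_univ, nsmul_eq_mul] at this
  rw [this]
  field_simp
  ring

lemma simplexWeight_lipschitz (i : Option (K × Bool)) {τ τ' : K → ℝ} :
    |simplexWeight K i τ - simplexWeight K i τ'| ≤ ‖τ - τ'‖ := by
  have hn : (0 : ℝ) < 2 * Fintype.card K + 1 := by positivity
  rcases i with _ | ⟨k, b⟩
  · simp [simplexWeight]
  · have hk : |τ k - τ' k| ≤ ‖τ - τ'‖ := norm_le_pi_norm (τ - τ') k
    have : simplexWeight K (some (k, b)) τ - simplexWeight K (some (k, b)) τ' =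
      1 / (2 * Fintype.card K + 1) * ((if b then 1 else -1) * (τ k - τ' k)) := by
      simp only [simplexWeight]; ring
    rw [this, abs_mul, abs_mul, abs_of_pos (by positivity)]
    have h1 : |(if b then 1 else -1 : ℝ)| = 1 := by cases b <;> simp
    rw [h1, one_mul]
    have : 1 / (2 * Fintype.card K + 1 : ℝ) ≤ 1 := by
      rw [div_le_one hn]; linarith [Nat.cast_nonneg (α := ℝ) (Fintype.card K)]
    exact (mul_le_of_le_one_left (abs_nonneg _) this).trans hk

/-- The ball of radius 1/2 keeps 1 ± τ_k away from 0, where the square root fails to be Lipschitz: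
both roots are at least 1/2, so their difference is at most the difference of the radicands. -/
lemma sqrt_simplexWeight_lipschitz (i : Option (K × Bool)) {τ τ' : K → ℝ}
    (hτ : τ ∈ Metric.closedBall (0 : K → ℝ) (1 / 2))
    (hτ' : τ' ∈ Metric.closedBall (0 : K → ℝ) (1 / 2)) :
    |√(simplexWeight K i τ) - √(simplexWeight K i τ')| ≤ ‖τ - τ'‖ := by
  have hn : (0 : ℝ) < 2 * Fintype.card K + 1 := by positivity
  have hτk : ∀ τ ∈ Metric.closedBall (0 : K → ℝ) (1 / 2), ∀ k, |τ k| ≤ 1 / 2 := fun τ hτ k => by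
    rw [mem_closedBall_zero_iff] at hτ
    exact (norm_le_pi_norm τ k).trans hτ
  rcases i with _ | ⟨k, b⟩
  · simp [simplexWeight]
  · have hk : |τ k - τ' k| ≤ ‖τ - τ'‖ := norm_le_pi_norm (τ - τ') k
    simp only [simplexWeight]
    set κ : ℝ := 1 / (2 * Fintype.card K + 1)
    have hκ0 : 0 ≤ κ := by positivity
    have hκ1 : √κ ≤ 1 := by
      rw [Real.sqrt_le_one]
      rw [div_le_one hn]; linarith [Nat.cast_nonneg (α := ℝ) (Fintype.card K)]
    set σ : ℝ := if b then 1 else -1 with hσ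
    have hσ1 : |σ| = 1 := by cases b <;> simp [hσ]
    have hx : ∀ τ ∈ Metric.closedBall (0 : K → ℝ) (1 / 2), 1 / 2 ≤ 1 + σ * τ k := fun τ hτ => by
      have h1 := hτk τ hτ k
      have h2 : |σ * τ k| ≤ 1 / 2 := by rwa [abs_mul, hσ1, one_mul]
      linarith [(abs_le.1 h2).1]
    have hsq : ∀ τ ∈ Metric.closedBall (0 : K → ℝ) (1 / 2), 1 / 2 ≤ √(1 + σ * τ k) := fun τ hτ => by
      refine Real.le_sqrt_of_sq_le ?_
      linarith [hx τ hτ]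
    rw [Real.sqrt_mul hκ0, Real.sqrt_mul hκ0, ← mul_sub, abs_mul, abs_of_nonneg (Real.sqrt_nonneg _)]
    refine (mul_le_of_le_one_left (abs_nonneg _) hκ1).trans (le_trans ?_ hk)
    have hs1 := hsq τ hτ
    have hs2 := hsq τ' hτ'
    have key : (√(1 + σ * τ k) - √(1 + σ * τ' k)) * (√(1 + σ * τ k) + √(1 + σ * τ' k)) =
        σ * (τ k - τ' k) := by
      have e1 := Real.mul_self_sqrt (show 0 ≤ 1 + σ * τ k by linarith [hx τ hτ])
      have e2 := Real.mul_self_sqrt (show 0 ≤ 1 + σ * τ' k by linarith [hx τ' hτ'])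
      linear_combination e1 - e2
    have := congrArg abs key
    rw [abs_mul, abs_mul, hσ1, one_mul, abs_of_pos (show 0 < √(1 + σ * τ k) + √(1 + σ * τ' k) by
      linarith)] at this
    rw [← this]
    exact le_mul_of_one_le_right (abs_nonneg _) (by linarith)

/-- If zero is an interior point of the variation set then there are points near `u₀` that satisfy
the equality constraints and strictly decrease all other components. -/
lemma exists_decrease_of_mem_interior {J : U → (I → ℝ) × (K → ℝ)} {u₀ : U}
    (hJ : ContDiffAt ℝ 2 J u₀) (hJ2 : (J u₀).2 = 0) {h : U}
    (hh1 : ∀ i, (fderiv ℝ J u₀ h).1 i ≤ 0) (hh2 : (fderiv ℝ J u₀ h).2 = 0)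
    (hint : (0 : (I → ℝ) × (K → ℝ)) ∈
      interior (variationSet (fderiv ℝ J u₀) (fderiv ℝ (fderiv ℝ J) u₀) h))
    {V : Set U} (hV : V ∈ 𝓝 u₀) : ∃ u ∈ V, (J u).2 = 0 ∧ ∀ i, (J u).1 i < (J u₀).1 i := by
  classical
  set A := fderiv ℝ J u₀ with hA
  set Q := fderiv ℝ (fderiv ℝ J) u₀ with hQ
  have hsymm : ∀ a b, Q a b = Q b a := fun a b => (hJ.isSymmSndFDerivAt (by simp)) a b
  obtain ⟨r, hr, hball⟩ := Metric.mem_nhds_iff.1 (mem_interior_iff_mem_nhds.1 hint)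
  set δ := r / 2 with hδ
  have hδ0 : 0 < δ := by positivity
  -- Test points near 0: every inequality component is −δ, and the equality components are 0 and the
  -- vertices ±δ e_k. With weights `simplexWeight` the equality part averages to 2κδτ.
  let p : Option (K × Bool) → (I → ℝ) × (K → ℝ)
    | none => (fun _ => -δ, 0)
    | some (k, b) => (fun _ => -δ, Pi.single k ((if b then 1 else -1) * δ))
  have hp1 : ∀ i j, (p i).1 j = -δ := by rintro (_ | ⟨k, b⟩) j <;> rfl
  have hp : ∀ i, p i ∈ variationSet A Q h := fun i => hball <| by
    rw [mem_ball_zero_iff]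
    refine lt_of_le_of_lt ?_ (show δ < r by linarith)
    have hc : ‖(fun _ => -δ : I → ℝ)‖ ≤ δ := by
      refine (pi_norm_le_iff_of_nonneg hδ0.le).2 fun _ => ?_
      rw [norm_neg, Real.norm_of_nonneg hδ0.le]
    rcases i with _ | ⟨k, b⟩
    · exact max_le hc (norm_zero.trans_le hδ0.le)
    · refine max_le hc ?_
      simp only [p, Pi.norm_single, norm_mul, Real.norm_of_nonneg hδ0.le]
      cases b <;> simp
  choose z a ha h1 h2 using hp
  set κ : ℝ := 1 / (2 * Fintype.card K + 1) with hκ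
  have hκ0 : 0 < κ := by positivity
  have hκ1 : κ ≤ 1 := by
    rw [hκ, div_le_one (by positivity)]; linarith [Nat.cast_nonneg (α := ℝ) (Fintype.card K)]
  set N : ℝ := (Fintype.card (Option (K × Bool)) : ℝ) with hN
  have hN0 : 0 < N := by rw [hN]; exact_mod_cast Fintype.card_pos
  -- The expansion contains ½Q(ξ,ξ), hence the factor 2. The tolerance κδ/(4N) sums to at most κδ/4
  -- over the N indices; with η = κδ/4 the total error is κδ/2.
  obtain ⟨ξ, hξ, hξξ⟩ := exists_orthogonal_family hsymm (fun i => (2 : ℝ) • a i)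
    (fun i => curvatureCone_smul (ha i) zero_le_two) h (δ := κ * δ / (4 * N)) (by positivity)
  let B : Set (K → ℝ) := Metric.closedBall 0 (1 / 2)
  obtain ⟨ε, u, ρ, hε, huV, hJu, hρ, hρL⟩ := exists_curve_expansion hJ hA hQ hV (B := B)
    (c := simplexWeight K) (fun i τ hτ => simplexWeight_props i hτ)
    (fun τ _ => sum_simplexWeight τ) (fun i τ _ τ' _ => simplexWeight_lipschitz i)
    (fun i τ hτ τ' hτ' => sqrt_simplexWeight_lipschitz i hτ hτ') h ξ z (fun i => (hξ i).1)
    (fun i => (hξ i).2.1) hξξ (η := κ * δ / 4) (by positivity)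
  -- the total perturbation of the affine map
  let e : Option (K × Bool) → (I → ℝ) × (K → ℝ) := fun i => (1 / 2 : ℝ) • Q (ξ i) (ξ i) - a i
  have he : ∀ i, ‖e i‖ ≤ κ * δ / (4 * N) := fun i => by
    have : e i = (1 / 2 : ℝ) • (Q (ξ i) (ξ i) - (2 : ℝ) • a i) := by
      simp only [e]; module
    rw [this, norm_smul]
    have := (hξ i).2.2
    have h0 := norm_nonneg (Q (ξ i) (ξ i) - (2 : ℝ) • a i)
    norm_num
    linarith
  have hsumN : ∀ b : Option (K × Bool) → ℝ, ∀ L, (∀ i, |b i| ≤ L) →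
      ‖∑ i, b i • e i‖ ≤ κ * δ / 4 * L := fun b L hb => by
    refine (norm_sum_le _ _).trans ?_
    have : ∀ i ∈ (Finset.univ : Finset (Option (K × Bool))), ‖b i • e i‖ ≤ L * (κ * δ / (4 * N)) :=
      fun i _ => by
        rw [norm_smul]
        exact mul_le_mul (hb i) (he i) (norm_nonneg _) ((abs_nonneg _).trans (hb i))
    refine (Finset.sum_le_card_nsmul _ _ _ this).trans (le_of_eq ?_)
    rw [nsmul_eq_mul, Finset.card_univ, ← hN]
    field_simp
  let err : (K → ℝ) → (I → ℝ) × (K → ℝ) := fun τ => ∑ i, simplexWeight K i τ • e i + ρ τ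
  have herr : ∀ τ ∈ B, ‖err τ‖ ≤ κ * δ / 2 := fun τ hτ => by
    have h1 := hsumN (fun i => simplexWeight K i τ) 1 fun i => by
      rw [abs_of_nonneg (simplexWeight_props i hτ).1]; exact (simplexWeight_props i hτ).2
    have h2 := hρ τ hτ
    exact (norm_add_le _ _).trans (by linarith)
  have herrL : ∀ τ ∈ B, ∀ τ' ∈ B, ‖err τ - err τ'‖ ≤ κ * δ / 2 * ‖τ - τ'‖ := fun τ hτ τ' hτ' => by
    have h0 : err τ - err τ' =
        ∑ i, (simplexWeight K i τ - simplexWeight K i τ') • e i + (ρ τ - ρ τ') := by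
      simp only [err, sub_smul, Finset.sum_sub_distrib]; abel
    rw [h0]
    have h1 := hsumN _ _ fun i => simplexWeight_lipschitz i (τ := τ) (τ' := τ')
    have h2 := hρL τ hτ τ' hτ'
    exact (norm_add_le _ _).trans (by linarith)
  have hJe : ∀ τ ∈ B, J (u τ) = J u₀ + ε • A h + ε ^ 2 • (∑ i, simplexWeight K i τ •
      (A (z i) + (1 / 2 : ℝ) • Q h h + a i) + err τ) := fun τ hτ => by
    rw [hJu τ hτ]
    simp only [err]
    rw [← add_assoc (Finset.sum _ _), ← Finset.sum_add_distrib]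
    congr 3
    refine Finset.sum_congr rfl fun i _ => ?_
    rw [← smul_add]
    congr 1
    simp only [e]
    abel
  -- The equality constraints along the curve reduce to 2κδτ + err = 0; the error κδ/2 is below both
  -- thresholds c·r = c/2 = κδ of the fixed point lemma.
  obtain ⟨τ, hτ, hzero⟩ := exists_zero_of_lipschitz_perturbation (P := K → ℝ) (c := 2 * (κ * δ))
    (r := 1 / 2) (by positivity) (by norm_num) (fun τ => (err τ).2)
    (fun τ hτ => by
      refine ((norm_snd_le _).trans (herr τ hτ)).trans (by nlinarith))
    (fun τ hτ τ' hτ' => by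
      have := (norm_snd_le (err τ - err τ')).trans (herrL τ hτ τ' hτ')
      rw [Prod.snd_sub] at this
      have h0 := mul_nonneg (mul_pos hκ0 hδ0).le (norm_nonneg (τ - τ'))
      linarith)
  refine ⟨u τ, huV τ hτ, ?_, fun i => ?_⟩
  · have hb : (∑ i, simplexWeight K i τ • (A (z i) + (1 / 2 : ℝ) • Q h h + a i)).2 =
        (2 * (κ * δ)) • τ := by
      rw [Prod.snd_sum]
      have : ∀ i, (simplexWeight K i τ • (A (z i) + (1 / 2 : ℝ) • Q h h + a i)).2 =
          simplexWeight K i τ • (p i).2 := fun i => by rw [h2 i]; rfl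
      simp_rw [this]
      rw [sum_simplexWeight_smul]
      ext j
      simp [p, Finset.sum_apply, Pi.single_apply]
      rw [← one_div, ← hκ]
      have : ∀ k, τ k * ((if j = k then δ else 0) - if j = k then -δ else 0) =
          if j = k then 2 * δ * τ k else 0 := fun k => by split_ifs <;> ring
      have h' : ∀ k, ((if j = k then δ else 0) + if j = k then -δ else 0) = (0 : ℝ) :=
        fun k => by split_ifs <;> ring
      simp [this, h']
      ring
    rw [hJe τ hτ]
    simp only [Prod.snd_add, Prod.smul_snd, hJ2, hh2, hb, hzero]
    simp
  · have hb : (∑ i, simplexWeight K i τ • (A (z i) + (1 / 2 : ℝ) • Q h h + a i)).1 i ≤ -δ := by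
      rw [Prod.fst_sum, Finset.sum_apply]
      calc _ ≤ ∑ j, simplexWeight K j τ * (-δ) := Finset.sum_le_sum fun j _ => by
            have := (h1 j i).le
            rw [hp1] at this
            exact mul_le_mul_of_nonneg_left this (simplexWeight_props j hτ).1
        _ = -δ := by rw [← Finset.sum_mul, sum_simplexWeight, one_mul]
    have he1 : (err τ).1 i ≤ κ * δ / 2 :=
      (le_abs_self _).trans ((norm_le_pi_norm (err τ).1 i).trans
        ((norm_fst_le _).trans (herr τ hτ)))
    -- The average −δ dominates the error κδ/2 because κ ≤ 1.
    have hneg : (∑ i, simplexWeight K i τ • (A (z i) + (1 / 2 : ℝ) • Q h h + a i)).1 i +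
        (err τ).1 i < 0 := by nlinarith
    have h3 := mul_neg_of_pos_of_neg (show 0 < ε ^ 2 by positivity) hneg
    have h4 := mul_nonpos_of_nonneg_of_nonpos hε.le (hh1 i)
    rw [hJe τ hτ]
    simp only [Prod.fst_add, Prod.smul_fst, Pi.add_apply, Pi.smul_apply, smul_eq_mul] at h3 h4 ⊢
    linarith

/-- Second order necessary conditions in a Banach space, without constraint qualification: along
a critical direction `h` there is a multiplier with nonnegative second variation that is also
nonnegative on the asymptotic cone of curvatures. -/
theorem exists_multiplier_of_local_min {J : U → (I → ℝ) × (K → ℝ)} {u₀ : U}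
    (hJ : ContDiffAt ℝ 2 J u₀) (hJ2 : (J u₀).2 = 0)
    (hmin : ∀ᶠ u in 𝓝 u₀, ¬((J u).2 = 0 ∧ ∀ i, (J u).1 i < (J u₀).1 i)) {h : U}
    (hh1 : ∀ i, (fderiv ℝ J u₀ h).1 i ≤ 0) (hh2 : (fderiv ℝ J u₀ h).2 = 0) :
    ∃ (α : I → ℝ) (β : K → ℝ), (α ≠ 0 ∨ β ≠ 0) ∧ (∀ i, 0 ≤ α i) ∧
      (∀ z, pairing α β (fderiv ℝ J u₀ z) = 0) ∧
      0 ≤ pairing α β (fderiv ℝ (fderiv ℝ J) u₀ h h) ∧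
      ∀ s ∈ curvatureCone (fderiv ℝ J u₀) (fderiv ℝ (fderiv ℝ J) u₀), 0 ≤ pairing α β s := by
  classical
  set A := fderiv ℝ J u₀ with hA
  set Q := fderiv ℝ (fderiv ℝ J) u₀ with hQ
  have hsymm : ∀ a b, Q a b = Q b a := fun a b => (hJ.isSymmSndFDerivAt (by simp)) a b
  have hmem : ∀ (z : U), ∀ a ∈ curvatureCone A Q, ∀ b : I → ℝ, (∀ i, 0 < b i) →
      A z + (1 / 2 : ℝ) • Q h h + a + (b, 0) ∈ variationSet A Q h := fun z a ha b hb =>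
    ⟨z, a, ha, fun i => by simpa using hb i, by simp⟩
  have h0 : (0 : (I → ℝ) × (K → ℝ)) ∉ interior (variationSet A Q h) := fun hint => by
    obtain ⟨u, hu, hu1⟩ := exists_decrease_of_mem_interior hJ hJ2 hh1 hh2 hint hmin
    exact hu hu1
  obtain ⟨f, hf0, hf⟩ := exists_support_of_notMem_interior (convex_variationSet hsymm h)
    ⟨_, hmem 0 0 curvatureCone_zero (fun _ => 1) fun _ => one_pos⟩ h0
  obtain ⟨α, β, hαβ⟩ := exists_pairing_eq f
  -- letting the slack tend to zero
  have hcl : ∀ (z : U), ∀ a ∈ curvatureCone A Q, ∀ b : I → ℝ, (∀ i, 0 ≤ b i) →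
      0 ≤ f (A z) + 1 / 2 * f (Q h h) + f a + f (b, 0) := fun z a ha b hb => by
    refine le_of_forall_pos_le_add fun ε hε => ?_
    have hlim : Tendsto (fun t : ℝ => t * f ((fun _ => 1 : I → ℝ), (0 : K → ℝ))) (𝓝[>] 0) (𝓝 0) := by
      refine tendsto_nhdsWithin_of_tendsto_nhds ?_
      simpa using (by fun_prop :
        Continuous fun t : ℝ => t * f ((fun _ => 1 : I → ℝ), (0 : K → ℝ))).tendsto 0
    obtain ⟨t, ht, ht0⟩ := ((hlim.eventually (eventually_le_nhds hε)).and
      self_mem_nhdsWithin).exists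
    have h1 := hf _ (hmem z a ha (fun i => b i + t) fun i => add_pos_of_nonneg_of_pos (hb i) ht0)
    have h2 : (((fun i => b i + t : I → ℝ), 0) : (I → ℝ) × (K → ℝ)) =
        (b, 0) + t • ((fun _ => 1 : I → ℝ), (0 : K → ℝ)) := by
      ext <;> simp
    rw [h2] at h1
    simp only [map_add, map_smul, smul_eq_mul] at h1
    linarith
  -- An affine function that is nonnegative on [0, ∞) has nonnegative slope. Since the admissible z,
  -- a and slacks form cones, this removes the constant ½f(Q(h,h)).
  have hscale : ∀ x y : ℝ, (∀ t : ℝ, 0 ≤ t → 0 ≤ x + t * y) → 0 ≤ y := fun x y hxy => by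
    by_contra hy
    push Not at hy
    have := hxy ((|x| + 1) / -y) (by have := abs_nonneg x; apply div_nonneg <;> linarith)
    have h2 : (|x| + 1) / -y * y = -(|x| + 1) := by
      have := hy.ne
      field_simp
    rw [h2] at this
    linarith [le_abs_self x]
  have hA0 : ∀ z, 0 ≤ f (A z) := fun z => hscale (1 / 2 * f (Q h h)) _ fun t _ => by
    have := hcl (t • z) 0 curvatureCone_zero 0 fun _ => le_rfl
    simp only [map_smul, smul_eq_mul, map_zero] at this
    have h0 : f ((0 : I → ℝ), (0 : K → ℝ)) = 0 := map_zero f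
    linarith
  refine ⟨α, β, ?_, fun i => ?_, fun z => ?_, ?_, fun s hs => ?_⟩
  · by_contra hcon
    push Not at hcon
    refine hf0 (ContinuousLinearMap.ext fun s => ?_)
    rw [hαβ, hcon.1, hcon.2]
    simp [pairing]
  · have : α i = f (Pi.single i 1, 0) := by
      rw [hαβ]; simp [pairing, Pi.single_apply]
    rw [this]
    refine hscale (1 / 2 * f (Q h h)) _ fun t ht => ?_
    have := hcl 0 0 curvatureCone_zero (t • Pi.single i 1) fun j => by
      by_cases hj : j = i
      · subst hj; simpa using ht
      · simp [hj]
    have h2 : ((t • Pi.single i 1, 0) : (I → ℝ) × (K → ℝ)) = t • (Pi.single i 1, 0) := by simp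
    rw [h2, map_smul f] at this
    simp only [map_zero, smul_eq_mul] at this
    linarith
  · rw [← hαβ]
    refine le_antisymm ?_ (hA0 z)
    have := hA0 (-z)
    simpa using this
  · rw [← hαβ]
    have := hcl 0 0 curvatureCone_zero 0 fun _ => le_rfl
    have h0 : f ((0 : I → ℝ), (0 : K → ℝ)) = 0 := map_zero f
    simp only [map_zero] at this
    linarith
  · rw [← hαβ]
    refine hscale (1 / 2 * f (Q h h)) _ fun t ht => ?_
    have := hcl 0 _ (curvatureCone_smul hs ht) 0 fun _ => le_rfl
    have h0 : f ((0 : I → ℝ), (0 : K → ℝ)) = 0 := map_zero f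
    simp only [map_zero, map_smul, smul_eq_mul] at this
    linarith

end MultiplierRule

/-! ### Primitives of integrable functions and their product rule -/

section Primitives

variable {E : Type*} [NormedAddCommGroup E] [NormedSpace ℝ E]
  {F : Type*} [NormedAddCommGroup F] [NormedSpace ℝ F]
  {G : Type*} [NormedAddCommGroup G] [NormedSpace ℝ G] {T : ℝ}

instance : IsFiniteMeasure (timeMeasure T) := by
  unfold timeMeasure; infer_instance

lemma ae_timeMeasure_iff {p : ℝ → Prop} :
    (∀ᵐ t ∂(timeMeasure T), p t) ↔ ∀ᵐ t, t ∈ Set.Icc (0 : ℝ) T → p t := by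
  unfold timeMeasure
  rw [ae_restrict_iff' measurableSet_Icc]

lemma ae_mem_Icc : ∀ᵐ t ∂(timeMeasure T), t ∈ Set.Icc (0 : ℝ) T :=
  ae_restrict_mem measurableSet_Icc

lemma ae_mem_Ioo : ∀ᵐ t ∂(timeMeasure T), t ∈ Set.Ioo (0 : ℝ) T := by
  have h0 : ∀ᵐ t : ℝ, t ≠ 0 := by simp [ae_iff, measure_singleton]
  have h1 : ∀ᵐ t : ℝ, t ≠ T := by simp [ae_iff, measure_singleton]
  rw [ae_timeMeasure_iff]
  filter_upwards [h0, h1] with t h0 h1 ht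
  exact ⟨lt_of_le_of_ne ht.1 h0.symm, lt_of_le_of_ne ht.2 h1⟩

lemma intervalIntegrable_of_integrable {H : Type*} [NormedAddCommGroup H] {y : ℝ → H} (hy : Integrable y (timeMeasure T)) {a b : ℝ}
    (ha : a ∈ Set.Icc 0 T) (hb : b ∈ Set.Icc 0 T) : IntervalIntegrable y volume a b := by
  rw [intervalIntegrable_iff]
  refine IntegrableOn.mono_set hy ?_
  rw [Set.uIoc]
  exact Set.Ioc_subset_Icc_self.trans (Set.Icc_subset_Icc (le_min ha.1 hb.1) (max_le ha.2 hb.2))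

lemma integral_timeMeasure (hT : 0 ≤ T) (y : ℝ → E) :
    ∫ t, y t ∂(timeMeasure T) = ∫ t in (0 : ℝ)..T, y t := by
  rw [intervalIntegral.integral_of_le hT, timeMeasure, integral_Icc_eq_integral_Ioc]

lemma intervalIntegral_congr_timeMeasure {y z : ℝ → E} (h : y =ᵐ[timeMeasure T] z) {a b : ℝ}
    (ha : a ∈ Set.Icc 0 T) (hb : b ∈ Set.Icc 0 T) : ∫ s in a..b, y s = ∫ s in a..b, z s := by
  refine intervalIntegral.integral_congr_ae ?_
  filter_upwards [ae_timeMeasure_iff.1 h] with t ht hm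
  rw [Set.uIoc] at hm
  exact ht (Set.Icc_subset_Icc (le_min ha.1 hb.1) (max_le ha.2 hb.2) (Set.Ioc_subset_Icc_self hm))

lemma zero_mem_Icc (hT : 0 ≤ T) : (0 : ℝ) ∈ Set.Icc 0 T := ⟨le_rfl, hT⟩

lemma T_mem_Icc (hT : 0 ≤ T) : T ∈ Set.Icc 0 T := ⟨hT, le_rfl⟩

/-- On `[0,T]` the function `x` is a primitive of the integrable function `y`. -/
structure IsPrim (T : ℝ) (x y : ℝ → E) : Prop where
  integrable : Integrable y (timeMeasure T)
  eq : ∀ t ∈ Set.Icc (0 : ℝ) T, x t = x 0 + ∫ s in (0 : ℝ)..t, y s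

namespace IsPrim

variable {x y : ℝ → E}

lemma congr {y' : ℝ → E} (h : IsPrim T x y) (hy : y =ᵐ[timeMeasure T] y') : IsPrim T x y' := by
  refine ⟨h.integrable.congr hy, fun t ht => ?_⟩
  have hT : 0 ≤ T := ht.1.trans ht.2
  rw [h.eq t ht, intervalIntegral_congr_timeMeasure hy (zero_mem_Icc hT) ht]

lemma sub_eq (h : IsPrim T x y) {s t : ℝ} (hs : s ∈ Set.Icc 0 T) (ht : t ∈ Set.Icc 0 T) :
    x t - x s = ∫ r in s..t, y r := by
  have h0 := zero_mem_Icc (hs.1.trans hs.2)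
  rw [h.eq t ht, h.eq s hs, add_sub_add_left_eq_sub,
    intervalIntegral.integral_interval_sub_left]
  · exact intervalIntegrable_of_integrable h.integrable h0 ht
  · exact intervalIntegrable_of_integrable h.integrable h0 hs

lemma of_integrable (hy : Integrable y (timeMeasure T)) (x₀ : E) :
    IsPrim T (fun t => x₀ + ∫ s in (0 : ℝ)..t, y s) y := ⟨hy, fun t _ => by simp⟩

lemma continuousOn (h : IsPrim T x y) : ContinuousOn x (Set.Icc 0 T) := by
  rcases lt_or_ge T 0 with hT | hT
  · simp [Set.Icc_eq_empty (not_le.2 hT)]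
  have h1 := intervalIntegral.continuousOn_primitive_interval' (a := (0 : ℝ))
    (intervalIntegrable_of_integrable h.integrable (zero_mem_Icc hT) (T_mem_Icc hT))
    Set.left_mem_uIcc
  rw [Set.uIcc_of_le hT] at h1
  exact (continuousOn_const.add h1).congr fun t ht => h.eq t ht

lemma aestronglyMeasurable [SecondCountableTopologyEither ℝ E] (h : IsPrim T x y) :
    AEStronglyMeasurable x (timeMeasure T) :=
  h.continuousOn.aestronglyMeasurable measurableSet_Icc

lemma exists_bound (h : IsPrim T x y) : ∃ C, 0 ≤ C ∧ ∀ t ∈ Set.Icc 0 T, ‖x t‖ ≤ C := by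
  obtain ⟨C, hC⟩ := isCompact_Icc.exists_bound_of_continuousOn h.continuousOn
  exact ⟨max C 0, le_max_right _ _, fun t ht => (hC t ht).trans (le_max_left _ _)⟩

lemma memLp_top [SecondCountableTopologyEither ℝ E] (h : IsPrim T x y) :
    MemLp x ∞ (timeMeasure T) := by
  obtain ⟨C, -, hC⟩ := h.exists_bound
  exact memLp_top_of_bound h.aestronglyMeasurable C (ae_mem_Icc.mono hC)

lemma ae_hasDerivAt [CompleteSpace E] (h : IsPrim T x y) :
    ∀ᵐ t ∂(timeMeasure T), HasDerivAt x (y t) t := by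
  rcases lt_or_ge T 0 with hT | hT
  · rw [ae_timeMeasure_iff]
    exact Eventually.of_forall fun t ht => absurd (ht.1.trans ht.2) (not_le.2 hT)
  have h1 := (intervalIntegrable_of_integrable h.integrable (zero_mem_Icc hT)
    (T_mem_Icc hT)).ae_hasDerivAt_integral
  filter_upwards [ae_restrict_of_ae (s := Set.Icc 0 T) h1, ae_mem_Ioo] with t ht ht'
  have h2 := ht (by rw [Set.uIcc_of_le hT]; exact Set.Ioo_subset_Icc_self ht') 0 Set.left_mem_uIcc
  refine (h2.const_add (x 0)).congr_of_eventuallyEq ?_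
  filter_upwards [Ioo_mem_nhds ht'.1 ht'.2] with s hs
  exact h.eq s (Set.Ioo_subset_Icc_self hs)

/-- An a.e. derivative of a primitive is the integrand. -/
lemma congr_deriv [CompleteSpace E] {y' : ℝ → E} (h : IsPrim T x y)
    (h' : ∀ᵐ t ∂(timeMeasure T), HasDerivAt x (y' t) t) : IsPrim T x y' :=
  h.congr (by filter_upwards [h.ae_hasDerivAt, h'] with t h1 h2 using h1.unique h2)

lemma add {x' y' : ℝ → E} (h : IsPrim T x y) (h' : IsPrim T x' y') :
    IsPrim T (fun t => x t + x' t) (fun t => y t + y' t) := by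
  refine ⟨h.integrable.add h'.integrable, fun t ht => ?_⟩
  have h0 := zero_mem_Icc (ht.1.trans ht.2)
  rw [intervalIntegral.integral_add (intervalIntegrable_of_integrable h.integrable h0 ht)
    (intervalIntegrable_of_integrable h'.integrable h0 ht), h.eq t ht, h'.eq t ht]
  abel

lemma clm [CompleteSpace E] [CompleteSpace F] (L : E →L[ℝ] F) (h : IsPrim T x y) :
    IsPrim T (fun t => L (x t)) (fun t => L (y t)) := by
  refine ⟨L.integrable_comp h.integrable, fun t ht => ?_⟩
  have h0 := zero_mem_Icc (ht.1.trans ht.2)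
  rw [L.intervalIntegral_comp_comm (intervalIntegrable_of_integrable h.integrable h0 ht),
    h.eq t ht, map_add]

/-- The sums that define absolute continuity of g are dominated term by term by C times those of m.
Here m will be the primitive of an integrable majorant. -/
lemma _root_.AbsolutelyContinuousOnInterval.of_dist_le {H : Type*} [NormedAddCommGroup H] {g : ℝ → H} {m : ℝ → ℝ} {b : ℝ}
    (hm : AbsolutelyContinuousOnInterval m 0 b) (C : ℝ)
    (h : ∀ s ∈ Set.uIcc 0 b, ∀ t ∈ Set.uIcc 0 b, dist (g s) (g t) ≤ C * dist (m s) (m t)) :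
    AbsolutelyContinuousOnInterval g 0 b := by
  have h1 : Tendsto (fun P : ℕ × (ℕ → ℝ × ℝ) =>
      C * ∑ i ∈ Finset.range P.1, dist (m (P.2 i).1) (m (P.2 i).2))
      (AbsolutelyContinuousOnInterval.totalLengthFilter ⊓
        𝓟 (AbsolutelyContinuousOnInterval.disjWithin 0 b)) (𝓝 0) := by
    simpa using Tendsto.const_mul C hm
  refine squeeze_zero' (Eventually.of_forall fun P => Finset.sum_nonneg fun i _ => dist_nonneg)
    ?_ h1
  filter_upwards [mem_inf_of_right (mem_principal_self _)] with P hP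
  rw [Finset.mul_sum]
  refine Finset.sum_le_sum fun i hi => ?_
  have := hP.1 i hi
  exact h _ this.1 _ this.2

/-- The product rule for primitives. -/
lemma bilin [CompleteSpace E] [CompleteSpace F] [CompleteSpace G]
    [SecondCountableTopologyEither ℝ E] [SecondCountableTopologyEither ℝ F]
    (L : E →L[ℝ] F →L[ℝ] G) {x' y' : _} (h : IsPrim T x y) (h' : IsPrim T x' y') :
    IsPrim T (fun t => L (x t) (x' t)) (fun t => L (y t) (x' t) + L (x t) (y' t)) := by
  obtain ⟨C, hC0, hC⟩ := h.exists_bound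
  obtain ⟨C', hC0', hC'⟩ := h'.exists_bound
  have hint : Integrable (fun t => L (y t) (x' t) + L (x t) (y' t)) (timeMeasure T) :=
    (L.integrable_of_bilin_of_bdd_right C' h.integrable h'.aestronglyMeasurable
      (ae_mem_Icc.mono hC')).add
    (L.integrable_of_bilin_of_bdd_left C h.aestronglyMeasurable (ae_mem_Icc.mono hC) h'.integrable)
  refine ⟨hint, fun t ht => ?_⟩
  have hT : 0 ≤ T := ht.1.trans ht.2
  -- m is a common majorant: its increments dominate those of x, of x' and of the integral of the
  -- product derivative. Hence product minus integral is absolutely continuous with derivative zero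
  -- a.e., so it is constant.
  set m : ℝ → ℝ := fun t => ∫ s in (0 : ℝ)..t, (‖y s‖ + ‖y' s‖ +
    ‖L (y s) (x' s) + L (x s) (y' s)‖) with hm
  have hmint : Integrable (fun s => ‖y s‖ + ‖y' s‖ + ‖L (y s) (x' s) + L (x s) (y' s)‖)
      (timeMeasure T) := (h.integrable.norm.add h'.integrable.norm).add hint.norm
  have hIcc : Set.uIcc 0 T = Set.Icc 0 T := Set.uIcc_of_le hT
  have hII := fun {s t : ℝ} (hs : s ∈ Set.Icc 0 T) (ht : t ∈ Set.Icc 0 T) =>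
    intervalIntegrable_of_integrable hmint hs ht
  have hmac : AbsolutelyContinuousOnInterval m 0 T :=
    (hII (zero_mem_Icc hT) (T_mem_Icc hT)).absolutelyContinuousOnInterval_intervalIntegral
      Set.left_mem_uIcc
  let z : ℝ → G := fun t => L (x t) (x' t) -
    ∫ s in (0 : ℝ)..t, (L (y s) (x' s) + L (x s) (y' s))
  have key : ∀ s ∈ Set.Icc 0 T, ∀ t ∈ Set.Icc 0 T, s ≤ t →
      dist (z s) (z t) ≤ (‖L‖ * C + ‖L‖ * C' + 1) * dist (m s) (m t) := by
    intro s hs t ht hst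
    have hdm : dist (m s) (m t) = ∫ r in s..t, (‖y r‖ + ‖y' r‖ +
        ‖L (y r) (x' r) + L (x r) (y' r)‖) := by
      rw [dist_comm, Real.dist_eq, hm]
      simp only
      rw [intervalIntegral.integral_interval_sub_left (hII (zero_mem_Icc hT) ht)
        (hII (zero_mem_Icc hT) hs), abs_of_nonneg]
      exact intervalIntegral.integral_nonneg hst fun _ _ => by positivity
    have e1 : ‖x t - x s‖ ≤ dist (m s) (m t) := by
      rw [h.sub_eq hs ht]
      refine (intervalIntegral.norm_integral_le_of_norm_le hst (Eventually.of_forall fun r _ => ?_)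
        (hII hs ht)).trans_eq hdm.symm
      have := norm_nonneg (y' r); have := norm_nonneg (L (y r) (x' r) + L (x r) (y' r)); linarith
    have e2 : ‖x' t - x' s‖ ≤ dist (m s) (m t) := by
      rw [h'.sub_eq hs ht]
      refine (intervalIntegral.norm_integral_le_of_norm_le hst (Eventually.of_forall fun r _ => ?_)
        (hII hs ht)).trans_eq hdm.symm
      have := norm_nonneg (y r); have := norm_nonneg (L (y r) (x' r) + L (x r) (y' r)); linarith
    have e3 : ‖∫ r in s..t, (L (y r) (x' r) + L (x r) (y' r))‖ ≤ dist (m s) (m t) := by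
      refine (intervalIntegral.norm_integral_le_of_norm_le hst (Eventually.of_forall fun r _ => ?_)
        (hII hs ht)).trans_eq hdm.symm
      have := norm_nonneg (y r); have := norm_nonneg (y' r); linarith
    have hz : z t - z s = L (x t) (x' t - x' s) + L (x t - x s) (x' s) -
        ∫ r in s..t, (L (y r) (x' r) + L (x r) (y' r)) := by
      rw [← intervalIntegral.integral_interval_sub_left
        (intervalIntegrable_of_integrable hint (zero_mem_Icc hT) ht)
        (intervalIntegrable_of_integrable hint (zero_mem_Icc hT) hs)]
      simp only [z, map_sub, sub_apply]
      abel
    rw [dist_comm, dist_eq_norm, hz]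
    have b1 : ‖L (x t) (x' t - x' s)‖ ≤ ‖L‖ * C * dist (m s) (m t) :=
      (L.le_opNorm₂ _ _).trans (by gcongr; exact hC t ht)
    have b2 : ‖L (x t - x s) (x' s)‖ ≤ ‖L‖ * C' * dist (m s) (m t) :=
      (L.le_opNorm₂ _ _).trans (by
        rw [mul_assoc, mul_assoc, mul_comm C']
        gcongr
        exact hC' s hs)
    refine (norm_sub_le _ _).trans ?_
    have := norm_add_le (L (x t) (x' t - x' s)) (L (x t - x s) (x' s))
    linarith
  have hac : AbsolutelyContinuousOnInterval z 0 T :=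
    AbsolutelyContinuousOnInterval.of_dist_le hmac (‖L‖ * C + ‖L‖ * C' + 1) fun s hs t ht => by
      rw [hIcc] at hs ht
      rcases le_total s t with hst | hst
      · exact key s hs t ht hst
      · rw [dist_comm, dist_comm (m s)]; exact key t ht s hs hst
  have hd : ∀ᵐ t, t ∈ Set.uIcc 0 T → HasDerivAt z 0 t := by
    rw [hIcc, ← ae_timeMeasure_iff]
    filter_upwards [h.ae_hasDerivAt, h'.ae_hasDerivAt,
      (IsPrim.of_integrable hint (0 : G)).ae_hasDerivAt] with t h1 h2 h3
    have h4 := (L.hasFDerivAt_of_bilinear h1.hasFDerivAt h2.hasFDerivAt).hasDerivAt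
    have h5 := h4.sub h3
    simp only [zero_add] at h5
    refine h5.congr_deriv ?_
    simp [add_comm]
  obtain ⟨c, hc⟩ := hac.const_of_ae_hasDerivAt_zero hd
  rw [hIcc] at hc
  have h1 := hc t ht
  have h2 := hc 0 (zero_mem_Icc hT)
  simp only [z, intervalIntegral.integral_same, sub_zero] at h1 h2
  rw [h2, ← h1]
  abel

lemma eq_zero_deriv (h : IsPrim T x y) (hy : y =ᵐ[timeMeasure T] 0) {t : ℝ}
    (ht : t ∈ Set.Icc 0 T) : x t = x 0 := by
  rw [(h.congr hy).eq t ht]; simp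

end IsPrim

end Primitives

/-! ### Volterra operators on L^∞ -/

/-- Essentially bounded functions on the time interval. -/
abbrev Linf (T : ℝ) (E : Type*) [NormedAddCommGroup E] := Lp E ∞ (timeMeasure T)

section BoundedFunctions

variable {E F : Type} [NormedAddCommGroup E] [NormedSpace ℝ E]
  [NormedAddCommGroup F] [NormedSpace ℝ F] {T : ℝ}

namespace Linf

lemma norm_le {E : Type*} [NormedAddCommGroup E] (f : Linf T E) {C : ℝ} (hC : 0 ≤ C) (h : ∀ᵐ t ∂(timeMeasure T), ‖f t‖ ≤ C) :
    ‖f‖ ≤ C := by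
  simpa using Lp.norm_le_of_ae_bound hC h

lemma ae_norm_le {E : Type*} [NormedAddCommGroup E] (f : Linf T E) : ∀ᵐ t ∂(timeMeasure T), ‖f t‖ ≤ ‖f‖ := by
  filter_upwards [ae_le_eLpNormEssSup (f := f) (μ := timeMeasure T)] with t ht
  rw [Lp.norm_def, eLpNorm_exponent_top, ← ENNReal.ofReal_le_iff_le_toReal, ofReal_norm]
  · exact ht
  · rw [← eLpNorm_exponent_top]; exact Lp.eLpNorm_ne_top f

lemma integrable {E : Type*} [NormedAddCommGroup E] (f : Linf T E) : Integrable f (timeMeasure T) :=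
  (Lp.memLp f).integrable (by simp)

lemma isPrim (f : Linf T E) (x₀ : E) :
    IsPrim T (fun t => x₀ + ∫ s in (0 : ℝ)..t, f s) f := IsPrim.of_integrable (Linf.integrable f) x₀

end Linf

lemma memLp_primitive (f : Linf T E) :
    MemLp (fun t => ∫ s in (0 : ℝ)..t, f s) ∞ (timeMeasure T) := by
  simpa using (Linf.isPrim f 0).memLp_top

/-- The Volterra operator `y ↦ ∫₀ᵗ y` on essentially bounded functions. -/
def volterra (T : ℝ) (E : Type) [NormedAddCommGroup E] [NormedSpace ℝ E] :
    Linf T E →L[ℝ] Linf T E :=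
  LinearMap.mkContinuous
    { toFun := fun f => (memLp_primitive f).toLp
      map_add' := fun f g => by
        rw [← MemLp.toLp_add]
        refine MemLp.toLp_congr _ _ ?_
        filter_upwards [ae_mem_Icc (T := T)] with t ht
        have h0 := zero_mem_Icc (ht.1.trans ht.2)
        rw [Pi.add_apply, ← intervalIntegral.integral_add
          (intervalIntegrable_of_integrable (Linf.integrable f) h0 ht)
          (intervalIntegrable_of_integrable (Linf.integrable g) h0 ht)]
        exact intervalIntegral_congr_timeMeasure (Lp.coeFn_add f g) h0 ht
      map_smul' := fun c f => by
        rw [RingHom.id_apply, ← MemLp.toLp_const_smul]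
        refine MemLp.toLp_congr _ _ ?_
        filter_upwards [ae_mem_Icc (T := T)] with t ht
        have h0 := zero_mem_Icc (ht.1.trans ht.2)
        rw [Pi.smul_apply, ← intervalIntegral.integral_smul]
        exact intervalIntegral_congr_timeMeasure (Lp.coeFn_smul c f) h0 ht }
    |T| fun f => by
      refine Linf.norm_le _ (by positivity) ?_
      filter_upwards [(memLp_primitive f).coeFn_toLp, ae_mem_Icc (T := T)] with t ht ht'
      have h0 := zero_mem_Icc (ht'.1.trans ht'.2)
      simp only [LinearMap.coe_mk, AddHom.coe_mk]
      rw [ht, mul_comm]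
      have h1 : ∀ᵐ s, s ∈ Set.uIoc 0 t → ‖f s‖ ≤ ‖f‖ := by
        filter_upwards [ae_timeMeasure_iff.1 (Linf.ae_norm_le f)] with s hs hs'
        rw [Set.uIoc_of_le ht'.1] at hs'
        exact hs ⟨hs'.1.le, hs'.2.trans ht'.2⟩
      refine (intervalIntegral.norm_integral_le_of_norm_le_const_ae h1).trans ?_
      rw [sub_zero]
      exact mul_le_mul_of_nonneg_left (abs_le_abs_of_nonneg ht'.1 ht'.2) (norm_nonneg _)

lemma volterra_ae (f : Linf T E) :
    volterra T E f =ᵐ[timeMeasure T] fun t => ∫ s in (0 : ℝ)..t, f s :=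
  (memLp_primitive f).coeFn_toLp

/-- Multiplication by an operator valued bounded function. -/
def mulLinf (T : ℝ) (E F : Type) [NormedAddCommGroup E] [NormedSpace ℝ E]
    [NormedAddCommGroup F] [NormedSpace ℝ F] :
    Linf T (E →L[ℝ] F) →L[ℝ] Linf T E →L[ℝ] Linf T F :=
  (ContinuousLinearMap.id ℝ (E →L[ℝ] F)).holderL (timeMeasure T) ∞ ∞ ∞

lemma mulLinf_ae (A : Linf T (E →L[ℝ] F)) (f : Linf T E) :
    mulLinf T E F A f =ᵐ[timeMeasure T] fun t => A t (f t) := by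
  simpa [mulLinf] using (ContinuousLinearMap.id ℝ (E →L[ℝ] F)).coeFn_holder (r := ∞) A f

/-- Keeping the bound pointwise in t, with t instead of T, lets each integration of s^k contribute a
factor 1/(k+1); this builds the factorial. -/
lemma norm_volterra_comp_pow_le {C : ℝ} (hC : 0 ≤ C) (M : Linf T E →L[ℝ] Linf T E)
    (hM : ∀ f, ∀ᵐ t ∂(timeMeasure T), ‖M f t‖ ≤ C * ‖f t‖) (k : ℕ) (f : Linf T E) :
    ∀ᵐ t ∂(timeMeasure T), ‖((volterra T E ∘L M) ^ k) f t‖ ≤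
      (C * t) ^ k / (k.factorial : ℝ) * ‖f‖ := by
  induction k with
  | zero => simpa using (Linf.ae_norm_le f)
  | succ k ih =>
    set g := ((volterra T E ∘L M) ^ k) f with hg
    have hstep : ((volterra T E ∘L M) ^ (k + 1)) f = volterra T E (M g) := by
      rw [pow_succ']; rfl
    rw [hstep]
    filter_upwards [volterra_ae (M g), ae_mem_Icc (T := T)] with t ht ht'
    have h0 := zero_mem_Icc (ht'.1.trans ht'.2)
    rw [ht]
    have hb : ∀ᵐ s, s ∈ Set.Ioc 0 t →
        ‖M g s‖ ≤ C * ((C * s) ^ k / (k.factorial : ℝ) * ‖f‖) := by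
      filter_upwards [ae_timeMeasure_iff.1 (hM g), ae_timeMeasure_iff.1 ih] with s h1 h2 hs
      have hs' : s ∈ Set.Icc 0 T := ⟨hs.1.le, hs.2.trans ht'.2⟩
      exact (h1 hs').trans (mul_le_mul_of_nonneg_left (h2 hs') hC)
    refine (intervalIntegral.norm_integral_le_of_norm_le ht'.1 hb
      (Continuous.intervalIntegrable (by fun_prop) _ _)).trans (le_of_eq ?_)
    have : ∀ s : ℝ, C * ((C * s) ^ k / (k.factorial : ℝ) * ‖f‖) =
        (C ^ (k + 1) / k.factorial * ‖f‖) * s ^ k := fun s => by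
      rw [mul_pow]; ring
    simp_rw [this]
    rw [intervalIntegral.integral_const_mul, integral_pow, Nat.factorial_succ]
    push_cast
    rw [mul_pow]
    have hk : (k.factorial : ℝ) ≠ 0 := by exact_mod_cast k.factorial_ne_zero
    field_simp
    simp

/-- A Volterra integral equation of the second kind is uniquely solvable. -/
lemma isUnit_one_sub_volterra_comp {C : ℝ} (hC : 0 ≤ C) (M : Linf T E →L[ℝ] Linf T E)
    [CompleteSpace E]
    (hM : ∀ f, ∀ᵐ t ∂(timeMeasure T), ‖M f t‖ ≤ C * ‖f t‖) :
    IsUnit (1 - volterra T E ∘L M) := by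
  set V := volterra T E ∘L M with hV
  have hlim : Tendsto (fun k : ℕ => (C * |T|) ^ k / (k.factorial : ℝ)) atTop (𝓝 0) :=
    FloorSemiring.tendsto_pow_div_factorial_atTop _
  obtain ⟨k, hk⟩ := (hlim.eventually (eventually_lt_nhds one_pos)).exists
  have hnorm : ‖V ^ k‖ < 1 := by
    refine lt_of_le_of_lt (ContinuousLinearMap.opNorm_le_bound _ (by positivity) fun f => ?_) hk
    refine Linf.norm_le _ (by positivity) ?_
    filter_upwards [norm_volterra_comp_pow_le hC M hM k f, ae_mem_Icc (T := T)] with t ht ht'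
    refine ht.trans ?_
    have := ht'.1
    gcongr
    exact ht'.2.trans (le_abs_self T)
  have hu : IsUnit (1 - V ^ k) := isUnit_one_sub_of_norm_lt_one hnorm
  -- A high power of V has norm below 1, and 1 − V^k is the product of the commuting factors ∑ Vⁱ
  -- and 1 − V, so each factor is a unit.
  have hgeom := Commute.isUnit_mul_iff (a := ∑ i ∈ Finset.range k, V ^ i) (b := 1 - V)
    (by
      refine Commute.sum_left _ _ _ fun i _ => ?_
      exact ((Commute.one_right _).sub_right ((Commute.refl V).pow_left i)))
  rw [geom_sum_mul_neg] at hgeom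
  exact (hgeom.1 hu).2

/-- The constant functions. -/
def constLinf (T : ℝ) (E : Type) [NormedAddCommGroup E] [NormedSpace ℝ E] : E →L[ℝ] Linf T E :=
  LinearMap.mkContinuous
    { toFun := fun x => Lp.const ∞ (timeMeasure T) x
      map_add' := fun x y => map_add _ x y
      map_smul' := fun c x => by
        refine Lp.ext ?_
        filter_upwards [Lp.coeFn_const (p := ∞) (μ := timeMeasure T) (c • x),
          Lp.coeFn_const (p := ∞) (μ := timeMeasure T) x,
          Lp.coeFn_smul c (Lp.const ∞ (timeMeasure T) x)] with t h1 h2 h3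
        rw [h1, RingHom.id_apply, h3, Pi.smul_apply, h2]; rfl }
    1 fun x => by
      rw [one_mul]
      refine Linf.norm_le _ (norm_nonneg x) ?_
      filter_upwards [Lp.coeFn_const (p := ∞) (μ := timeMeasure T) x] with t ht
      simp only [LinearMap.coe_mk, AddHom.coe_mk]
      rw [ht]; rfl

lemma constLinf_ae (x : E) : constLinf T E x =ᵐ[timeMeasure T] fun _ => x :=
  Lp.coeFn_const (p := ∞) (μ := timeMeasure T) x

/-- The integral over the time interval. -/
def integralLinf (T : ℝ) (E : Type) [NormedAddCommGroup E] [NormedSpace ℝ E] :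
    Linf T E →L[ℝ] E :=
  LinearMap.mkContinuous
    { toFun := fun f => ∫ t, f t ∂(timeMeasure T)
      map_add' := fun f g => by
        rw [← integral_add (Linf.integrable f) (Linf.integrable g)]
        exact integral_congr_ae (Lp.coeFn_add f g)
      map_smul' := fun c f => by
        rw [RingHom.id_apply, ← integral_smul]
        exact integral_congr_ae (Lp.coeFn_smul c f) }
    ((timeMeasure T).real Set.univ) fun f => by
      rw [mul_comm]
      exact norm_integral_le_of_norm_le_const (Linf.ae_norm_le f)

lemma integralLinf_apply (f : Linf T E) : integralLinf T E f = ∫ t, f t ∂(timeMeasure T) := rfl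

end BoundedFunctions

/-! ### Smoothness of superposition operators on L^∞ -/

section Nemytskii

variable {E F : Type} [NormedAddCommGroup E] [NormedSpace ℝ E] [FiniteDimensional ℝ E]
  [NormedAddCommGroup F] [NormedSpace ℝ F] {T : ℝ}

lemma memLp_comp_Linf {F : Type} [NormedAddCommGroup F] {g : E → F} (hg : Continuous g) (f : Linf T E) :
    MemLp (fun t => g (f t)) ∞ (timeMeasure T) := by
  have : ProperSpace E := FiniteDimensional.proper ℝ E
  obtain ⟨C, hC⟩ := (isCompact_closedBall (0 : E) ‖f‖).exists_bound_of_continuousOn hg.continuousOn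
  refine memLp_top_of_bound (hg.comp_aestronglyMeasurable (Lp.aestronglyMeasurable f)) C ?_
  filter_upwards [(Linf.ae_norm_le f)] with t ht
  exact hC _ (by simpa using ht)

/-- The superposition operator of a continuous function. -/
def nemytskii (T : ℝ) (g : E → F) (hg : Continuous g) (f : Linf T E) : Linf T F :=
  (memLp_comp_Linf hg f).toLp

omit [NormedSpace ℝ F] in
lemma nemytskii_ae {g : E → F} (hg : Continuous g) (f : Linf T E) :
    nemytskii T g hg f =ᵐ[timeMeasure T] fun t => g (f t) :=
  (memLp_comp_Linf hg f).coeFn_toLp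

omit [NormedSpace ℝ F] in
lemma continuous_nemytskii {g : E → F} (hg : Continuous g) : Continuous (nemytskii T g hg) := by
  have : ProperSpace E := FiniteDimensional.proper ℝ E
  refine Metric.continuous_iff.2 fun f ε hε => ?_
  have huc := (isCompact_closedBall (0 : E) (‖f‖ + 1)).uniformContinuousOn_of_continuous
    hg.continuousOn
  obtain ⟨δ, hδ, h⟩ := Metric.uniformContinuousOn_iff.1 huc (ε / 2) (by positivity)
  refine ⟨min δ 1, by positivity, fun f' hf' => ?_⟩
  rw [dist_eq_norm] at hf' ⊢
  refine lt_of_le_of_lt (Linf.norm_le _ (half_pos hε).le ?_) (half_lt_self hε)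
  filter_upwards [(Linf.ae_norm_le f), Linf.ae_norm_le (f' - f), Lp.coeFn_sub f' f, nemytskii_ae hg f,
    nemytskii_ae hg f', Lp.coeFn_sub (nemytskii T g hg f') (nemytskii T g hg f)]
    with t h1 h2 h3 h4 h5 h6
  rw [h6, Pi.sub_apply, h4, h5, ← dist_eq_norm]
  rw [h3, Pi.sub_apply] at h2
  have h7 := h2.trans_lt hf'
  have h8 : ‖f' t‖ ≤ ‖f t‖ + ‖f' t - f t‖ := by
    simpa using norm_add_le (f t) (f' t - f t)
  refine (h _ ?_ _ ?_ ?_).le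
  · rw [mem_closedBall_zero_iff]
    linarith [min_le_right δ 1]
  · rw [mem_closedBall_zero_iff]; linarith
  · rw [dist_eq_norm]; exact h7.trans_le (min_le_left _ _)

/-- Mean value inequality at almost every t. Essential boundedness keeps all segments from f t to f
t + k t in one compact ball, where g' is uniformly continuous, so the small-o estimate is uniform in
t. -/
lemma hasFDerivAt_nemytskii {g : E → F} (hg : ContDiff ℝ 1 g) (f : Linf T E) :
    HasFDerivAt (nemytskii T g hg.continuous)
      (mulLinf T E F (nemytskii T (fderiv ℝ g) (hg.continuous_fderiv (by simp)) f)) f := by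
  have : ProperSpace E := FiniteDimensional.proper ℝ E
  set hg' := hg.continuous_fderiv (by simp)
  have huc := (isCompact_closedBall (0 : E) (‖f‖ + 1)).uniformContinuousOn_of_continuous
    hg'.continuousOn
  rw [hasFDerivAt_iff_isLittleO_nhds_zero, Asymptotics.isLittleO_iff]
  intro c hc
  obtain ⟨δ, hδ, h⟩ := Metric.uniformContinuousOn_iff.1 huc c hc
  rw [Metric.eventually_nhds_iff]
  refine ⟨min δ 1, by positivity, fun k hk => ?_⟩
  rw [dist_zero_right] at hk
  refine Linf.norm_le _ (by positivity) ?_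
  filter_upwards [(Linf.ae_norm_le f), (Linf.ae_norm_le k), nemytskii_ae hg.continuous f,
    nemytskii_ae hg.continuous (f + k), Lp.coeFn_add f k, nemytskii_ae hg' f,
    mulLinf_ae (nemytskii T (fderiv ℝ g) hg' f) k,
    Lp.coeFn_sub (nemytskii T g hg.continuous (f + k) - nemytskii T g hg.continuous f)
      (mulLinf T E F (nemytskii T (fderiv ℝ g) hg' f) k),
    Lp.coeFn_sub (nemytskii T g hg.continuous (f + k)) (nemytskii T g hg.continuous f)]
    with t h1 h2 h3 h4 h5 h6 h7 h8 h9
  rw [h8, Pi.sub_apply, h9, Pi.sub_apply, h7, h6, h4, h3, h5, Pi.add_apply]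
  have hkt : ‖k t‖ < min δ 1 := h2.trans_lt hk
  have hseg : ∀ y ∈ segment ℝ (f t) (f t + k t), ‖fderiv ℝ g y - fderiv ℝ g (f t)‖ ≤ c := by
    intro y hy
    rw [segment_eq_image'] at hy
    obtain ⟨θ, hθ, rfl⟩ := hy
    have h10 : ‖θ • (f t + k t - f t)‖ ≤ ‖k t‖ := by
      rw [add_sub_cancel_left, norm_smul, Real.norm_of_nonneg hθ.1]
      exact mul_le_of_le_one_left (norm_nonneg _) hθ.2
    rw [← dist_eq_norm]
    refine (h _ ?_ _ ?_ ?_).le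
    · rw [mem_closedBall_zero_iff]
      refine (norm_add_le _ _).trans ?_
      linarith [min_le_right δ 1]
    · rw [mem_closedBall_zero_iff]; linarith
    · rw [dist_eq_norm, add_sub_cancel_left]
      exact (h10.trans_lt hkt).trans_le (min_le_left _ _)
  have := (convex_segment (𝕜 := ℝ) (f t) (f t + k t)).norm_image_sub_le_of_norm_fderiv_le'
    (fun y _ => (hg.differentiable (by simp)) y) hseg (left_mem_segment ℝ _ _)
    (right_mem_segment ℝ _ _)
  rw [add_sub_cancel_left] at this
  exact this.trans (by gcongr)

end Nemytskii

/-- The derivative is the superposition operator of g' followed by a bounded linear map, which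
allows induction. The target space must vary, because g' takes values in E →L F. -/
lemma contDiff_nemytskii {T : ℝ} {E : Type} [NormedAddCommGroup E] [NormedSpace ℝ E]
    [FiniteDimensional ℝ E] (k : ℕ) : ∀ {F : Type} [NormedAddCommGroup F] [NormedSpace ℝ F]
    {g : E → F} (hg : ContDiff ℝ k g), ContDiff ℝ k (nemytskii T g hg.continuous) := by
  induction k with
  | zero => intro F _ _ g hg; exact contDiff_zero.2 (continuous_nemytskii hg.continuous)
  | succ k ih =>
    intro F _ _ g hg
    have h1 : ContDiff ℝ 1 g := hg.of_le (by norm_cast; omega)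
    have h2 : ContDiff ℝ k (fderiv ℝ g) := hg.fderiv_right (by norm_cast)
    generalize hg.continuous = hc
    rw [Nat.cast_add, Nat.cast_one, contDiff_succ_iff_hasFDerivAt]
    exact ⟨_, (mulLinf T E F).contDiff.comp (ih h2), fun f => hasFDerivAt_nemytskii h1 f⟩

/-! ### Linear differential equations: resolvent and adjoint -/

section LinearEquations

variable {E : Type} [NormedAddCommGroup E] [NormedSpace ℝ E] {T : ℝ}
  {G : Type*} [NormedAddCommGroup G] [NormedSpace ℝ G]

/-- Solution of a linear Volterra equation. -/
lemma exists_isPrim_of_volterra [CompleteSpace E] {C : ℝ} (hC : 0 ≤ C)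
    (M : Linf T E →L[ℝ] Linf T E)
    (hM : ∀ f, ∀ᵐ t ∂(timeMeasure T), ‖M f t‖ ≤ C * ‖f t‖) (x₀ : E) :
    ∃ (f : Linf T E) (x : ℝ → E), x =ᵐ[timeMeasure T] f ∧ IsPrim T x (M f) ∧ x 0 = x₀ := by
  obtain ⟨u, hu⟩ := isUnit_one_sub_volterra_comp hC M hM
  let f : Linf T E := (↑u⁻¹ : Linf T E →L[ℝ] Linf T E) (constLinf T E x₀)
  have hf : f - volterra T E (M f) = constLinf T E x₀ := by
    have h1 : (u : Linf T E →L[ℝ] Linf T E) * ↑u⁻¹ = 1 := u.mul_inv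
    rw [hu] at h1
    exact DFunLike.congr_fun h1 (constLinf T E x₀)
  refine ⟨f, fun t => x₀ + ∫ s in (0 : ℝ)..t, M f s, ?_, Linf.isPrim (M f) x₀, by simp⟩
  have hf' : f = constLinf T E x₀ + volterra T E (M f) := by rw [← hf]; abel
  have : (f : ℝ → E) =ᵐ[timeMeasure T] (constLinf T E x₀ + volterra T E (M f) : Linf T E) := by
    rw [← hf']
  filter_upwards [this, Lp.coeFn_add (constLinf T E x₀) (volterra T E (M f)),
    constLinf_ae (T := T) x₀, volterra_ae (M f)] with t h1 h2 h3 h4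
  rw [h1, h2, Pi.add_apply, h3, h4]

/-- `X` is the fundamental solution of `ẋ = A x` and `Y` is its inverse. -/
structure IsResolvent (T : ℝ) (A X Y : ℝ → E →L[ℝ] E) : Prop where
  primX : IsPrim T X (fun t => A t ∘L X t)
  primY : IsPrim T Y (fun t => -(Y t ∘L A t))
  X_zero : X 0 = 1
  Y_zero : Y 0 = 1
  Y_comp_X : ∀ t ∈ Set.Icc 0 T, Y t ∘L X t = 1
  X_comp_Y : ∀ t ∈ Set.Icc 0 T, X t ∘L Y t = 1

/-- X and Y solve two independent Volterra equations. The product Y X has derivative zero, hence is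
1; X Y = 1 follows because one-sided inverses are two-sided in finite dimension. -/
lemma exists_resolvent [FiniteDimensional ℝ E] {A : ℝ → E →L[ℝ] E}
    (hA : MemLp A ∞ (timeMeasure T)) : ∃ X Y, IsResolvent T A X Y := by
  have : CompleteSpace E := FiniteDimensional.complete ℝ E
  let A' : Linf T (E →L[ℝ] E) := hA.toLp
  have hA' : A' =ᵐ[timeMeasure T] A := hA.coeFn_toLp
  let L := ContinuousLinearMap.compL ℝ E E E
  let MX : Linf T (E →L[ℝ] E) →L[ℝ] Linf T (E →L[ℝ] E) := L.holderL (timeMeasure T) ∞ ∞ ∞ A'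
  let MY : Linf T (E →L[ℝ] E) →L[ℝ] Linf T (E →L[ℝ] E) :=
    (-L.flip).holderL (timeMeasure T) ∞ ∞ ∞ A'
  have hMX : ∀ f, MX f =ᵐ[timeMeasure T] fun t => A t ∘L f t := fun f => by
    filter_upwards [L.coeFn_holder (r := ∞) A' f, hA'] with t h1 h2
    rw [← h2]; exact h1
  have hMY : ∀ f, MY f =ᵐ[timeMeasure T] fun t => -(f t ∘L A t) := fun f => by
    filter_upwards [(-L.flip).coeFn_holder (r := ∞) A' f, hA'] with t h1 h2
    rw [← h2]; exact h1
  obtain ⟨f, X, hXf, hX, hX0⟩ := exists_isPrim_of_volterra (norm_nonneg A') MX (fun f => by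
    filter_upwards [hMX f, hA', Linf.ae_norm_le A'] with t h1 h2 h3
    rw [h1]
    rw [h2] at h3
    exact (ContinuousLinearMap.opNorm_comp_le _ _).trans (by gcongr)) 1
  obtain ⟨g, Y, hYg, hY, hY0⟩ := exists_isPrim_of_volterra (norm_nonneg A') MY (fun f => by
    filter_upwards [hMY f, hA', Linf.ae_norm_le A'] with t h1 h2 h3
    rw [h1, norm_neg, mul_comm]
    rw [h2] at h3
    exact (ContinuousLinearMap.opNorm_comp_le _ _).trans (by gcongr)) 1
  have hX' : IsPrim T X (fun t => A t ∘L X t) := hX.congr (by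
    filter_upwards [hMX f, hXf] with t h1 h2
    rw [h1, h2])
  have hY' : IsPrim T Y (fun t => -(Y t ∘L A t)) := hY.congr (by
    filter_upwards [hMY g, hYg] with t h1 h2
    rw [h1, h2])
  have hYX : ∀ t ∈ Set.Icc 0 T, Y t ∘L X t = 1 := fun t ht => by
    have h1 := hY'.bilin L hX'
    have h2 := h1.eq_zero_deriv (Eventually.of_forall fun t => by
      ext v; simp [L]) ht
    have h3 : Y t ∘L X t = Y 0 ∘L X 0 := h2
    rw [h3, hX0, hY0]; rfl
  refine ⟨X, Y, hX', hY', hX0, hY0, hYX, fun t ht => ?_⟩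
  have h1 : (Y t : E →ₗ[ℝ] E) * (X t : E →ₗ[ℝ] E) = 1 :=
    LinearMap.ext fun v => DFunLike.congr_fun (hYX t ht) v
  have h2 := mul_eq_one_comm.1 h1
  exact ContinuousLinearMap.ext fun v => DFunLike.congr_fun h2 v

namespace IsResolvent

variable {A X Y : ℝ → E →L[ℝ] E}

/-- The variation of constants formula. -/
lemma eq_of_isPrim [CompleteSpace E] (h : IsResolvent T A X Y) {x b : ℝ → E}
    (hx : IsPrim T x (fun t => A t (x t) + b t)) {t : ℝ} (ht : t ∈ Set.Icc 0 T) :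
    x t = X t (x 0 + ∫ s in (0 : ℝ)..t, Y s (b s)) := by
  have h1 := h.primY.bilin (ContinuousLinearMap.id ℝ (E →L[ℝ] E)) hx
  have h2 : IsPrim T (fun t => Y t (x t)) (fun t => Y t (b t)) := h1.congr
    (Eventually.of_forall fun t => by simp)
  have h3 := h2.eq t ht
  simp only [h.Y_zero] at h3
  have h4 := DFunLike.congr_fun (h.X_comp_Y t ht) (x t)
  simp only [ContinuousLinearMap.comp_apply, one_apply_eq_self] at h4
  rw [← h4, h3]; rfl

/-- The variation of constants formula yields a solution. -/
lemma isPrim_solution [CompleteSpace E] (h : IsResolvent T A X Y) {b : ℝ → E}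
    (hb : Integrable b (timeMeasure T)) (x₀ : E) :
    IsPrim T (fun t => X t (x₀ + ∫ s in (0 : ℝ)..t, Y s (b s)))
      (fun t => A t (X t (x₀ + ∫ s in (0 : ℝ)..t, Y s (b s))) + b t) := by
  obtain ⟨C, -, hC⟩ := h.primY.exists_bound
  have hint : Integrable (fun t => Y t (b t)) (timeMeasure T) :=
    (ContinuousLinearMap.id ℝ (E →L[ℝ] E)).integrable_of_bilin_of_bdd_left C
      h.primY.aestronglyMeasurable (ae_mem_Icc.mono hC) hb
  have h1 := h.primX.bilin (ContinuousLinearMap.id ℝ (E →L[ℝ] E)) (IsPrim.of_integrable hint x₀)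
  refine h1.congr ?_
  filter_upwards [ae_mem_Icc (T := T)] with t ht
  have h4 := DFunLike.congr_fun (h.X_comp_Y t ht) (b t)
  simp only [ContinuousLinearMap.comp_apply, one_apply_eq_self] at h4
  simp [h4]

/-- The solution of the adjoint equation with prescribed final value. -/
lemma isPrim_adjoint [CompleteSpace E] [CompleteSpace G] (h : IsResolvent T A X Y) (q : E →L[ℝ] G) :
    IsPrim T (fun t => q ∘L X T ∘L Y t) (fun t => -((q ∘L X T ∘L Y t) ∘L A t)) := by
  have h1 := h.primY.clm (ContinuousLinearMap.compL ℝ E E G (q ∘L X T))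
  refine ⟨?_, fun t ht => ?_⟩
  · refine h1.integrable.congr (Eventually.of_forall fun t => ?_)
    ext v; simp
  · have h2 := h1.eq t ht
    simp only [ContinuousLinearMap.compL_apply] at h2
    have h3 : ∀ t, q ∘L X T ∘L Y t = (q ∘L X T) ∘L Y t := fun t => rfl
    rw [h3, h2]
    congr 1
    refine intervalIntegral.integral_congr fun s _ => ?_
    ext v; simp

lemma adjoint_final (h : IsResolvent T A X Y) (hT : 0 ≤ T) (q : E →L[ℝ] G) :
    q ∘L X T ∘L Y T = q := by
  rw [h.X_comp_Y T (T_mem_Icc hT)]; ext; simp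

/-- Uniqueness for the adjoint equation. -/
lemma adjoint_unique [CompleteSpace E] (h : IsResolvent T A X Y) {p : ℝ → StrongDual ℝ E}
    (hp : IsPrim T p (fun t => -(p t ∘L A t))) {t : ℝ} (ht : t ∈ Set.Icc 0 T) :
    p t = p T ∘L X T ∘L Y t := by
  have h1 := hp.bilin (ContinuousLinearMap.compL ℝ E E ℝ) h.primX
  have h2 : ∀ t ∈ Set.Icc 0 T, p t ∘L X t = p 0 := fun t ht => by
    have := h1.eq_zero_deriv (Eventually.of_forall fun t => by ext v; simp) ht
    simp only [ContinuousLinearMap.compL_apply, h.X_zero] at this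
    rw [this]; rfl
  have hT := ht.1.trans ht.2
  have h3 : p t = (p t ∘L X t) ∘L Y t := by
    rw [ContinuousLinearMap.comp_assoc, h.X_comp_Y t ht]; rfl
  rw [h3, h2 t ht, ← h2 T (T_mem_Icc hT)]; rfl

end IsResolvent

/-- Duality between the adjoint equation and the linear equation. -/
lemma IsPrim.duality [FiniteDimensional ℝ E] [CompleteSpace G] {A : ℝ → E →L[ℝ] E} {p : ℝ → E →L[ℝ] G} {x b : ℝ → E}
    (hp : IsPrim T p (fun t => -(p t ∘L A t))) (hx : IsPrim T x (fun t => A t (x t) + b t)) :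
    IsPrim T (fun t => p t (x t)) (fun t => p t (b t)) :=
  have : CompleteSpace E := FiniteDimensional.complete ℝ E
  (hp.bilin (ContinuousLinearMap.id ℝ (E →L[ℝ] G)) hx).congr
    (Eventually.of_forall fun t => by simp)

end LinearEquations

/-! ### Second-order jets of curves -/

section Jets

variable {V W : Type*} [NormedAddCommGroup V] [NormedSpace ℝ V]
  [NormedAddCommGroup W] [NormedSpace ℝ W]

/-- The first two derivatives at zero of a curve. -/
def HasJet (z : ℝ → V) (z₁ z₂ : V) : Prop :=
  ∃ z' : ℝ → V, (∀ᶠ s in 𝓝 0, HasDerivAt z (z' s) s) ∧ z' 0 = z₁ ∧ HasDerivAt z' z₂ 0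

namespace HasJet

variable {z w : ℝ → V} {z₁ z₂ w₁ w₂ : V}

/-- Expanding one curve in two ways identifies its first two derivatives. The derivatives of an
implicitly defined map are obtained in this way, without differentiating the implicit function
formula. -/
lemma unique (h : HasJet z z₁ z₂) (h' : HasJet z w₁ w₂) : z₁ = w₁ ∧ z₂ = w₂ := by
  obtain ⟨z', hz, rfl, hz2⟩ := h
  obtain ⟨w', hw, rfl, hw2⟩ := h'
  have heq : z' =ᶠ[𝓝 0] w' := by
    filter_upwards [hz, hw] with s h1 h2 using h1.unique h2
  exact ⟨heq.eq_of_nhds, (hz2.congr_of_eventuallyEq heq.symm).unique hw2⟩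

lemma congr (h : HasJet z z₁ z₂) (hzw : z =ᶠ[𝓝 0] w) : HasJet w z₁ z₂ := by
  obtain ⟨z', hz, rfl, hz2⟩ := h
  refine ⟨z', ?_, rfl, hz2⟩
  filter_upwards [hz, hzw.eventuallyEq_nhds] with s h1 h2 using h1.congr_of_eventuallyEq h2.symm

lemma add (h : HasJet z z₁ z₂) (h' : HasJet w w₁ w₂) :
    HasJet (fun s => z s + w s) (z₁ + w₁) (z₂ + w₂) := by
  obtain ⟨z', hz, rfl, hz2⟩ := h
  obtain ⟨w', hw, rfl, hw2⟩ := h'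
  refine ⟨fun s => z' s + w' s, ?_, rfl, hz2.add hw2⟩
  filter_upwards [hz, hw] with s h1 h2 using h1.add h2

lemma line (a ζ : V) : HasJet (fun s : ℝ => a + s • ζ) ζ 0 := by
  refine ⟨fun _ => ζ, Eventually.of_forall fun s => ?_, rfl, hasDerivAt_const _ _⟩
  simpa using ((hasDerivAt_id s).smul_const ζ).const_add a

lemma clm (L : V →L[ℝ] W) (h : HasJet z z₁ z₂) : HasJet (fun s => L (z s)) (L z₁) (L z₂) := by
  obtain ⟨z', hz, rfl, hz2⟩ := h
  refine ⟨fun s => L (z' s), ?_, rfl, L.hasFDerivAt.comp_hasDerivAt _ hz2⟩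
  filter_upwards [hz] with s h1 using L.hasFDerivAt.comp_hasDerivAt _ h1

lemma prodMk {w : ℝ → W} {w₁ w₂ : W} (h : HasJet z z₁ z₂) (h' : HasJet w w₁ w₂) :
    HasJet (fun s => (z s, w s)) (z₁, w₁) (z₂, w₂) := by
  obtain ⟨z', hz, rfl, hz2⟩ := h
  obtain ⟨w', hw, rfl, hw2⟩ := h'
  refine ⟨fun s => (z' s, w' s), ?_, rfl, hz2.prodMk hw2⟩
  filter_upwards [hz, hw] with s h1 h2 using h1.prodMk h2

lemma comp {f : V → W} (hf : ContDiffAt ℝ 2 f (z 0)) (h : HasJet z z₁ z₂) :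
    HasJet (fun s => f (z s)) (fderiv ℝ f (z 0) z₁)
      (fderiv ℝ (fderiv ℝ f) (z 0) z₁ z₁ + fderiv ℝ f (z 0) z₂) := by
  obtain ⟨z', hz, rfl, hz2⟩ := h
  have hc : ContinuousAt z 0 := hz.self_of_nhds.continuousAt
  refine ⟨fun s => fderiv ℝ f (z s) (z' s), ?_, rfl, ?_⟩
  · have h1 : ∀ᶠ v in 𝓝 (z 0), DifferentiableAt ℝ f v :=
      (hf.eventually (by simp)).mono fun v hv => hv.differentiableAt (by simp)
    filter_upwards [hz, hc.eventually h1] with s hs1 hs2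
    exact hs2.hasFDerivAt.comp_hasDerivAt s hs1
  · have hd2 : HasFDerivAt (fderiv ℝ f) (fderiv ℝ (fderiv ℝ f) (z 0)) (z 0) :=
      ((hf.fderiv_right (m := 1) (by norm_num)).differentiableAt (by simp)).hasFDerivAt
    exact (hd2.comp_hasDerivAt (0 : ℝ) hz.self_of_nhds).clm_apply hz2

lemma comp_line {f : V → W} {a : V} (hf : ContDiffAt ℝ 2 f a) (ζ : V) :
    HasJet (fun s : ℝ => f (a + s • ζ)) (fderiv ℝ f a ζ) (fderiv ℝ (fderiv ℝ f) a ζ ζ) := by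
  have := (line a ζ).comp (f := f) (by simpa using hf)
  simpa using this

end HasJet

end Jets

/-! ### The control-to-state map and its derivatives -/

section ControlToState

variable {E W : Type} [NormedAddCommGroup E] [NormedSpace ℝ E] [FiniteDimensional ℝ E]
  [NormedAddCommGroup W] [NormedSpace ℝ W] [FiniteDimensional ℝ W] {T : ℝ} {F : E × W → E}

/-- The pair of a bounded state and a bounded control. -/
def pairLinf (T : ℝ) (E W : Type) [NormedAddCommGroup E] [NormedSpace ℝ E]
    [NormedAddCommGroup W] [NormedSpace ℝ W] : Linf T E × Linf T W →L[ℝ] Linf T (E × W) :=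
  (ContinuousLinearMap.inl ℝ E W).compLpL ∞ (timeMeasure T) ∘L ContinuousLinearMap.fst ℝ _ _ +
  (ContinuousLinearMap.inr ℝ E W).compLpL ∞ (timeMeasure T) ∘L ContinuousLinearMap.snd ℝ _ _

omit [FiniteDimensional ℝ E] [FiniteDimensional ℝ W] in
lemma pairLinf_ae (x : Linf T E) (w : Linf T W) :
    pairLinf T E W (x, w) =ᵐ[timeMeasure T] fun t => (x t, w t) := by
  filter_upwards [Lp.coeFn_add ((ContinuousLinearMap.inl ℝ E W).compLpL ∞ (timeMeasure T) x)
    ((ContinuousLinearMap.inr ℝ E W).compLpL ∞ (timeMeasure T) w),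
    (ContinuousLinearMap.inl ℝ E W).coeFn_compLpL x,
    (ContinuousLinearMap.inr ℝ E W).coeFn_compLpL w] with t h1 h2 h3
  have h4 : pairLinf T E W (x, w) = (ContinuousLinearMap.inl ℝ E W).compLpL ∞ (timeMeasure T) x +
    (ContinuousLinearMap.inr ℝ E W).compLpL ∞ (timeMeasure T) w := rfl
  rw [h4, h1, Pi.add_apply, h2, h3]
  simp

/-- The residual of the state equation in integral form, for an initial value and a control
`q.1` and a state `q.2`. -/
def stateResidual (T : ℝ) (hF : Continuous F) (q : (E × Linf T W) × Linf T E) : Linf T E :=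
  q.2 - constLinf T E q.1.1 - volterra T E (nemytskii T F hF (pairLinf T E W (q.2, q.1.2)))

lemma contDiff_stateResidual (hF : ContDiff ℝ 2 F) :
    ContDiff ℝ 2 (stateResidual T hF.continuous) := by
  have h := contDiff_nemytskii (T := T) 2 hF
  have h2 : ContDiff ℝ 2 fun q : (E × Linf T W) × Linf T E =>
      pairLinf T E W (q.2, q.1.2) :=
    (pairLinf T E W).contDiff.comp (contDiff_snd.prodMk (contDiff_snd.comp contDiff_fst))
  exact (contDiff_snd.sub ((constLinf T E).contDiff.comp (contDiff_fst.comp contDiff_fst))).sub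
    ((volterra T E).contDiff.comp (h.comp h2))

/-- M is multiplication by the bounded matrix F_x, so the partial derivative in the state has the
form inverted by `isUnit_one_sub_volterra_comp`. This is the hypothesis of the implicit function
theorem. -/
lemma fderiv_stateResidual_inr (hF : ContDiff ℝ 2 F) (q : (E × Linf T W) × Linf T E) :
    ∃ M : Linf T E →L[ℝ] Linf T E, ∃ C, 0 ≤ C ∧
      (∀ f, ∀ᵐ t ∂(timeMeasure T), ‖M f t‖ ≤ C * ‖f t‖) ∧
      fderiv ℝ (stateResidual T hF.continuous) q ∘L ContinuousLinearMap.inr ℝ _ _ =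
        1 - volterra T E ∘L M := by
  have hF1 : ContDiff ℝ 1 F := hF.of_le (by norm_num)
  set D : Linf T (E × W →L[ℝ] E) := nemytskii T (fderiv ℝ F) (hF1.continuous_fderiv (by simp))
    (pairLinf T E W (q.2, q.1.2)) with hD
  let inrZ : Linf T E →L[ℝ] Linf T (E × W) := pairLinf T E W ∘L ContinuousLinearMap.inl ℝ _ _
  refine ⟨mulLinf T (E × W) E D ∘L inrZ, ‖D‖, norm_nonneg _, fun f => ?_, ?_⟩
  · filter_upwards [mulLinf_ae D (inrZ f), pairLinf_ae f (0 : Linf T W), Linf.ae_norm_le D,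
      Lp.coeFn_zero (E := W) (p := ∞) (μ := timeMeasure T)] with t h1 h2 h3 h4
    have h5 : inrZ f t = (f t, 0) := by
      have : inrZ f = pairLinf T E W (f, 0) := rfl
      rw [this, h2, h4]; rfl
    rw [ContinuousLinearMap.comp_apply, h1, h5]
    refine (ContinuousLinearMap.le_opNorm _ _).trans ?_
    have h6 : ‖(f t, (0 : W))‖ = ‖f t‖ := by simp [Prod.norm_def]
    rw [h6]
    gcongr
  · have h1 : HasFDerivAt (fun x : Linf T E => stateResidual T hF.continuous (q.1, x))
        (1 - volterra T E ∘L (mulLinf T (E × W) E D ∘L inrZ)) q.2 := by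
      have hz : HasFDerivAt (fun x : Linf T E => pairLinf T E W (x, q.1.2)) inrZ q.2 :=
        (pairLinf T E W).hasFDerivAt.comp q.2 (hasFDerivAt_prodMk_left q.2 q.1.2)
      have hn := (hasFDerivAt_nemytskii hF1 (pairLinf T E W (q.2, q.1.2))).comp q.2 hz
      have hv := (volterra T E).hasFDerivAt.comp q.2 hn
      exact ((hasFDerivAt_id q.2).sub_const (constLinf T E q.1.1)).sub hv
    have h2 := (((contDiff_stateResidual (T := T) hF).differentiable (by simp)) q).hasFDerivAt
    have h3 := HasFDerivAt.comp (f := fun x : Linf T E => (q.1, x)) q.2 h2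
      (hasFDerivAt_prodMk_right q.1 q.2)
    exact h3.unique h1

/-- Solvability of the state equation near a reference trajectory. -/
lemma exists_controlToState (hF : ContDiff ℝ 2 F) (u₀ : E × Linf T W) (x₀ : Linf T E)
    (h0 : stateResidual T hF.continuous (u₀, x₀) = 0) :
    ∃ ψ : E × Linf T W → Linf T E, ContDiffAt ℝ 2 ψ u₀ ∧ ψ u₀ = x₀ ∧
      ∀ᶠ u in 𝓝 u₀, stateResidual T hF.continuous (u, ψ u) = 0 := by
  have : CompleteSpace E := FiniteDimensional.complete ℝ E
  have : CompleteSpace W := FiniteDimensional.complete ℝ W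
  have cdf : ContDiffAt ℝ 2 (stateResidual T hF.continuous) (u₀, x₀) :=
    (contDiff_stateResidual hF).contDiffAt
  have hinv : (fderiv ℝ (stateResidual T hF.continuous) (u₀, x₀) ∘L
      ContinuousLinearMap.inr ℝ (E × Linf T W) (Linf T E)).IsInvertible := by
    obtain ⟨M, C, hC, hM, h⟩ := fderiv_stateResidual_inr (T := T) hF (u₀, x₀)
    rw [h]
    obtain ⟨u, hu⟩ := isUnit_one_sub_volterra_comp hC M hM
    rw [← hu]
    exact ContinuousLinearMap.IsInvertible.of_inverse (g := (↑u⁻¹ : Linf T E →L[ℝ] Linf T E))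
      u.mul_inv u.inv_mul
  refine ⟨cdf.implicitFunction (by simp) hinv, cdf.contDiffAt_implicitFunction (by simp) hinv,
    cdf.implicitFunction_apply_self (by simp) hinv, ?_⟩
  have := cdf.eventually_apply_implicitFunction (by simp) hinv
  rwa [h0] at this

/-- The initial and the final state as a function of the initial state and of the control. -/
def endpointMap (hF : Continuous F) (ψ : E × Linf T W → Linf T E) (u : E × Linf T W) : E × E :=
  (u.1, u.1 + integralLinf T E (nemytskii T F hF (pairLinf T E W (ψ u, u.2))))

/-- ψ u is only an a.e. class and has no value at T; writing the final state as an integral makes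
the map a composition of smooth maps. -/
lemma contDiffAt_endpointMap (hF : ContDiff ℝ 2 F) {ψ : E × Linf T W → Linf T E}
    {u₀ : E × Linf T W} (hψ : ContDiffAt ℝ 2 ψ u₀) :
    ContDiffAt ℝ 2 (endpointMap hF.continuous ψ) u₀ := by
  have h := contDiff_nemytskii (T := T) 2 hF
  have h2 : ContDiffAt ℝ 2 (fun u => pairLinf T E W (ψ u, u.2)) u₀ :=
    (pairLinf T E W).contDiff.contDiffAt.comp u₀ (hψ.prodMk contDiffAt_snd)
  exact contDiffAt_fst.prodMk (contDiffAt_fst.add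
    ((integralLinf T E).contDiff.contDiffAt.comp u₀ (h.contDiffAt.comp u₀ h2)))

lemma fderiv_fderiv_nemytskii_ae (hF : ContDiff ℝ 2 F) (f a b : Linf T (E × W)) :
    fderiv ℝ (fderiv ℝ (nemytskii T F hF.continuous)) f a b =ᵐ[timeMeasure T]
      fun t => fderiv ℝ (fderiv ℝ F) (f t) (a t) (b t) := by
  have hF1 : ContDiff ℝ 1 F := hF.of_le (by norm_num)
  have hF2 : ContDiff ℝ 1 (fderiv ℝ F) := hF.fderiv_right (by norm_num)
  have h1 : fderiv ℝ (nemytskii T F hF.continuous) = fun f => mulLinf T (E × W) E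
      (nemytskii T (fderiv ℝ F) hF2.continuous f) := funext fun f =>
    (hasFDerivAt_nemytskii hF1 f).fderiv
  have h2 : fderiv ℝ (fderiv ℝ (nemytskii T F hF.continuous)) f =
      mulLinf T (E × W) E ∘L mulLinf T (E × W) (E × W →L[ℝ] E)
        (nemytskii T (fderiv ℝ (fderiv ℝ F)) (hF2.continuous_fderiv (by simp)) f) := by
    rw [h1]
    exact ((mulLinf T (E × W) E).hasFDerivAt.comp f (hasFDerivAt_nemytskii hF2 f)).fderiv
  rw [h2]
  filter_upwards [mulLinf_ae (mulLinf T (E × W) (E × W →L[ℝ] E)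
        (nemytskii T (fderiv ℝ (fderiv ℝ F)) (hF2.continuous_fderiv (by simp)) f) a) b,
    mulLinf_ae (nemytskii T (fderiv ℝ (fderiv ℝ F)) (hF2.continuous_fderiv (by simp)) f) a,
    nemytskii_ae (hF2.continuous_fderiv (by simp)) f] with t h3 h4 h5
  simp only [ContinuousLinearMap.comp_apply]
  rw [h3, h4, h5]

lemma fderiv_nemytskii_ae (hF : ContDiff ℝ 2 F) (f a : Linf T (E × W)) :
    fderiv ℝ (nemytskii T F hF.continuous) f a =ᵐ[timeMeasure T]
      fun t => fderiv ℝ F (f t) (a t) := by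
  have hF1 : ContDiff ℝ 1 F := hF.of_le (by norm_num)
  rw [(hasFDerivAt_nemytskii hF1 f).fderiv]
  filter_upwards [mulLinf_ae (nemytskii T (fderiv ℝ F) (hF1.continuous_fderiv (by simp)) f) a,
    nemytskii_ae (hF1.continuous_fderiv (by simp)) f] with t h1 h2
  rw [h1, h2]

/-- The first and second derivatives of the endpoint map along a direction `ζ`: they are given by
the solutions `x` and `h` of the first and second order linearized state equations. -/
lemma endpointMap_derivatives (hT : 0 ≤ T) (hF : ContDiff ℝ 2 F) {ψ : E × Linf T W → Linf T E}
    {u₀ : E × Linf T W} (hψ : ContDiffAt ℝ 2 ψ u₀)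
    (hres : ∀ᶠ u in 𝓝 u₀, stateResidual T hF.continuous (u, ψ u) = 0) (ζ : E × Linf T W) :
    ∃ x h : ℝ → E,
      IsPrim T x (fun t => fderiv ℝ F (ψ u₀ t, u₀.2 t) (x t, ζ.2 t)) ∧ x 0 = ζ.1 ∧
      fderiv ℝ (endpointMap hF.continuous ψ) u₀ ζ = (x 0, x T) ∧
      IsPrim T h (fun t => fderiv ℝ F (ψ u₀ t, u₀.2 t) (h t, 0) +
        fderiv ℝ (fderiv ℝ F) (ψ u₀ t, u₀.2 t) (x t, ζ.2 t) (x t, ζ.2 t)) ∧ h 0 = 0 ∧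
      fderiv ℝ (fderiv ℝ (endpointMap hF.continuous ψ)) u₀ ζ ζ = (0, h T) := by
  have hN := contDiff_nemytskii (T := T) 2 hF
  obtain ⟨x₁, x₂, hx⟩ : ∃ x₁ x₂, HasJet (fun s : ℝ => ψ (u₀ + s • ζ)) x₁ x₂ :=
    ⟨_, _, HasJet.comp_line hψ ζ⟩
  let z₁ := pairLinf T E W (x₁, ζ.2)
  let z₂ := pairLinf T E W (x₂, 0)
  let z₀ := pairLinf T E W (ψ u₀, u₀.2)
  have hz : HasJet (fun s : ℝ => pairLinf T E W (ψ (u₀ + s • ζ), (u₀ + s • ζ).2)) z₁ z₂ :=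
    (hx.prodMk ((HasJet.line u₀ ζ).clm (ContinuousLinearMap.snd ℝ E (Linf T W)))).clm
      (pairLinf T E W)
  let N := nemytskii T F hF.continuous
  let y₁ := fderiv ℝ N z₀ z₁
  let y₂ := fderiv ℝ (fderiv ℝ N) z₀ z₁ z₁ + fderiv ℝ N z₀ z₂
  have hy : HasJet (fun s : ℝ => N (pairLinf T E W (ψ (u₀ + s • ζ), (u₀ + s • ζ).2))) y₁ y₂ := by
    have := HasJet.comp (f := N) hN.contDiffAt hz
    simpa [z₀, y₁, y₂] using this
  have hfst := (HasJet.line u₀ ζ).clm (ContinuousLinearMap.fst ℝ E (Linf T W))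
  have hline : Tendsto (fun s : ℝ => u₀ + s • ζ) (𝓝 0) (𝓝 u₀) := by
    have := (by fun_prop : Continuous fun s : ℝ => u₀ + s • ζ).tendsto 0
    simpa using this
  -- The integral state equation expresses the curve ψ(u₀ + sζ) through its own superposition.
  -- Comparing both jets yields the integral forms of the first- and second-order linearized
  -- equations.
  have hx' : HasJet (fun s : ℝ => ψ (u₀ + s • ζ)) (constLinf T E ζ.1 + volterra T E y₁)
      (constLinf T E 0 + volterra T E y₂) := by
    refine ((hfst.clm (constLinf T E)).add (hy.clm (volterra T E))).congr ?_
    filter_upwards [hline.eventually hres] with s hs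
    simp only [stateResidual] at hs
    rw [sub_sub, sub_eq_zero] at hs
    exact hs.symm
  obtain ⟨hx1, hx2⟩ := hx.unique hx'
  have he : HasJet (fun s : ℝ => endpointMap hF.continuous ψ (u₀ + s • ζ))
      (ζ.1, ζ.1 + integralLinf T E y₁) (0, 0 + integralLinf T E y₂) :=
    hfst.prodMk (hfst.add (hy.clm (integralLinf T E)))
  obtain ⟨he1, he2⟩ := (HasJet.comp_line (contDiffAt_endpointMap hF hψ) ζ).unique he
  have hz0 := pairLinf_ae (T := T) (ψ u₀) u₀.2
  have hx1ae : x₁ =ᵐ[timeMeasure T] fun t => ζ.1 + ∫ s in (0 : ℝ)..t, y₁ s := by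
    rw [hx1]
    filter_upwards [Lp.coeFn_add (constLinf T E ζ.1) (volterra T E y₁),
      constLinf_ae (T := T) ζ.1, volterra_ae y₁] with t h1 h2 h3
    rw [h1, Pi.add_apply, h2, h3]
  have hx2ae : x₂ =ᵐ[timeMeasure T] fun t => 0 + ∫ s in (0 : ℝ)..t, y₂ s := by
    rw [hx2, map_zero, zero_add]
    filter_upwards [volterra_ae y₂] with t h3
    rw [h3, zero_add]
  refine ⟨fun t => ζ.1 + ∫ s in (0 : ℝ)..t, y₁ s, fun t => 0 + ∫ s in (0 : ℝ)..t, y₂ s,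
    (Linf.isPrim y₁ ζ.1).congr ?_, by simp, ?_, (Linf.isPrim y₂ 0).congr ?_, by simp, ?_⟩
  · filter_upwards [fderiv_nemytskii_ae hF z₀ z₁, hz0, pairLinf_ae x₁ ζ.2, hx1ae] with t h1 h2 h3 h4
    rw [h1, h2, h3, h4]
  · rw [he1, integralLinf_apply, integral_timeMeasure hT]
    simp
  · filter_upwards [fderiv_nemytskii_ae hF z₀ z₂, hz0, pairLinf_ae x₁ ζ.2, hx1ae,
      pairLinf_ae x₂ (0 : Linf T W), hx2ae, fderiv_fderiv_nemytskii_ae hF z₀ z₁ z₁,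
      Lp.coeFn_add (fderiv ℝ (fderiv ℝ N) z₀ z₁ z₁) (fderiv ℝ N z₀ z₂),
      Lp.coeFn_zero (E := W) (p := ∞) (μ := timeMeasure T)]
      with t h1 h2 h3 h4 h5 h6 h7 h8 h9
    rw [h8, Pi.add_apply, h7, h1, h2, h3, h4, h5, h6, h9, add_comm]
    rfl
  · rw [he2, integralLinf_apply, integral_timeMeasure hT]

end ControlToState

variable {n l m dφ dη : ℕ}

lemma memLp_top_comp {E F : Type} [NormedAddCommGroup E] [NormedSpace ℝ E] [FiniteDimensional ℝ E]
    [NormedAddCommGroup F] {T : ℝ} {g : E → F} (hg : Continuous g) {z : ℝ → E}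
    (hz : MemLp z ∞ (timeMeasure T)) : MemLp (fun t => g (z t)) ∞ (timeMeasure T) :=
  (memLp_comp_Linf hg hz.toLp).ae_eq (by filter_upwards [hz.coeFn_toLp] with t ht; rw [ht])

lemma exists_ae_bound {F : Type*} [NormedAddCommGroup F] {T : ℝ} {z : ℝ → F}
    (hz : MemLp z ∞ (timeMeasure T)) : ∃ C, 0 ≤ C ∧ ∀ᵐ t ∂(timeMeasure T), ‖z t‖ ≤ C := by
  refine ⟨‖hz.toLp‖, norm_nonneg _, ?_⟩
  filter_upwards [Linf.ae_norm_le hz.toLp, hz.coeFn_toLp] with t h1 h2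
  rwa [← h2]

lemma MemW1.isPrim {E : Type} [NormedAddCommGroup E] [NormedSpace ℝ E] {q : ℝ≥0∞} (hq : 1 ≤ q)
    {T : ℝ} {x : ℝ → E} (h : MemW1 q T x) : ∃ y, MemLp y q (timeMeasure T) ∧ IsPrim T x y := by
  obtain ⟨y, hy, hx⟩ := h
  exact ⟨y, hy, hy.integrable hq, hx⟩

lemma MemW1.isPrim_of_hasDerivAt {E : Type} [NormedAddCommGroup E] [NormedSpace ℝ E]
    [CompleteSpace E] {q : ℝ≥0∞} (hq : 1 ≤ q) {T : ℝ} {x y : ℝ → E} (h : MemW1 q T x)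
    (hd : ∀ᵐ t ∂(timeMeasure T), HasDerivAt x (y t) t) : IsPrim T x y := by
  obtain ⟨y', -, hy⟩ := h.isPrim hq
  exact hy.congr_deriv hd

lemma IsPrim.memW1 {E : Type} [NormedAddCommGroup E] [NormedSpace ℝ E] {q : ℝ≥0∞} {T : ℝ}
    {x y : ℝ → E} (h : IsPrim T x y) (hy : MemLp y q (timeMeasure T)) : MemW1 q T x :=
  ⟨y, hy, h.eq⟩

/-! ### The linearized state equation along the reference trajectory -/

namespace MayerProblem

variable (P : MayerProblem n l m dφ dη) (ŵ : Triple n l m)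

/-- The derivative of the dynamics with respect to the state, along `ŵ`. -/
def stateMatrix (t : ℝ) : Vec n →L[ℝ] Vec n :=
  fderiv ℝ P.F (ŵ.at t) ∘L ContinuousLinearMap.inl ℝ (Vec n) (Vec l × Vec m)

/-- The derivative of the dynamics with respect to both controls, along `ŵ`. -/
def controlMatrix (t : ℝ) : Vec l × Vec m →L[ℝ] Vec n :=
  fderiv ℝ P.F (ŵ.at t) ∘L ContinuousLinearMap.inr ℝ (Vec n) (Vec l × Vec m)

/-- The second derivative of the dynamics along `ŵ`. -/
def hessF (t : ℝ) : Vec n × Vec l × Vec m →L[ℝ] Vec n × Vec l × Vec m →L[ℝ] Vec n :=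
  fderiv ℝ (fderiv ℝ P.F) (ŵ.at t)

lemma fderiv_F_apply (t : ℝ) (x : Vec n) (w : Vec l × Vec m) :
    fderiv ℝ P.F (ŵ.at t) (x, w) = P.stateMatrix ŵ t x + P.controlMatrix ŵ t w := by
  simp only [stateMatrix, controlMatrix, ContinuousLinearMap.comp_apply]
  rw [← map_add]
  simp

/-- The data of a regular reference trajectory together with a resolvent of the linearized
equation. -/
structure IsReference (X Y : ℝ → Vec n →L[ℝ] Vec n) : Prop where
  pos : 0 < P.T
  contDiff_F : ContDiff ℝ 2 P.F
  contDiff_φ : ∀ i, ContDiff ℝ 2 (P.φ i)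
  contDiff_η : ∀ j, ContDiff ℝ 2 (P.η j)
  traj : P.IsTrajectory ŵ
  res : IsResolvent P.T (P.stateMatrix ŵ) X Y

variable {P ŵ}

lemma Regular.contDiff_F (h : P.Regular) : ContDiff ℝ 2 P.F := by
  have h0 : ContDiff ℝ 2 fun z : Vec n × Vec l × Vec m => (z.1, z.2.1) := by fun_prop
  refine ((h.1 0).1.comp h0).add (ContDiff.sum fun i _ => ?_)
  have h1 : ContDiff ℝ 2 fun v : Vec m => v i :=
    (EuclideanSpace.proj i : Vec m →L[ℝ] ℝ).contDiff
  exact (h1.comp (contDiff_snd.comp contDiff_snd)).smul ((h.1 i.succ).1.comp h0)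

lemma IsTrajectory.memLp_controls (h : P.IsTrajectory ŵ) :
    MemLp (fun t => (ŵ.u t, ŵ.v t)) ∞ (timeMeasure P.T) := memLp_prod_iff.2 ⟨h.1.2.1, h.1.2.2⟩

lemma IsTrajectory.memLp_x (h : P.IsTrajectory ŵ) : MemLp ŵ.x ∞ (timeMeasure P.T) := by
  obtain ⟨y, -, hy⟩ := h.1.1.isPrim (by simp)
  exact hy.memLp_top

lemma IsTrajectory.memLp_at (h : P.IsTrajectory ŵ) : MemLp ŵ.at ∞ (timeMeasure P.T) :=
  memLp_prod_iff.2 ⟨h.memLp_x, h.memLp_controls⟩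

lemma IsTrajectory.isPrim (h : P.IsTrajectory ŵ) : IsPrim P.T ŵ.x (fun t => P.F (ŵ.at t)) :=
  h.1.1.isPrim_of_hasDerivAt (by simp) h.2

lemma memLp_fderiv_F (hF : ContDiff ℝ 2 P.F) (h : P.IsTrajectory ŵ) :
    MemLp (fun t => fderiv ℝ P.F (ŵ.at t)) ∞ (timeMeasure P.T) :=
  memLp_top_comp (hF.continuous_fderiv (by simp)) h.memLp_at

lemma memLp_stateMatrix (hF : ContDiff ℝ 2 P.F) (h : P.IsTrajectory ŵ) :
    MemLp (P.stateMatrix ŵ) ∞ (timeMeasure P.T) :=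
  memLp_top_comp (g := fun z => fderiv ℝ P.F z ∘L
    ContinuousLinearMap.inl ℝ (Vec n) (Vec l × Vec m))
    ((hF.continuous_fderiv (by simp)).clm_comp continuous_const) h.memLp_at

lemma memLp_controlMatrix (hF : ContDiff ℝ 2 P.F) (h : P.IsTrajectory ŵ) :
    MemLp (P.controlMatrix ŵ) ∞ (timeMeasure P.T) :=
  memLp_top_comp (g := fun z => fderiv ℝ P.F z ∘L
    ContinuousLinearMap.inr ℝ (Vec n) (Vec l × Vec m))
    ((hF.continuous_fderiv (by simp)).clm_comp continuous_const) h.memLp_at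

lemma memLp_hessF (hF : ContDiff ℝ 2 P.F) (h : P.IsTrajectory ŵ) :
    MemLp (P.hessF ŵ) ∞ (timeMeasure P.T) :=
  memLp_top_comp ((hF.fderiv_right (m := 1) (by norm_num)).continuous_fderiv (by simp)) h.memLp_at

lemma exists_isReference (hT : 0 < P.T) (hreg : P.Regular) (h : P.IsTrajectory ŵ) :
    ∃ X Y, P.IsReference ŵ X Y := by
  obtain ⟨X, Y, hXY⟩ := exists_resolvent (memLp_stateMatrix hreg.contDiff_F h)
  exact ⟨X, Y, hT, hreg.contDiff_F, fun i => (hreg.2.1 i).1, fun j => (hreg.2.2 j).1, h, hXY⟩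

variable (P ŵ) in
/-- The solution of the linearized state equation with initial value `x₀` and control `w`. -/
def linState (X Y : ℝ → Vec n →L[ℝ] Vec n) (x₀ : Vec n) (w : ℝ → Vec l × Vec m) (t : ℝ) : Vec n :=
  X t (x₀ + ∫ s in (0 : ℝ)..t, Y s (P.controlMatrix ŵ s (w s)))

namespace IsReference

variable {X Y : ℝ → Vec n →L[ℝ] Vec n} (h : P.IsReference ŵ X Y)
include h

lemma integrable_controlMatrix {w : ℝ → Vec l × Vec m} (hw : Integrable w (timeMeasure P.T)) :
    Integrable (fun t => P.controlMatrix ŵ t (w t)) (timeMeasure P.T) := by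
  have hB := memLp_controlMatrix h.contDiff_F h.traj
  obtain ⟨C, -, hC⟩ := exists_ae_bound hB
  exact (ContinuousLinearMap.id ℝ (Vec l × Vec m →L[ℝ] Vec n)).integrable_of_bilin_of_bdd_left C
    hB.1 hC hw

lemma integrable_Y_controlMatrix {w : ℝ → Vec l × Vec m} (hw : Integrable w (timeMeasure P.T)) :
    Integrable (fun t => Y t (P.controlMatrix ŵ t (w t))) (timeMeasure P.T) := by
  obtain ⟨C, -, hC⟩ := h.res.primY.exists_bound
  exact (ContinuousLinearMap.id ℝ (Vec n →L[ℝ] Vec n)).integrable_of_bilin_of_bdd_left C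
    h.res.primY.aestronglyMeasurable (ae_mem_Icc.mono hC) (h.integrable_controlMatrix hw)

lemma linState_zero (x₀ : Vec n) (w : ℝ → Vec l × Vec m) : P.linState ŵ X Y x₀ w 0 = x₀ := by
  simp [linState, h.res.X_zero]

lemma isPrim_linState {w : ℝ → Vec l × Vec m} (hw : Integrable w (timeMeasure P.T)) (x₀ : Vec n) :
    IsPrim P.T (P.linState ŵ X Y x₀ w)
      (fun t => fderiv ℝ P.F (ŵ.at t) (P.linState ŵ X Y x₀ w t, w t)) :=
  (h.res.isPrim_solution (h.integrable_controlMatrix hw) x₀).congr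
    (Eventually.of_forall fun t => (P.fderiv_F_apply ŵ t _ _).symm)

lemma eq_linState {x : ℝ → Vec n} {w : ℝ → Vec l × Vec m}
    (hx : IsPrim P.T x (fun t => fderiv ℝ P.F (ŵ.at t) (x t, w t))) {t : ℝ}
    (ht : t ∈ Set.Icc 0 P.T) : x t = P.linState ŵ X Y (x 0) w t :=
  h.res.eq_of_isPrim (hx.congr (Eventually.of_forall fun t => P.fderiv_F_apply ŵ t _ _)) ht

lemma linState_congr {w w' : ℝ → Vec l × Vec m} (hw : w =ᵐ[timeMeasure P.T] w') (x₀ : Vec n)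
    {t : ℝ} (ht : t ∈ Set.Icc 0 P.T) :
    P.linState ŵ X Y x₀ w t = P.linState ŵ X Y x₀ w' t := by
  simp only [linState]
  rw [intervalIntegral_congr_timeMeasure _ (zero_mem_Icc h.pos.le) ht]
  filter_upwards [hw] with s hs
  rw [hs]

lemma linState_add {w w' : ℝ → Vec l × Vec m} (hw : Integrable w (timeMeasure P.T))
    (hw' : Integrable w' (timeMeasure P.T)) (x₀ x₀' : Vec n) {t : ℝ} (ht : t ∈ Set.Icc 0 P.T) :
    P.linState ŵ X Y (x₀ + x₀') (fun s => w s + w' s) t =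
      P.linState ŵ X Y x₀ w t + P.linState ŵ X Y x₀' w' t := by
  have h0 := zero_mem_Icc h.pos.le
  simp only [linState, map_add]
  rw [intervalIntegral.integral_add
    (intervalIntegrable_of_integrable (h.integrable_Y_controlMatrix hw) h0 ht)
    (intervalIntegrable_of_integrable (h.integrable_Y_controlMatrix hw') h0 ht), map_add]
  abel

/-- Only the L¹ norm of the control enters, so controls bounded in L² produce uniformly bounded
states. -/
lemma exists_linState_bound : ∃ C, 0 ≤ C ∧ ∀ (x₀ : Vec n) (w : ℝ → Vec l × Vec m),
    Integrable w (timeMeasure P.T) → ∀ t ∈ Set.Icc 0 P.T,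
      ‖P.linState ŵ X Y x₀ w t‖ ≤ C * (‖x₀‖ + ∫ s, ‖w s‖ ∂(timeMeasure P.T)) := by
  obtain ⟨CX, hCX0, hCX⟩ := h.res.primX.exists_bound
  obtain ⟨CY, hCY0, hCY⟩ := h.res.primY.exists_bound
  obtain ⟨CB, hCB0, hCB⟩ := exists_ae_bound (memLp_controlMatrix h.contDiff_F h.traj)
  refine ⟨CX * (1 + CY * CB), by positivity, fun x₀ w hw t ht => ?_⟩
  have h1 : ‖∫ s in (0 : ℝ)..t, Y s (P.controlMatrix ŵ s (w s))‖ ≤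
      CY * CB * ∫ s, ‖w s‖ ∂(timeMeasure P.T) := by
    rw [intervalIntegral.integral_of_le ht.1]
    have hres : volume.restrict (Set.Ioc 0 t) ≤ timeMeasure P.T :=
      Measure.restrict_mono (Set.Ioc_subset_Icc_self.trans (Set.Icc_subset_Icc_right ht.2)) le_rfl
    refine (norm_integral_le_integral_norm _).trans ?_
    refine (integral_mono_measure hres (Eventually.of_forall fun _ => norm_nonneg _)
      (h.integrable_Y_controlMatrix hw).norm).trans ?_
    rw [← integral_const_mul]
    refine integral_mono_ae (h.integrable_Y_controlMatrix hw).norm (hw.norm.const_mul _) ?_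
    filter_upwards [ae_mem_Icc (T := P.T), hCB] with s hs hsB
    refine (ContinuousLinearMap.le_opNorm _ _).trans ?_
    rw [mul_assoc]
    exact mul_le_mul (hCY s hs) ((ContinuousLinearMap.le_opNorm _ _).trans (by gcongr))
      (norm_nonneg _) hCY0
  have hI : 0 ≤ ∫ s, ‖w s‖ ∂(timeMeasure P.T) := integral_nonneg fun _ => norm_nonneg _
  calc ‖P.linState ŵ X Y x₀ w t‖ ≤ CX * (‖x₀‖ + CY * CB * ∫ s, ‖w s‖ ∂(timeMeasure P.T)) := by
        refine (ContinuousLinearMap.le_opNorm _ _).trans ?_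
        exact mul_le_mul (hCX t ht) ((norm_add_le _ _).trans (by gcongr)) (norm_nonneg _) hCX0
    _ ≤ CX * (1 + CY * CB) * (‖x₀‖ + ∫ s, ‖w s‖ ∂(timeMeasure P.T)) := by
        rw [mul_assoc CX]
        refine mul_le_mul_of_nonneg_left ?_ hCX0
        have := mul_nonneg (mul_nonneg hCY0 hCB0) (norm_nonneg x₀)
        rw [add_mul, one_mul, mul_add]
        linarith

end IsReference

/-- The triple formed by the solution of the linearized equation and its controls. -/
def linTriple (P : MayerProblem n l m dφ dη) (ŵ : Triple n l m) (X Y : ℝ → Vec n →L[ℝ] Vec n)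
    (x₀ : Vec n) (w : ℝ → Vec l × Vec m) : Triple n l m :=
  ⟨P.linState ŵ X Y x₀ w, fun t => (w t).1, fun t => (w t).2⟩

/-- Both controls of a triple. -/
def _root_.PartiallyAffine.Triple.controls (w : Triple n l m) (t : ℝ) : Vec l × Vec m :=
  (w.u t, w.v t)

namespace IsReference

variable {X Y : ℝ → Vec n →L[ℝ] Vec n} (h : P.IsReference ŵ X Y)
include h

omit h in
lemma memLp_controls_of_mem_linearized {w : Triple n l m} (hw : w ∈ P.linearized ŵ) :
    MemLp w.controls 2 (timeMeasure P.T) := memLp_prod_iff.2 ⟨hw.1.2.1, hw.1.2.2⟩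

omit h in
lemma isPrim_of_mem_linearized {w : Triple n l m} (hw : w ∈ P.linearized ŵ) :
    IsPrim P.T w.x (fun t => fderiv ℝ P.F (ŵ.at t) (w.x t, w.controls t)) :=
  hw.1.1.isPrim_of_hasDerivAt (by norm_num) hw.2

lemma eq_linState_of_mem_linearized {w : Triple n l m} (hw : w ∈ P.linearized ŵ) {t : ℝ}
    (ht : t ∈ Set.Icc 0 P.T) : w.x t = P.linState ŵ X Y (w.x 0) w.controls t :=
  h.eq_linState (isPrim_of_mem_linearized hw) ht

omit h in
lemma memLp_at_of_mem_linearized {w : Triple n l m} (hw : w ∈ P.linearized ŵ) :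
    MemLp w.at 2 (timeMeasure P.T) :=
  memLp_prod_iff.2 ⟨(isPrim_of_mem_linearized hw).memLp_top.mono_exponent le_top,
    memLp_controls_of_mem_linearized hw⟩

lemma linTriple_mem_linearized {w : ℝ → Vec l × Vec m} (hw : MemLp w 2 (timeMeasure P.T))
    (x₀ : Vec n) : P.linTriple ŵ X Y x₀ w ∈ P.linearized ŵ := by
  have hp := h.isPrim_linState (hw.integrable (by norm_num)) x₀
  have hz : MemLp (fun t => (P.linState ŵ X Y x₀ w t, w t)) 2 (timeMeasure P.T) :=
    memLp_prod_iff.2 ⟨hp.memLp_top.mono_exponent le_top, hw⟩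
  have hder : MemLp (fun t => fderiv ℝ P.F (ŵ.at t) (P.linState ŵ X Y x₀ w t, w t)) 2
      (timeMeasure P.T) :=
    (ContinuousLinearMap.id ℝ (Vec n × Vec l × Vec m →L[ℝ] Vec n)).memLp_of_bilin 2
      (memLp_fderiv_F h.contDiff_F h.traj) hz
  exact ⟨⟨hp.memW1 hder, hw.fst, hw.snd⟩, hp.ae_hasDerivAt⟩

end IsReference

end MayerProblem

set_option maxSynthPendingDepth 3

/-! ### Derivatives of linear images and pairing with coefficients -/

section SecondDerivatives

variable {V W G : Type*} [NormedAddCommGroup V] [NormedSpace ℝ V] [NormedAddCommGroup W]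
  [NormedSpace ℝ W] [NormedAddCommGroup G] [NormedSpace ℝ G]

lemma fderiv_clm_comp_apply (L : W →L[ℝ] G) {f : V → W} (hf : ContDiff ℝ 2 f) (z : V) :
    fderiv ℝ (fun z => L (f z)) z = L ∘L fderiv ℝ f z :=
  (L.hasFDerivAt.comp z (hf.differentiable (by simp) z).hasFDerivAt).fderiv

lemma fderiv_fderiv_clm_comp_apply (L : W →L[ℝ] G) {f : V → W} (hf : ContDiff ℝ 2 f) (z a b : V) :
    fderiv ℝ (fderiv ℝ fun z => L (f z)) z a b = L (fderiv ℝ (fderiv ℝ f) z a b) := by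
  have h1 : (fderiv ℝ fun z => L (f z)) = fun z => L ∘L fderiv ℝ f z :=
    funext fun z => fderiv_clm_comp_apply L hf z
  have h2 := (((hf.fderiv_right (m := 1) (by norm_num)).differentiable (by simp)) z).hasFDerivAt
  have h3 := (ContinuousLinearMap.compL ℝ V W G L).hasFDerivAt.comp z h2
  have h4 : HasFDerivAt (fun z => L ∘L fderiv ℝ f z)
    (ContinuousLinearMap.compL ℝ V W G L ∘L fderiv ℝ (fderiv ℝ f) z) z := h3
  rw [h1, h4.fderiv]
  rfl

lemma fderiv_fderiv_symm {f : V → W} (hf : ContDiff ℝ 2 f) (z a b : V) :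
    fderiv ℝ (fderiv ℝ f) z a b = fderiv ℝ (fderiv ℝ f) z b a :=
  (hf.contDiffAt.isSymmSndFDerivAt (by simp)) a b

/-- The pairing with a multiplier as a continuous linear form. -/
def pairingL {I K : Type*} [Fintype I] [Fintype K] (α : I → ℝ) (β : K → ℝ) :
    (I → ℝ) × (K → ℝ) →L[ℝ] ℝ :=
  ∑ i, α i • (ContinuousLinearMap.proj i ∘L ContinuousLinearMap.fst ℝ (I → ℝ) (K → ℝ)) +
    ∑ j, β j • (ContinuousLinearMap.proj j ∘L ContinuousLinearMap.snd ℝ (I → ℝ) (K → ℝ))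

lemma pairingL_apply {I K : Type*} [Fintype I] [Fintype K] (α : I → ℝ) (β : K → ℝ)
    (s : (I → ℝ) × (K → ℝ)) : pairingL α β s = pairing α β s := by
  simp [pairingL, pairing]

lemma memLp_compL_comp {T : ℝ} {q : ℝ → W →L[ℝ] G} {k : ℝ → V →L[ℝ] V →L[ℝ] W}
    (hq : MemLp q ∞ (timeMeasure T)) (hk : MemLp k ∞ (timeMeasure T)) :
    MemLp (fun t => ContinuousLinearMap.compL ℝ V W G (q t) ∘L k t) ∞ (timeMeasure T) := by
  have h1 : MemLp (fun t => ContinuousLinearMap.compL ℝ V W G (q t)) ∞ (timeMeasure T) :=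
    hq.continuousLinearMap_comp (ContinuousLinearMap.compL ℝ V W G)
  exact (ContinuousLinearMap.compL ℝ V (V →L[ℝ] W) (V →L[ℝ] G)).memLp_of_bilin ∞ h1 hk

lemma memLp_bilin_two {T : ℝ} {k : ℝ → V →L[ℝ] W} (hk : MemLp k ∞ (timeMeasure T)) {z : ℝ → V}
    (hz : MemLp z 2 (timeMeasure T)) : MemLp (fun t => k t (z t)) 2 (timeMeasure T) :=
  (ContinuousLinearMap.id ℝ (V →L[ℝ] W)).memLp_of_bilin 2 hk hz

lemma integrable_bilin {T : ℝ} {k : ℝ → V →L[ℝ] W} (hk : MemLp k 2 (timeMeasure T)) {z : ℝ → V}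
    (hz : MemLp z 2 (timeMeasure T)) : Integrable (fun t => k t (z t)) (timeMeasure T) :=
  memLp_one_iff_integrable.1 ((ContinuousLinearMap.id ℝ (V →L[ℝ] W)).memLp_of_bilin 1 hk hz)

end SecondDerivatives

/-! ### Vector-valued costates and second variations; multipliers as coefficients -/

/-- The space of values of all endpoint functions. -/
abbrev CVal (dφ dη : ℕ) : Type := (Fin (dφ + 1) → ℝ) × (Fin dη → ℝ)

namespace MayerProblem

variable (P : MayerProblem n l m dφ dη) (ŵ : Triple n l m) (X Y : ℝ → Vec n →L[ℝ] Vec n)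

/-- All endpoint functions. -/
def constraints (q : Vec n × Vec n) : CVal dφ dη := (fun i => P.φ i q, fun j => P.η j q)

/-- The derivative of the endpoint functions at the reference trajectory. -/
def dConstraints : Vec n × Vec n →L[ℝ] CVal dφ dη := fderiv ℝ P.constraints (P.endpoints ŵ)

/-- The second derivative of the endpoint functions at the reference trajectory. -/
def ddConstraints : Vec n × Vec n →L[ℝ] Vec n × Vec n →L[ℝ] CVal dφ dη :=
  fderiv ℝ (fderiv ℝ P.constraints) (P.endpoints ŵ)

/-- The costates of all endpoint functions. -/
def costate (t : ℝ) : Vec n →L[ℝ] CVal dφ dη :=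
  (P.dConstraints ŵ ∘L ContinuousLinearMap.inr ℝ (Vec n) (Vec n)) ∘L X P.T ∘L Y t

/-- The second derivatives of the pre-Hamiltonians of all endpoint functions. -/
def hess (t : ℝ) : Vec n × Vec l × Vec m →L[ℝ] Vec n × Vec l × Vec m →L[ℝ] CVal dφ dη :=
  (ContinuousLinearMap.compL ℝ (Vec n × Vec l × Vec m) (Vec n) (CVal dφ dη)
    (P.costate ŵ X Y t)) ∘L P.hessF ŵ t

/-- The symmetric bilinear form of twice the second variation. -/
def secondVarBilin (w z : Triple n l m) : CVal dφ dη :=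
  P.ddConstraints ŵ (P.endpoints w) (P.endpoints z) +
    ∫ t, P.hess ŵ X Y t (w.at t) (z.at t) ∂(timeMeasure P.T)

/-- The multiplier with given coefficients and the corresponding costate. -/
def canon (α : Fin (dφ + 1) → ℝ) (β : Fin dη → ℝ) : Multiplier n dφ dη :=
  ⟨α, β, fun t => pairingL α β ∘L P.costate ŵ X Y t⟩

variable {P ŵ X Y}

lemma hess_apply (t : ℝ) (a b : Vec n × Vec l × Vec m) :
    P.hess ŵ X Y t a b = P.costate ŵ X Y t (P.hessF ŵ t a b) := rfl

lemma ell_eq (lam : Multiplier n dφ dη) :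
    P.ell lam = fun q => pairingL lam.α lam.β (P.constraints q) := by
  funext q
  rw [pairingL_apply]; rfl

/-- F is affine in v, so its second derivative vanishes along lines in the v direction; polarization
gives the whole vv block. -/
lemma hessF_snd_snd (hF : ContDiff ℝ 2 P.F) (t : ℝ) (a b : Vec m) :
    P.hessF ŵ t (0, 0, a) (0, 0, b) = 0 := by
  have hdiag : ∀ a : Vec m, P.hessF ŵ t (0, 0, a) (0, 0, a) = 0 := fun a => by
    have h1 := HasJet.comp_line (a := ŵ.at t) hF.contDiffAt (0, 0, a)
    have h2 : HasJet (fun s : ℝ => P.F (ŵ.at t + s • (0, 0, a)))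
        (∑ i : Fin m, a i • P.f i.succ (ŵ.x t, ŵ.u t)) 0 := by
      refine (HasJet.line (P.F (ŵ.at t)) _).congr (Eventually.of_forall fun s => ?_)
      simp [F, Triple.at, add_smul, Finset.sum_add_distrib, Finset.smul_sum, smul_smul, add_assoc]
    exact (h1.unique h2).2
  have h1 := hdiag (a + b)
  have h2 : ((0, 0, a + b) : Vec n × Vec l × Vec m) = (0, 0, a) + (0, 0, b) := by simp
  have h3 : P.hessF ŵ t (0, 0, b) (0, 0, a) = P.hessF ŵ t (0, 0, a) (0, 0, b) :=
    fderiv_fderiv_symm hF _ _ _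
  simp only [h2, map_add, add_apply, hdiag, h3, zero_add, add_zero] at h1
  rw [← two_smul ℝ] at h1
  exact (smul_eq_zero.1 h1).resolve_left (by norm_num)

lemma D2H_eq (hF : ContDiff ℝ 2 P.F) (lam : Multiplier n dφ dη) (t : ℝ)
    (a b : Vec n × Vec l × Vec m) : P.D2H ŵ lam t a b = lam.p t (P.hessF ŵ t a b) :=
  fderiv_fderiv_clm_comp_apply _ hF _ _ _

lemma DH_eq (hF : ContDiff ℝ 2 P.F) (lam : Multiplier n dφ dη) (t : ℝ) :
    P.DH ŵ lam t = lam.p t ∘L fderiv ℝ P.F (ŵ.at t) :=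
  fderiv_clm_comp_apply _ hF _

/-- The integrand of the second variation. -/
lemma integrand_eq (hF : ContDiff ℝ 2 P.F) (lam : Multiplier n dφ dη) (t : ℝ) (x : Vec n)
    (u : Vec l) (v : Vec m) :
    1 / 2 * P.Hxx ŵ lam t x x + P.Hux ŵ lam t u x + P.Hvx ŵ lam t v x +
      1 / 2 * P.Huu ŵ lam t u u + P.Hvu ŵ lam t v u =
    1 / 2 * lam.p t (P.hessF ŵ t (x, u, v) (x, u, v)) := by
  have h0 : ((x, u, v) : Vec n × Vec l × Vec m) = (x, 0, 0) + (0, u, 0) + (0, 0, v) := by simp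
  have hs : ∀ a b, P.hessF ŵ t a b = P.hessF ŵ t b a := fderiv_fderiv_symm hF _
  simp only [Hxx, Hux, Hvx, Huu, Hvu, D2H_eq hF, h0, map_add, add_apply, hessF_snd_snd hF]
  rw [hs (x, 0, 0) (0, u, 0), hs (x, 0, 0) (0, 0, v), hs (0, u, 0) (0, 0, v), map_zero]
  ring

/-- The pointwise conditions on the second derivatives with respect to the controls. -/
lemma huu_hvu_iff (hF : ContDiff ℝ 2 P.F) (lam : Multiplier n dφ dη) (t : ℝ) :
    ((∀ a, 0 ≤ P.Huu ŵ lam t a a) ∧ ∀ b a, P.Hvu ŵ lam t b a = 0) ↔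
      ∀ w : Vec l × Vec m, 0 ≤ lam.p t (P.hessF ŵ t (0, w) (0, w)) := by
  have key : ∀ (u : Vec l) (v : Vec m), lam.p t (P.hessF ŵ t (0, u, v) (0, u, v)) =
      P.Huu ŵ lam t u u + 2 * P.Hvu ŵ lam t v u := fun u v => by
    have := integrand_eq (ŵ := ŵ) hF lam t 0 u v
    have h0 : ((0, 0, 0) : Vec n × Vec l × Vec m) = 0 := rfl
    simp only [Hxx, Hux, Hvx, D2H_eq hF, h0, map_zero, mul_zero, zero_add] at this
    linarith
  constructor
  · rintro ⟨h1, h2⟩ ⟨u, v⟩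
    rw [key, h2, mul_zero, add_zero]
    exact h1 u
  · intro h
    have h1 : ∀ a, 0 ≤ P.Huu ŵ lam t a a := fun a => by
      have h2 := h (a, 0)
      rw [key] at h2
      have h0 : ((0, 0, 0) : Vec n × Vec l × Vec m) = 0 := rfl
      simpa [Hvu, D2H_eq hF, h0] using h2
    refine ⟨h1, fun b a => ?_⟩
    have h2 : ∀ c : ℝ, 0 ≤ P.Huu ŵ lam t a a + 2 * (c * P.Hvu ŵ lam t b a) := fun c => by
      have h3 := h (a, c • b)
      have h4 : ((0, 0, c • b) : Vec n × Vec l × Vec m) = c • (0, 0, b) := by simp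
      have h5 : P.Hvu ŵ lam t (c • b) a = c * P.Hvu ŵ lam t b a := by
        simp only [Hvu, D2H_eq hF]
        rw [h4, map_smul, smul_apply, map_smul, smul_eq_mul]
      rwa [key, h5] at h3
    by_contra hne
    -- A mixed term that is linear in b cannot be dominated by a term independent of b: this
    -- multiple of b gives the value −1.
    have h5 := h2 (-(P.Huu ŵ lam t a a + 1) / (2 * P.Hvu ŵ lam t b a))
    have h6 : -(P.Huu ŵ lam t a a + 1) / (2 * P.Hvu ŵ lam t b a) * P.Hvu ŵ lam t b a =
      -(P.Huu ŵ lam t a a + 1) / 2 := by field_simp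
    rw [h6] at h5
    linarith

namespace IsReference

variable (h : P.IsReference ŵ X Y)
include h

lemma contDiff_constraints : ContDiff ℝ 2 P.constraints :=
  (contDiff_pi.2 h.contDiff_φ).prodMk (contDiff_pi.2 h.contDiff_η)

lemma fderiv_ell (lam : Multiplier n dφ dη) :
    fderiv ℝ (P.ell lam) (P.endpoints ŵ) = pairingL lam.α lam.β ∘L P.dConstraints ŵ := by
  rw [ell_eq]
  exact fderiv_clm_comp_apply _ h.contDiff_constraints _

lemma fderiv_fderiv_ell (lam : Multiplier n dφ dη) (a b : Vec n × Vec n) :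
    fderiv ℝ (fderiv ℝ (P.ell lam)) (P.endpoints ŵ) a b =
      pairingL lam.α lam.β (P.ddConstraints ŵ a b) := by
  rw [ell_eq]
  exact fderiv_fderiv_clm_comp_apply _ h.contDiff_constraints _ _ _

lemma dConstraints_fst (q : Vec n × Vec n) (i : Fin (dφ + 1)) :
    (P.dConstraints ŵ q).1 i = fderiv ℝ (P.φ i) (P.endpoints ŵ) q := by
  have := fderiv_clm_comp_apply (ContinuousLinearMap.proj i ∘L
    ContinuousLinearMap.fst ℝ (Fin (dφ + 1) → ℝ) (Fin dη → ℝ)) h.contDiff_constraints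
    (P.endpoints ŵ)
  exact (DFunLike.congr_fun this q).symm

lemma dConstraints_snd (q : Vec n × Vec n) (j : Fin dη) :
    (P.dConstraints ŵ q).2 j = fderiv ℝ (P.η j) (P.endpoints ŵ) q := by
  have := fderiv_clm_comp_apply (ContinuousLinearMap.proj j ∘L
    ContinuousLinearMap.snd ℝ (Fin (dφ + 1) → ℝ) (Fin dη → ℝ)) h.contDiff_constraints
    (P.endpoints ŵ)
  exact (DFunLike.congr_fun this q).symm

lemma isPrim_costate : IsPrim P.T (P.costate ŵ X Y)
    (fun t => -(P.costate ŵ X Y t ∘L P.stateMatrix ŵ t)) :=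
  h.res.isPrim_adjoint (P.dConstraints ŵ ∘L ContinuousLinearMap.inr ℝ (Vec n) (Vec n))

lemma costate_final :
    P.costate ŵ X Y P.T = P.dConstraints ŵ ∘L ContinuousLinearMap.inr ℝ (Vec n) (Vec n) :=
  h.res.adjoint_final h.pos.le _

lemma memLp_hess : MemLp (P.hess ŵ X Y) ∞ (timeMeasure P.T) :=
  memLp_compL_comp h.isPrim_costate.memLp_top (memLp_hessF h.contDiff_F h.traj)

lemma hess_symm (t : ℝ) (a b : Vec n × Vec l × Vec m) :
    P.hess ŵ X Y t a b = P.hess ŵ X Y t b a := by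
  rw [hess_apply, hess_apply]
  congr 1
  exact fderiv_fderiv_symm h.contDiff_F _ _ _

lemma integrable_hess {z z' : ℝ → Vec n × Vec l × Vec m} (hz : MemLp z 2 (timeMeasure P.T))
    (hz' : MemLp z' 2 (timeMeasure P.T)) :
    Integrable (fun t => P.hess ŵ X Y t (z t) (z' t)) (timeMeasure P.T) :=
  integrable_bilin (memLp_bilin_two h.memLp_hess hz) hz'

/-- The adjoint equation is linear and its final value is fixed by the coefficients, so (α, β)
determines p on [0,T]. This reduces Λ to a finite-dimensional set. -/
lemma p_eq_costate {lam : Multiplier n dφ dη} (hlam : lam ∈ P.multipliers ŵ) {t : ℝ}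
    (ht : t ∈ Set.Icc 0 P.T) : lam.p t = pairingL lam.α lam.β ∘L P.costate ŵ X Y t := by
  have h1 : IsPrim P.T lam.p (fun t => -(lam.p t ∘L P.stateMatrix ŵ t)) := by
    refine (hlam.memW1.isPrim_of_hasDerivAt (by simp) hlam.costate).congr
      (Eventually.of_forall fun t => ?_)
    simp only [DH_eq h.contDiff_F]
    rfl
  rw [h.res.adjoint_unique h1 ht, hlam.transversality_T, h.fderiv_ell]
  rfl

/-- The second variation is the pairing of the multiplier with the vector of second variations. -/
lemma Omega_eq {lam : Multiplier n dφ dη} (hlam : lam ∈ P.multipliers ŵ) {w : Triple n l m}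
    (hw : w ∈ P.linearized ŵ) :
    P.Omega ŵ lam w = 1 / 2 * pairingL lam.α lam.β (P.secondVarBilin ŵ X Y w w) := by
  have hint := h.integrable_hess (memLp_at_of_mem_linearized hw) (memLp_at_of_mem_linearized hw)
  rw [Omega, secondVarBilin, map_add, mul_add, h.fderiv_fderiv_ell,
    ← ContinuousLinearMap.integral_comp_comm _ hint, ← integral_const_mul]
  congr 1
  refine integral_congr_ae ?_
  filter_upwards [ae_mem_Icc (T := P.T)] with t ht
  rw [integrand_eq h.contDiff_F, h.p_eq_costate hlam ht]
  rfl

lemma huu_hvu_ae_iff {lam : Multiplier n dφ dη} (hlam : lam ∈ P.multipliers ŵ) :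
    (∀ᵐ t ∂(timeMeasure P.T), (∀ a, 0 ≤ P.Huu ŵ lam t a a) ∧ ∀ b a, P.Hvu ŵ lam t b a = 0) ↔
      ∀ᵐ t ∂(timeMeasure P.T), ∀ a : Vec l × Vec m,
        0 ≤ pairingL lam.α lam.β (P.hess ŵ X Y t (0, a) (0, a)) := by
  refine eventually_congr ?_
  filter_upwards [ae_mem_Icc (T := P.T)] with t ht
  rw [huu_hvu_iff h.contDiff_F, h.p_eq_costate hlam ht]
  rfl

/-- The first variation of the endpoint functions is annihilated by Lagrange multipliers. -/
lemma pairingL_dConstraints_eq_zero {lam : Multiplier n dφ dη} (hlam : lam ∈ P.multipliers ŵ)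
    (x₀ : Vec n) {w : ℝ → Vec l × Vec m} (hw : Integrable w (timeMeasure P.T)) :
    pairingL lam.α lam.β (P.dConstraints ŵ (x₀, P.linState ŵ X Y x₀ w P.T)) = 0 := by
  have hp : IsPrim P.T lam.p (fun t => -(lam.p t ∘L P.stateMatrix ŵ t)) := by
    refine (hlam.memW1.isPrim_of_hasDerivAt (by simp) hlam.costate).congr
      (Eventually.of_forall fun t => ?_)
    simp only [DH_eq h.contDiff_F]
    rfl
  have hx := (h.isPrim_linState hw x₀).congr
    (Eventually.of_forall fun t => P.fderiv_F_apply ŵ t _ _)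
  have h1 := (hp.duality hx).eq_zero_deriv (by
    filter_upwards [hlam.stationarity_u, hlam.stationarity_v] with t hu hv
    have h2 : ((0, w t) : Vec n × Vec l × Vec m) = (0, (w t).1, 0) + (0, 0, (w t).2) := by simp
    have h3 : lam.p t (P.controlMatrix ŵ t (w t)) = P.DH ŵ lam t (0, w t) := by
      rw [DH_eq h.contDiff_F]; rfl
    rw [h3, h2, map_add, hu, hv]; simp) (T_mem_Icc h.pos.le)
  rw [hlam.transversality_T, hlam.transversality_zero, h.linState_zero, h.fderiv_ell] at h1
  have h4 : ((x₀, P.linState ŵ X Y x₀ w P.T) : Vec n × Vec n) =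
    (x₀, 0) + (0, P.linState ŵ X Y x₀ w P.T) := by simp
  rw [h4, map_add, map_add]
  simp only [ContinuousLinearMap.comp_apply, ContinuousLinearMap.inr_apply,
    ContinuousLinearMap.inl_apply, neg_apply] at h1
  rw [h1]; ring

/-- Coefficients that annihilate the first variation yield a Lagrange multiplier. -/
lemma canon_mem_multipliers {α : Fin (dφ + 1) → ℝ} {β : Fin dη → ℝ}
    (h1 : ∑ i, |α i| + ∑ j, |β j| = 1) (h2 : ∀ i, 0 ≤ α i)
    (h3 : ∀ (x₀ : Vec n) (w : ℝ → Vec l × Vec m), MemLp w ∞ (timeMeasure P.T) →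
      pairingL α β (P.dConstraints ŵ (x₀, P.linState ŵ X Y x₀ w P.T)) = 0) :
    P.canon ŵ X Y α β ∈ P.multipliers ŵ := by
  have hp : IsPrim P.T (P.canon ŵ X Y α β).p
      (fun t => -((P.canon ŵ X Y α β).p t ∘L P.stateMatrix ŵ t)) :=
    (h.isPrim_costate.clm (ContinuousLinearMap.compL ℝ (Vec n) (CVal dφ dη) ℝ
      (pairingL α β))).congr (Eventually.of_forall fun t => by
        ext v; simp [canon])
  have hstat : ∀ᵐ t ∂(timeMeasure P.T), (P.canon ŵ X Y α β).p t ∘L P.controlMatrix ŵ t = 0 := by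
    have hmem : MemLp (fun t => (P.canon ŵ X Y α β).p t ∘L P.controlMatrix ŵ t) ∞
        (timeMeasure P.T) :=
      (ContinuousLinearMap.compL ℝ (Vec l × Vec m) (Vec n) ℝ).memLp_of_bilin ∞ hp.memLp_top
        (memLp_controlMatrix h.contDiff_F h.traj)
    have hint := hmem.integrable (q := ∞) (by simp)
    -- Test with the control equal to a on S and 0 elsewhere, from initial state 0: duality
    -- identifies the integral over S of the stationarity expression with the first variation, which
    -- vanishes.
    refine hint.ae_eq_zero_of_forall_setIntegral_eq_zero fun S hS _ => ?_
    refine ContinuousLinearMap.ext fun a => ?_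
    rw [ContinuousLinearMap.integral_apply hint.integrableOn, ← integral_indicator hS]
    have hwS : MemLp (S.indicator fun _ => a) ∞ (timeMeasure P.T) :=
      (memLp_const a).indicator hS
    have h4 := h3 0 (S.indicator fun _ => a) hwS
    have hwi := hwS.integrable (q := ∞) (by simp)
    have hx := (h.isPrim_linState hwi 0).congr
      (Eventually.of_forall fun t => P.fderiv_F_apply ŵ t _ _)
    have h5 := (hp.duality hx).eq P.T (T_mem_Icc h.pos.le)
    rw [h.linState_zero, map_zero, zero_add, ← integral_timeMeasure h.pos.le] at h5
    have h6 : (P.canon ŵ X Y α β).p P.T (P.linState ŵ X Y 0 (S.indicator fun _ => a) P.T) = 0 := by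
      rw [← h4]
      simp only [canon, h.costate_final]
      rfl
    rw [h6] at h5
    rw [zero_apply, h5]
    refine integral_congr_ae (Eventually.of_forall fun t => ?_)
    by_cases ht : t ∈ S <;> simp [ht]
  have hDH : ∀ t (a : Vec l × Vec m), P.DH ŵ (P.canon ŵ X Y α β) t (0, a) =
      ((P.canon ŵ X Y α β).p t ∘L P.controlMatrix ŵ t) a := fun t a => by
    rw [DH_eq h.contDiff_F]; rfl
  refine ⟨hp.memW1 ?_, h1, h2, ?_, ?_, ?_, ?_, ?_⟩
  · exact ((ContinuousLinearMap.compL ℝ (Vec n) (Vec n) ℝ).memLp_of_bilin ∞ hp.memLp_top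
        (memLp_stateMatrix h.contDiff_F h.traj)).neg
  · filter_upwards [hp.ae_hasDerivAt] with t ht
    have h4 : P.DH ŵ (P.canon ŵ X Y α β) t ∘L ContinuousLinearMap.inl ℝ (Vec n) (Vec l × Vec m) =
        (P.canon ŵ X Y α β).p t ∘L P.stateMatrix ŵ t := by
      rw [DH_eq h.contDiff_F]; rfl
    rw [h4]
    exact ht
  · ext x₀
    -- The zero control isolates the dependence on x₀; the final state is then X_T x₀, and X_T is
    -- the factor appearing in the costate at time 0.
    have h4 := h3 x₀ 0 MemLp.zero
    have h5 : P.linState ŵ X Y x₀ 0 P.T = X P.T x₀ := by simp [linState]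
    have h6 : ((x₀, X P.T x₀) : Vec n × Vec n) = (x₀, 0) + (0, X P.T x₀) := by simp
    rw [h5, h6, map_add, map_add] at h4
    rw [h.fderiv_ell]
    simp only [canon, costate, h.res.Y_zero, ContinuousLinearMap.comp_apply, neg_apply,
      ContinuousLinearMap.inr_apply, ContinuousLinearMap.inl_apply, one_apply_eq_self]
    linarith
  · rw [h.fderiv_ell]
    simp only [canon, h.costate_final]
    rfl
  · filter_upwards [hstat] with t ht a
    rw [hDH, ht]; rfl
  · filter_upwards [hstat] with t ht a
    rw [hDH, ht]; rfl

end IsReference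

end MayerProblem

/-! ### Sequences of controls converging weakly to zero in L² -/

section WeakNullSequences

variable {W : Type} [NormedAddCommGroup W] [NormedSpace ℝ W]
  {G : Type} [NormedAddCommGroup G] [NormedSpace ℝ G] {T : ℝ}

lemma tendsto_of_forall_dual [FiniteDimensional ℝ G] {ι : Type*} {f : Filter ι} {s : ι → G}
    {s₀ : G} (h : ∀ φ : StrongDual ℝ G, Tendsto (fun k => φ (s k)) f (𝓝 (φ s₀))) :
    Tendsto s f (𝓝 s₀) := by
  let e := (Module.finBasis ℝ G).equivFunL
  have h1 : Tendsto (fun k => e (s k)) f (𝓝 (e s₀)) :=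
    tendsto_pi_nhds.2 fun i =>
      h ((ContinuousLinearMap.proj i : (Fin (Module.finrank ℝ G) → ℝ) →L[ℝ] ℝ) ∘L
        e.toContinuousLinearMap)
  have h2 := (e.symm.continuous.tendsto _).comp h1
  simpa [Function.comp_def] using h2

omit [NormedSpace ℝ W] [NormedSpace ℝ G] in
lemma integral_norm_mul_norm_le {f : ℝ → W} {g : ℝ → G} (hf : MemLp f 2 (timeMeasure T))
    (hg : MemLp g 2 (timeMeasure T)) :
    ∫ t, ‖f t‖ * ‖g t‖ ∂(timeMeasure T) ≤
      √(∫ t, ‖f t‖ ^ 2 ∂(timeMeasure T)) * √(∫ t, ‖g t‖ ^ 2 ∂(timeMeasure T)) := by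
  have h := integral_mul_norm_le_Lp_mul_Lq (μ := timeMeasure T) (f := fun t => ‖f t‖)
    (g := fun t => ‖g t‖) Real.HolderConjugate.two_two (by simpa using hf.norm)
    (by simpa using hg.norm)
  simpa [Real.sqrt_eq_rpow] using h

omit [NormedSpace ℝ W] in
lemma integrable_norm_sq {f : ℝ → W} (hf : MemLp f 2 (timeMeasure T)) :
    Integrable (fun t => ‖f t‖ ^ 2) (timeMeasure T) := hf.integrable_norm_pow (by simp)

/-- A bounded sequence in `L²` that converges weakly to zero. -/
structure WeakNull (T : ℝ) (w : ℕ → ℝ → W) : Prop where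
  memLp : ∀ k, MemLp (w k) 2 (timeMeasure T)
  bound : ∃ C, ∀ k, ∫ t, ‖w k t‖ ^ 2 ∂(timeMeasure T) ≤ C
  weak : ∀ g : ℝ → StrongDual ℝ W, MemLp g 2 (timeMeasure T) →
    Tendsto (fun k => ∫ t, g t (w k t) ∂(timeMeasure T)) atTop (𝓝 0)

lemma WeakNull.tendsto_integral [FiniteDimensional ℝ G] {w : ℕ → ℝ → W} (h : WeakNull T w)
    {g : ℝ → W →L[ℝ] G} (hg : MemLp g 2 (timeMeasure T)) :
    Tendsto (fun k => ∫ t, g t (w k t) ∂(timeMeasure T)) atTop (𝓝 0) := by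
  have : CompleteSpace G := FiniteDimensional.complete ℝ G
  refine tendsto_of_forall_dual fun φ => ?_
  rw [map_zero]
  have h1 : MemLp (fun t => φ ∘L g t) 2 (timeMeasure T) :=
    hg.continuousLinearMap_comp (ContinuousLinearMap.compL ℝ W G ℝ φ)
  refine (h.weak _ h1).congr fun k => ?_
  exact φ.integral_comp_comm (integrable_bilin hg (h.memLp k))

lemma WeakNull.exists_integral_norm_le {w : ℕ → ℝ → W} (h : WeakNull T w) :
    ∃ C, ∀ k, ∫ t, ‖w k t‖ ∂(timeMeasure T) ≤ C := by
  obtain ⟨C, hC⟩ := h.bound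
  refine ⟨√C * √(∫ _, ‖(1 : ℝ)‖ ^ 2 ∂(timeMeasure T)), fun k => ?_⟩
  have h1 := integral_norm_mul_norm_le (h.memLp k) (memLp_const (1 : ℝ))
  simp only [norm_one, mul_one] at h1 ⊢
  exact h1.trans (by gcongr; exact hC k)

/-- Strongly convergent sequences converge weakly. -/
lemma WeakNull.of_tendsto {w : ℕ → ℝ → W} (hw : ∀ k, MemLp (w k) 2 (timeMeasure T))
    (h : Tendsto (fun k => ∫ t, ‖w k t‖ ^ 2 ∂(timeMeasure T)) atTop (𝓝 0)) : WeakNull T w := by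
  refine ⟨hw, ?_, fun g hg => ?_⟩
  · obtain ⟨C, hC⟩ := h.bddAbove_range
    exact ⟨C, fun k => hC ⟨k, rfl⟩⟩
  · have h1 : Tendsto (fun k => √(∫ t, ‖g t‖ ^ 2 ∂(timeMeasure T)) *
        √(∫ t, ‖w k t‖ ^ 2 ∂(timeMeasure T))) atTop (𝓝 0) := by
      simpa using (h.sqrt).const_mul (√(∫ t, ‖g t‖ ^ 2 ∂(timeMeasure T)))
    refine squeeze_zero_norm (fun k => ?_) h1
    refine (norm_integral_le_integral_norm _).trans
      ((integral_mono_of_nonneg (Eventually.of_forall fun _ => norm_nonneg _) ?_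
        (Eventually.of_forall fun t => (g t).le_opNorm _)).trans
          (integral_norm_mul_norm_le hg (hw k)))
    exact memLp_one_iff_integrable.1 ((ContinuousLinearMap.mul ℝ ℝ).memLp_of_bilin 1
      hg.norm (hw k).norm)

lemma tendsto_integral_of_bounded {x : ℕ → ℝ → W}
    (hx : ∀ k, AEStronglyMeasurable (x k) (timeMeasure T)) {C : ℝ}
    (hC : ∀ k, ∀ t ∈ Set.Icc 0 T, ‖x k t‖ ≤ C)
    (h0 : ∀ t ∈ Set.Icc 0 T, Tendsto (fun k => x k t) atTop (𝓝 0))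
    {g : ℝ → W →L[ℝ] G} (hg : Integrable g (timeMeasure T)) :
    Tendsto (fun k => ∫ t, g t (x k t) ∂(timeMeasure T)) atTop (𝓝 0) := by
  have h1 := tendsto_integral_of_dominated_convergence (μ := timeMeasure T)
    (F := fun k t => g t (x k t)) (f := fun _ => 0) (fun t => ‖g t‖ * C)
    (fun k => (ContinuousLinearMap.id ℝ (W →L[ℝ] G)).aestronglyMeasurable_comp₂ hg.1 (hx k))
    (hg.norm.mul_const C) (fun k => by
      filter_upwards [ae_mem_Icc (T := T)] with t ht
      exact ((g t).le_opNorm _).trans (by gcongr; exact hC k t ht))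
    (by
      filter_upwards [ae_mem_Icc (T := T)] with t ht
      simpa [Function.comp_def] using ((g t).continuous.tendsto 0).comp (h0 t ht))
  simpa using h1

omit [NormedSpace ℝ W] in
lemma tendsto_integral_norm_sq {x : ℕ → ℝ → W}
    (hx : ∀ k, AEStronglyMeasurable (x k) (timeMeasure T)) {C : ℝ}
    (hC : ∀ k, ∀ t ∈ Set.Icc 0 T, ‖x k t‖ ≤ C)
    (h0 : ∀ t ∈ Set.Icc 0 T, Tendsto (fun k => x k t) atTop (𝓝 0)) :
    Tendsto (fun k => ∫ t, ‖x k t‖ ^ 2 ∂(timeMeasure T)) atTop (𝓝 0) := by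
  have h1 := tendsto_integral_of_dominated_convergence (μ := timeMeasure T)
    (F := fun k t => ‖x k t‖ ^ 2) (f := fun _ => 0) (fun t => C ^ 2)
    (fun k => (hx k).norm.pow 2)
    (integrable_const _) (fun k => by
      filter_upwards [ae_mem_Icc (T := T)] with t ht
      rw [norm_pow, norm_norm]
      have := hC k t ht
      gcongr)
    (by
      filter_upwards [ae_mem_Icc (T := T)] with t ht
      simpa using (h0 t ht).norm.pow 2)
  simpa using h1

end WeakNullSequences

/-! ### Controls concentrating at a point in time -/

section Concentration

variable {W : Type} [NormedAddCommGroup W] [NormedSpace ℝ W]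
  {G : Type} [NormedAddCommGroup G] [NormedSpace ℝ G] {T : ℝ}

/-- A sequence of controls that concentrates at the time `t₀`. -/
def concentration (t₀ : ℝ) (a : W) (k : ℕ) : ℝ → W :=
  (Set.Ioc t₀ (t₀ + ((k : ℝ) + 1)⁻¹)).indicator fun _ => √((k : ℝ) + 1) • a

lemma memLp_concentration (t₀ : ℝ) (a : W) (k : ℕ) (q : ℝ≥0∞) :
    MemLp (concentration t₀ a k) q (timeMeasure T) := (memLp_const _).indicator measurableSet_Ioc

/-- Height √(k+1) on an interval of length 1/(k+1) carries squared mass ‖a‖²; there is only an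
inequality because the interval may leave [0,T]. -/
lemma integral_concentration_le (t₀ : ℝ) (a : W) (k : ℕ) :
    ∫ t, ‖concentration t₀ a k t‖ ^ 2 ∂(timeMeasure T) ≤ ‖a‖ ^ 2 := by
  have hk : (0 : ℝ) < (k : ℝ) + 1 := by positivity
  have h1 : (fun t => ‖concentration t₀ a k t‖ ^ 2) =
      (Set.Ioc t₀ (t₀ + ((k : ℝ) + 1)⁻¹)).indicator fun _ => ((k : ℝ) + 1) * ‖a‖ ^ 2 := by
    funext t
    by_cases ht : t ∈ Set.Ioc t₀ (t₀ + ((k : ℝ) + 1)⁻¹)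
    · simp [concentration, ht, norm_smul, mul_pow, abs_of_nonneg, Real.sq_sqrt hk.le]
    · simp [concentration, ht]
  rw [h1, integral_indicator measurableSet_Ioc, setIntegral_const, smul_eq_mul]
  have h2 : (timeMeasure T).real (Set.Ioc t₀ (t₀ + ((k : ℝ) + 1)⁻¹)) ≤ ((k : ℝ) + 1)⁻¹ := by
    have : (timeMeasure T) (Set.Ioc t₀ (t₀ + ((k : ℝ) + 1)⁻¹)) ≤
        ENNReal.ofReal ((k : ℝ) + 1)⁻¹ := by
      refine (Measure.restrict_apply_le _ _).trans_eq ?_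
      rw [Real.volume_Ioc, add_sub_cancel_left]
    exact ENNReal.toReal_le_of_le_ofReal (by positivity) this
  calc _ ≤ ((k : ℝ) + 1)⁻¹ * (((k : ℝ) + 1) * ‖a‖ ^ 2) := by gcongr
    _ = ‖a‖ ^ 2 := by field_simp

/-- Cauchy–Schwarz against g restricted to the support: the supports decrease to the empty set,
being open on the left, so the mass of ‖g‖² on them tends to zero. -/
lemma weakNull_concentration (t₀ : ℝ) (a : W) : WeakNull T (concentration t₀ a) := by
  refine ⟨fun k => memLp_concentration t₀ a k 2, ⟨_, integral_concentration_le t₀ a⟩,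
    fun g hg => ?_⟩
  let I : ℕ → Set ℝ := fun k => Set.Ioc t₀ (t₀ + ((k : ℝ) + 1)⁻¹)
  have hI : Antitone I := fun i j hij => Set.Ioc_subset_Ioc_right (by gcongr)
  have hI0 : ⋂ k, I k = ∅ := by
    refine Set.eq_empty_of_forall_notMem fun t ht => ?_
    rw [Set.mem_iInter] at ht
    obtain ⟨k, hk⟩ := exists_nat_one_div_lt (sub_pos.2 (ht 0).1)
    have := (ht k).2
    rw [one_div] at hk
    linarith
  have h1 : Tendsto (fun k => ∫ t in I k, ‖g t‖ ^ 2 ∂(timeMeasure T)) atTop (𝓝 0) := by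
    have := tendsto_setIntegral_of_antitone (μ := timeMeasure T) (f := fun t => ‖g t‖ ^ 2)
      (s := I) (fun _ => measurableSet_Ioc) hI ⟨0, (integrable_norm_sq hg).integrableOn⟩
    simpa [hI0] using this
  have h2 : Tendsto (fun k => √(∫ t in I k, ‖g t‖ ^ 2 ∂(timeMeasure T)) * √(‖a‖ ^ 2)) atTop
      (𝓝 0) := by
    have := h1.sqrt.mul_const √(‖a‖ ^ 2)
    rwa [Real.sqrt_zero, zero_mul] at this
  refine squeeze_zero_norm (fun k => ?_) h2
  have hgI : MemLp ((I k).indicator g) 2 (timeMeasure T) := hg.indicator measurableSet_Ioc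
  have h3 := integral_norm_mul_norm_le hgI (memLp_concentration t₀ a k 2)
  have h4 : ∫ t, ‖(I k).indicator g t‖ ^ 2 ∂(timeMeasure T) =
      ∫ t in I k, ‖g t‖ ^ 2 ∂(timeMeasure T) := by
    have hm : MeasurableSet (I k) := measurableSet_Ioc
    rw [← integral_indicator hm]
    refine integral_congr_ae (Eventually.of_forall fun t => ?_)
    by_cases ht : t ∈ I k <;> simp [ht]
  rw [h4] at h3
  refine (norm_integral_le_integral_norm _).trans ((integral_mono_of_nonneg
    (Eventually.of_forall fun _ => norm_nonneg _) ?_ (Eventually.of_forall fun t => ?_)).trans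
      (h3.trans (by gcongr; exact integral_concentration_le t₀ a k)))
  · exact memLp_one_iff_integrable.1 ((ContinuousLinearMap.mul ℝ ℝ).memLp_of_bilin 1
      hgI.norm (memLp_concentration t₀ a k 2).norm)
  · by_cases ht : t ∈ I k
    · simpa [ht] using (g t).le_opNorm _
    · have : concentration t₀ a k t = 0 := Set.indicator_of_notMem ht _
      simp [this]

/-- Quadratic functionals along a concentrating sequence converge to a point evaluation. -/
lemma tendsto_integral_concentration [CompleteSpace G] {K : ℝ → W →L[ℝ] W →L[ℝ] G}
    (hK : MemLp K ∞ (timeMeasure T)) :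
    ∀ᵐ t₀ ∂(timeMeasure T), ∀ a, Tendsto (fun k => ∫ t, K t (concentration t₀ a k t)
      (concentration t₀ a k t) ∂(timeMeasure T)) atTop (𝓝 (K t₀ a a)) := by
  have hp := IsPrim.of_integrable (hK.integrable (by simp)) 0
  filter_upwards [hp.ae_hasDerivAt, ae_mem_Ioo] with t₀ ht₀ ht a
  set Φ : ℝ → W →L[ℝ] W →L[ℝ] G := fun t => 0 + ∫ s in (0 : ℝ)..t, K s with hΦ
  have hδ : Tendsto (fun k : ℕ => ((k : ℝ) + 1)⁻¹) atTop (𝓝[≠] 0) := by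
    refine tendsto_nhdsWithin_iff.2 ⟨?_, Eventually.of_forall fun k => by
      rw [Set.mem_compl_singleton_iff]; positivity⟩
    simpa using tendsto_one_div_add_atTop_nhds_zero_nat (𝕜 := ℝ)
  -- Along the concentration the quadratic integral is a difference quotient of the primitive of K,
  -- evaluated at (a, a). Differentiating the operator-valued primitive makes the exceptional null
  -- set independent of a.
  have h1 := (hasDerivAt_iff_tendsto_slope_zero.1 ht₀).comp hδ
  have h2 := ((ContinuousLinearMap.apply ℝ G a ∘L
    ContinuousLinearMap.apply ℝ (W →L[ℝ] G) a).continuous.tendsto _).comp h1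
  refine h2.congr' ?_
  have hlt : ∀ᶠ k : ℕ in atTop, ((k : ℝ) + 1)⁻¹ < T - t₀ :=
    (tendsto_nhdsWithin_iff.1 hδ).1.eventually (eventually_lt_nhds (sub_pos.2 ht.2))
  filter_upwards [hlt] with k hk
  have hk0 : (0 : ℝ) < ((k : ℝ) + 1)⁻¹ := by positivity
  have hsub : Set.Ioc t₀ (t₀ + ((k : ℝ) + 1)⁻¹) ⊆ Set.Icc 0 T := fun s hs =>
    ⟨ht.1.le.trans hs.1.le, hs.2.trans (by linarith)⟩
  have hmem : t₀ + ((k : ℝ) + 1)⁻¹ ∈ Set.Icc 0 T :=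
    hsub ⟨by linarith, le_rfl⟩
  have h3 : (fun t => K t (concentration t₀ a k t) (concentration t₀ a k t)) =
      (Set.Ioc t₀ (t₀ + ((k : ℝ) + 1)⁻¹)).indicator fun t => ((k : ℝ) + 1) • K t a a := by
    funext t
    by_cases hs : t ∈ Set.Ioc t₀ (t₀ + ((k : ℝ) + 1)⁻¹)
    · simp [concentration, hs, smul_smul, Real.mul_self_sqrt (by positivity : (0:ℝ) ≤ k + 1)]
    · simp [concentration, hs]
  have hKI : Integrable K (volume.restrict (Set.Ioc t₀ (t₀ + ((k : ℝ) + 1)⁻¹))) :=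
    IntegrableOn.mono_set (hK.integrable (by simp)) hsub
  rw [h3, integral_indicator measurableSet_Ioc, timeMeasure,
    Measure.restrict_restrict_of_subset hsub, integral_smul]
  simp only [Function.comp_apply, map_smul, inv_inv]
  congr 1
  rw [hp.sub_eq (Set.Ioo_subset_Icc_self ht) hmem, intervalIntegral.integral_of_le (by linarith),
    ← ContinuousLinearMap.integral_comp_comm _ hKI]
  rfl

end Concentration

/-! ### The second variation along null sequences -/

/-- A sequence of triples with vanishing initial states and with controls that converge weakly
to zero. -/
structure IsNullSeq (T : ℝ) (d : ℕ → Triple n l m) : Prop where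
  weakNull : WeakNull T fun k => (d k).controls
  initial : Tendsto (fun k => (d k).x 0) atTop (𝓝 0)

namespace MayerProblem.IsReference

variable {P : MayerProblem n l m dφ dη} {ŵ : Triple n l m} {X Y : ℝ → Vec n →L[ℝ] Vec n}
  (h : P.IsReference ŵ X Y)
include h

lemma memLp_Y_controlMatrix :
    MemLp (fun t => Y t ∘L P.controlMatrix ŵ t) ∞ (timeMeasure P.T) :=
  (ContinuousLinearMap.compL ℝ (Vec l × Vec m) (Vec n) (Vec n)).memLp_of_bilin ∞
    h.res.primY.memLp_top (memLp_controlMatrix h.contDiff_F h.traj)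

/-- The variation of constants formula writes the state at a fixed time as the integral of the
control against a fixed L² kernel, so weak convergence of controls gives pointwise convergence of
states. -/
lemma tendsto_linState {w : ℕ → ℝ → Vec l × Vec m} (hw : WeakNull P.T w) {x₀ : ℕ → Vec n}
    (hx₀ : Tendsto x₀ atTop (𝓝 0)) {t : ℝ} (ht : t ∈ Set.Icc 0 P.T) :
    Tendsto (fun k => P.linState ŵ X Y (x₀ k) (w k) t) atTop (𝓝 0) := by
  have hg : MemLp ((Set.Ioc 0 t).indicator fun s => Y s ∘L P.controlMatrix ŵ s) 2
      (timeMeasure P.T) :=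
    (h.memLp_Y_controlMatrix.mono_exponent le_top).indicator measurableSet_Ioc
  have h1 := hx₀.add (hw.tendsto_integral hg)
  have h2 := ((X t).continuous.tendsto _).comp h1
  rw [add_zero, map_zero] at h2
  refine h2.congr fun k => ?_
  have h3 : (fun s => (Set.Ioc 0 t).indicator (fun s => Y s ∘L P.controlMatrix ŵ s) s (w k s)) =
      (Set.Ioc 0 t).indicator fun s => Y s (P.controlMatrix ŵ s (w k s)) := by
    funext s
    by_cases hs : s ∈ Set.Ioc 0 t <;> simp [hs]
  simp only [Function.comp_apply, linState]
  rw [h3, integral_indicator measurableSet_Ioc, timeMeasure, Measure.restrict_restrict_of_subset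
    (Set.Ioc_subset_Icc_self.trans (Set.Icc_subset_Icc_right ht.2)),
    intervalIntegral.integral_of_le ht.1]

section NullSequences

variable {d : ℕ → Triple n l m} (hd : ∀ k, d k ∈ P.linearized ŵ) (hn : IsNullSeq P.T d)
include hd hn

lemma tendsto_state {t : ℝ} (ht : t ∈ Set.Icc 0 P.T) :
    Tendsto (fun k => (d k).x t) atTop (𝓝 0) :=
  (h.tendsto_linState hn.weakNull hn.initial ht).congr fun k =>
    (h.eq_linState_of_mem_linearized (hd k) ht).symm

lemma tendsto_endpoints : Tendsto (fun k => P.endpoints (d k)) atTop (𝓝 0) :=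
  (h.tendsto_state hd hn (zero_mem_Icc h.pos.le)).prodMk_nhds
    (h.tendsto_state hd hn (T_mem_Icc h.pos.le))

lemma exists_state_bound : ∃ C, ∀ k, ∀ t ∈ Set.Icc 0 P.T, ‖(d k).x t‖ ≤ C := by
  obtain ⟨C, hC0, hC⟩ := h.exists_linState_bound
  obtain ⟨C₁, hC₁⟩ := hn.initial.norm.bddAbove_range
  obtain ⟨C₂, hC₂⟩ := hn.weakNull.exists_integral_norm_le
  refine ⟨C * (C₁ + C₂), fun k t ht => ?_⟩
  rw [h.eq_linState_of_mem_linearized (hd k) ht]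
  refine (hC _ _ ((hn.weakNull.memLp k).integrable (by norm_num)) t ht).trans ?_
  gcongr
  · exact hC₁ ⟨k, rfl⟩
  · exact hC₂ k

/-- Against a fixed w the form is linear in d k: the state part vanishes by dominated convergence,
the control part by weak convergence. -/
lemma tendsto_secondVarBilin_left {w : Triple n l m} (hw : w ∈ P.linearized ŵ) :
    Tendsto (fun k => P.secondVarBilin ŵ X Y w (d k)) atTop (𝓝 0) := by
  have hg : MemLp (fun t => P.hess ŵ X Y t (w.at t)) 2 (timeMeasure P.T) :=
    memLp_bilin_two h.memLp_hess (memLp_at_of_mem_linearized hw)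
  have hgx : MemLp (fun t => P.hess ŵ X Y t (w.at t) ∘L
      ContinuousLinearMap.inl ℝ (Vec n) (Vec l × Vec m)) 2 (timeMeasure P.T) :=
    hg.continuousLinearMap_comp ((ContinuousLinearMap.compL ℝ (Vec n) (Vec n × Vec l × Vec m)
      (CVal dφ dη)).flip (ContinuousLinearMap.inl ℝ (Vec n) (Vec l × Vec m)))
  have hgw : MemLp (fun t => P.hess ŵ X Y t (w.at t) ∘L
      ContinuousLinearMap.inr ℝ (Vec n) (Vec l × Vec m)) 2 (timeMeasure P.T) :=
    hg.continuousLinearMap_comp ((ContinuousLinearMap.compL ℝ (Vec l × Vec m)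
      (Vec n × Vec l × Vec m) (CVal dφ dη)).flip
        (ContinuousLinearMap.inr ℝ (Vec n) (Vec l × Vec m)))
  have hx : ∀ k, MemLp (d k).x 2 (timeMeasure P.T) := fun k =>
    (isPrim_of_mem_linearized (hd k)).memLp_top.mono_exponent le_top
  obtain ⟨C, hC⟩ := h.exists_state_bound hd hn
  have h1 := tendsto_integral_of_bounded (fun k => (hx k).1) hC
    (fun t ht => h.tendsto_state hd hn ht) (hgx.integrable (by norm_num))
  have h2 := hn.weakNull.tendsto_integral hgw
  have h3 := ((P.ddConstraints ŵ (P.endpoints w)).continuous.tendsto 0).comp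
    (h.tendsto_endpoints hd hn)
  rw [map_zero] at h3
  have h4 := h3.add (h1.add h2)
  rw [add_zero, add_zero] at h4
  refine h4.congr fun k => ?_
  rw [← integral_add (integrable_bilin hgx (hx k)) (integrable_bilin hgw (hn.weakNull.memLp k)),
    secondVarBilin, Function.comp_apply]
  congr 1
  refine integral_congr_ae (Eventually.of_forall fun t => ?_)
  have h5 : (d k).at t = ((d k).x t, 0) + (0, (d k).controls t) := by
    simp [Triple.at, Triple.controls]
  simp only [h5, map_add]
  rfl

/-- States tend to zero in L² and at the endpoints, while controls stay bounded in L². Every term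
containing a state therefore disappears; the pure control block is the only obstruction to weak
continuity. -/
lemma tendsto_secondVarBilin_diag :
    Tendsto (fun k => P.secondVarBilin ŵ X Y (d k) (d k) -
      ∫ t, P.hess ŵ X Y t (0, (d k).controls t) (0, (d k).controls t) ∂(timeMeasure P.T))
      atTop (𝓝 0) := by
  obtain ⟨C, hC⟩ := h.exists_state_bound hd hn
  obtain ⟨Cw, hCw⟩ := hn.weakNull.bound
  obtain ⟨K, hK0, hK⟩ := exists_ae_bound h.memLp_hess
  have hx : ∀ k, MemLp (d k).x 2 (timeMeasure P.T) := fun k =>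
    (isPrim_of_mem_linearized (hd k)).memLp_top.mono_exponent le_top
  have hw := hn.weakNull.memLp
  have hax := tendsto_integral_norm_sq (fun k => (hx k).1) hC
    (fun t ht => h.tendsto_state hd hn ht)
  have hend : Tendsto (fun k => P.ddConstraints ŵ (P.endpoints (d k)) (P.endpoints (d k))) atTop
      (𝓝 0) := by
    have h1 : Continuous fun q => P.ddConstraints ŵ q q :=
      (P.ddConstraints ŵ).continuous.clm_apply continuous_id
    have h2 := (h1.tendsto 0).comp (h.tendsto_endpoints hd hn)
    simpa [Function.comp_def] using h2
  have hint : Tendsto (fun k => ∫ t, (P.hess ŵ X Y t ((d k).at t) ((d k).at t) -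
      P.hess ŵ X Y t (0, (d k).controls t) (0, (d k).controls t)) ∂(timeMeasure P.T)) atTop
      (𝓝 0) := by
    have hlim : Tendsto (fun k => K * (∫ t, ‖(d k).x t‖ ^ 2 ∂(timeMeasure P.T)) +
        2 * K * (√(∫ t, ‖(d k).x t‖ ^ 2 ∂(timeMeasure P.T)) * √Cw)) atTop (𝓝 0) := by
      have := (hax.const_mul K).add ((hax.sqrt.mul_const √Cw).const_mul (2 * K))
      simpa using this
    refine squeeze_zero_norm (fun k => ?_) hlim
    have hxw : Integrable (fun t => ‖(d k).x t‖ * ‖(d k).controls t‖) (timeMeasure P.T) :=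
      memLp_one_iff_integrable.1 ((ContinuousLinearMap.mul ℝ ℝ).memLp_of_bilin 1
        (hx k).norm (hw k).norm)
    have hb : ∫ t, (K * ‖(d k).x t‖ ^ 2 + 2 * K * (‖(d k).x t‖ * ‖(d k).controls t‖))
        ∂(timeMeasure P.T) = K * (∫ t, ‖(d k).x t‖ ^ 2 ∂(timeMeasure P.T)) +
        2 * K * ∫ t, ‖(d k).x t‖ * ‖(d k).controls t‖ ∂(timeMeasure P.T) := by
      rw [integral_add ((integrable_norm_sq (hx k)).const_mul K) (hxw.const_mul (2 * K)),
        integral_const_mul, integral_const_mul]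
    refine (norm_integral_le_integral_norm _).trans ((integral_mono_of_nonneg
      (Eventually.of_forall fun _ => norm_nonneg _)
      (((integrable_norm_sq (hx k)).const_mul K).add (hxw.const_mul (2 * K))) ?_).trans
        (hb.trans_le ?_))
    · filter_upwards [hK] with t ht
      have h5 : (d k).at t = ((d k).x t, 0) + (0, (d k).controls t) := by
        simp [Triple.at, Triple.controls]
      have h6 : P.hess ŵ X Y t ((d k).at t) ((d k).at t) -
          P.hess ŵ X Y t (0, (d k).controls t) (0, (d k).controls t) =
          P.hess ŵ X Y t ((d k).x t, 0) ((d k).x t, 0) +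
          (2 : ℝ) • P.hess ŵ X Y t ((d k).x t, 0) (0, (d k).controls t) := by
        have h7 := h.hess_symm t (0, (d k).controls t) ((d k).x t, 0)
        rw [h5, map_add]
        simp only [map_add, add_apply, h7, two_smul]
        abel
      have n1 : ‖(((d k).x t, 0) : Vec n × Vec l × Vec m)‖ = ‖(d k).x t‖ := by
        simp [Prod.norm_def]
      have n2 : ‖((0, (d k).controls t) : Vec n × Vec l × Vec m)‖ = ‖(d k).controls t‖ := by
        simp [Prod.norm_def]
      have b1 := (P.hess ŵ X Y t).le_opNorm₂ ((d k).x t, 0) ((d k).x t, 0)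
      have b2 := (P.hess ŵ X Y t).le_opNorm₂ ((d k).x t, 0) (0, (d k).controls t)
      rw [n1] at b1
      rw [n1, n2] at b2
      change ‖_‖ ≤ _
      rw [h6]
      change _ ≤ K * ‖(d k).x t‖ ^ 2 + 2 * K * (‖(d k).x t‖ * ‖(d k).controls t‖)
      refine (norm_add_le _ _).trans (add_le_add (b1.trans ?_) ?_)
      · rw [mul_assoc, ← sq]; gcongr
      · rw [norm_smul, Real.norm_ofNat, mul_assoc]
        refine mul_le_mul_of_nonneg_left (b2.trans ?_) zero_le_two
        rw [mul_assoc]; gcongr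
    · gcongr
      exact (integral_norm_mul_norm_le (hx k) (hw k)).trans (by gcongr; exact hCw k)
  have h1 := hend.add hint
  rw [add_zero] at h1
  refine h1.congr fun k => ?_
  have hz : MemLp (fun t => ((0, (d k).controls t) : Vec n × Vec l × Vec m)) 2
      (timeMeasure P.T) := memLp_prod_iff.2 ⟨MemLp.zero, hw k⟩
  rw [integral_sub (h.integrable_hess (memLp_at_of_mem_linearized (hd k))
    (memLp_at_of_mem_linearized (hd k))) (h.integrable_hess hz hz), secondVarBilin, add_sub_assoc]

end NullSequences

lemma secondVarBilin_add {w z y : Triple n l m} (hw : w ∈ P.linearized ŵ)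
    (hz : z ∈ P.linearized ŵ) (hy : ∀ᵐ t ∂(timeMeasure P.T), y.at t = w.at t + z.at t)
    (hy' : P.endpoints y = P.endpoints w + P.endpoints z) :
    P.secondVarBilin ŵ X Y y y = P.secondVarBilin ŵ X Y w w +
      (2 : ℝ) • P.secondVarBilin ŵ X Y w z + P.secondVarBilin ŵ X Y z z := by
  have iw := memLp_at_of_mem_linearized hw
  have iz := memLp_at_of_mem_linearized hz
  have h1 : ∫ t, P.hess ŵ X Y t (y.at t) (y.at t) ∂(timeMeasure P.T) =
      ∫ t, (P.hess ŵ X Y t (w.at t) (w.at t) + (2 : ℝ) • P.hess ŵ X Y t (w.at t) (z.at t) +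
        P.hess ŵ X Y t (z.at t) (z.at t)) ∂(timeMeasure P.T) := by
    refine integral_congr_ae ?_
    filter_upwards [hy] with t ht
    have h2 := h.hess_symm t (z.at t) (w.at t)
    rw [ht, map_add]
    simp only [map_add, add_apply, h2, two_smul]
    abel
  have h3 : P.ddConstraints ŵ (P.endpoints z) (P.endpoints w) =
      P.ddConstraints ŵ (P.endpoints w) (P.endpoints z) :=
    fderiv_fderiv_symm h.contDiff_constraints _ _ _
  have i1 := h.integrable_hess iw iw
  have i2 := (h.integrable_hess iw iz).smul (2 : ℝ)
  have i3 := h.integrable_hess iz iz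
  have h4 := integral_add (i1.add i2) i3
  have h5 := integral_add i1 i2
  simp only [Pi.add_apply, Pi.smul_apply] at h4 h5
  rw [secondVarBilin, h1, hy', h4, h5, integral_smul]
  simp only [secondVarBilin, map_add, add_apply, h3, two_smul]
  abel

/-- The second variation of a concentrating sequence of controls. -/
lemma tendsto_secondVarBilin_concentration :
    ∀ᵐ t₀ ∂(timeMeasure P.T), ∀ (a : Vec l × Vec m) (d : ℕ → Triple n l m),
      (∀ k, d k ∈ P.linearized ŵ) → IsNullSeq P.T d →
      (∀ k, (d k).controls =ᵐ[timeMeasure P.T] concentration t₀ a k) →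
      Tendsto (fun k => P.secondVarBilin ŵ X Y (d k) (d k)) atTop
        (𝓝 (P.hess ŵ X Y t₀ (0, a) (0, a))) := by
  filter_upwards [tendsto_integral_concentration h.memLp_hess] with t₀ ht a d hd hn hc
  have h1 := (h.tendsto_secondVarBilin_diag hd hn).add (ht (0, a))
  rw [zero_add] at h1
  refine h1.congr fun k => ?_
  have h2 : ∀ t, concentration t₀ ((0, a) : Vec n × Vec l × Vec m) k t =
      (0, concentration t₀ a k t) := fun t => by
    by_cases hs : t ∈ Set.Ioc t₀ (t₀ + ((k : ℝ) + 1)⁻¹) <;> simp [concentration, hs, ← Prod.zero_eq_mk]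
  rw [sub_add, sub_eq_self, sub_eq_zero]
  refine integral_congr_ae ?_
  filter_upwards [hc k] with t htc
  rw [h2, htc]

end MayerProblem.IsReference

/-! ### From weak convergence in 𝒲₂ to null sequences and back -/

section WeakConvergence

variable {E : Type} [NormedAddCommGroup E] [InnerProductSpace ℝ E] {T : ℝ}

lemma memLp_innerSL {z : ℝ → E} {q : ℝ≥0∞} (hz : MemLp z q (timeMeasure T)) :
    MemLp (fun t => innerSL ℝ (z t)) q (timeMeasure T) := by
  refine hz.of_le ((innerSL ℝ).continuous.comp_aestronglyMeasurable hz.1)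
    (Eventually.of_forall fun t => ?_)
  rw [innerSL_apply_norm]

lemma integrable_inner {x z : ℝ → E} (hx : MemLp x 2 (timeMeasure T))
    (hz : MemLp z 2 (timeMeasure T)) :
    Integrable (fun t => inner ℝ (x t) (z t)) (timeMeasure T) :=
  integrable_bilin (memLp_innerSL hx) hz

/-- Weakly convergent sequences in `L²` are bounded. -/
lemma exists_integral_sq_le_of_weak [CompleteSpace E] {u : ℕ → ℝ → E}
    (hu : ∀ k, MemLp (u k) 2 (timeMeasure T))
    (h : ∀ z : ℝ → E, MemLp z 2 (timeMeasure T) →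
      Tendsto (fun k => ∫ t, inner ℝ (u k t) (z t) ∂(timeMeasure T)) atTop (𝓝 0)) :
    ∃ C, ∀ k, ∫ t, ‖u k t‖ ^ 2 ∂(timeMeasure T) ≤ C := by
  let U : ℕ → Lp E 2 (timeMeasure T) := fun k => (hu k).toLp
  obtain ⟨C, hC⟩ := banach_steinhaus (g := fun k => innerSL ℝ (U k)) fun z => by
    have h1 : ∀ k, innerSL ℝ (U k) z = ∫ t, inner ℝ (u k t) (z t) ∂(timeMeasure T) := fun k => by
      rw [innerSL_apply_apply, L2.inner_def]
      refine integral_congr_ae ?_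
      filter_upwards [(hu k).coeFn_toLp] with t ht
      rw [ht]
    obtain ⟨C, hC⟩ := (h z (Lp.memLp z)).norm.bddAbove_range
    exact ⟨C, fun k => by rw [h1]; exact hC ⟨k, rfl⟩⟩
  refine ⟨C ^ 2, fun k => ?_⟩
  have h1 : ‖U k‖ ^ 2 = ∫ t, ‖u k t‖ ^ 2 ∂(timeMeasure T) := by
    rw [← real_inner_self_eq_norm_sq, L2.inner_def]
    refine integral_congr_ae ?_
    filter_upwards [(hu k).coeFn_toLp] with t ht
    rw [ht, real_inner_self_eq_norm_sq]
  rw [← h1]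
  have h2 := hC k
  rw [innerSL_apply_norm] at h2
  gcongr

end WeakConvergence

/-- The difference of two triples. -/
def Triple.sub (w z : Triple n l m) : Triple n l m :=
  ⟨fun t => w.x t - z.x t, fun t => w.u t - z.u t, fun t => w.v t - z.v t⟩

namespace MayerProblem

variable {P : MayerProblem n l m dφ dη} {ŵ : Triple n l m} {X Y : ℝ → Vec n →L[ℝ] Vec n}

lemma zero_mem_linearized : (⟨0, 0, 0⟩ : Triple n l m) ∈ P.linearized ŵ := by
  refine ⟨⟨⟨0, MemLp.zero, fun t _ => by simp⟩, MemLp.zero, MemLp.zero⟩,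
    Eventually.of_forall fun t => ?_⟩
  have h1 : (⟨0, 0, 0⟩ : Triple n l m).at t = 0 := rfl
  rw [h1, map_zero]
  exact hasDerivAt_const t 0

namespace IsReference

variable (h : P.IsReference ŵ X Y)
include h

lemma memLp_fderiv_at {w : Triple n l m} (hw : w ∈ P.linearized ŵ) :
    MemLp (fun t => fderiv ℝ P.F (ŵ.at t) (w.at t)) 2 (timeMeasure P.T) :=
  memLp_bilin_two (memLp_fderiv_F h.contDiff_F h.traj) (memLp_at_of_mem_linearized hw)

lemma sub_mem_linearized {w z : Triple n l m} (hw : w ∈ P.linearized ŵ)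
    (hz : z ∈ P.linearized ŵ) : w.sub z ∈ P.linearized ŵ := by
  have h1 := (isPrim_of_mem_linearized hw).add
    ((isPrim_of_mem_linearized hz).clm (-ContinuousLinearMap.id ℝ (Vec n)))
  have h2 : IsPrim P.T (w.sub z).x (fun t => fderiv ℝ P.F (ŵ.at t) ((w.sub z).at t)) := by
    have hx : (w.sub z).x = fun t => w.x t + (-ContinuousLinearMap.id ℝ (Vec n)) (z.x t) := by
      funext t; simp [Triple.sub, sub_eq_add_neg]
    rw [hx]
    refine h1.congr (Eventually.of_forall fun t => ?_)
    change _ = fderiv ℝ P.F (ŵ.at t) (w.at t - z.at t)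
    rw [map_sub, sub_eq_add_neg]
    rfl
  have h3 : MemLp (fun t => fderiv ℝ P.F (ŵ.at t) ((w.sub z).at t)) 2 (timeMeasure P.T) := by
    have h4 := (h.memLp_fderiv_at hw).sub (h.memLp_fderiv_at hz)
    refine h4.ae_eq (Eventually.of_forall fun t => ?_)
    change _ = fderiv ℝ P.F (ŵ.at t) (w.at t - z.at t)
    rw [map_sub]; rfl
  exact ⟨⟨h2.memW1 h3, hw.1.2.1.sub hz.1.2.1, hw.1.2.2.sub hz.1.2.2⟩, h2.ae_hasDerivAt⟩

/-- The scalar product in `𝒲₂` with a fixed element. -/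
lemma innerW2_eq {w z : Triple n l m} {y : ℝ → Vec n} (hw : w ∈ P.linearized ŵ)
    (hz : MemW 2 P.T z) (hy : MemLp y 2 (timeMeasure P.T)) (hzy : deriv z.x =ᵐ[timeMeasure P.T] y)
    (hzx : MemLp z.x 2 (timeMeasure P.T)) :
    innerW2 P.T w z = ∫ t, (inner ℝ (w.x t) (z.x t) +
      inner ℝ (fderiv ℝ P.F (ŵ.at t) (w.at t)) (y t) + inner ℝ (w.u t) (z.u t) +
      inner ℝ (w.v t) (z.v t)) ∂(timeMeasure P.T) := by
  have i1 := integrable_inner (memLp_at_of_mem_linearized hw).fst hzx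
  have i2 := integrable_inner (h.memLp_fderiv_at hw) hy
  have i3 := integrable_inner hw.1.2.1 hz.2.1
  have i4 := integrable_inner hw.1.2.2 hz.2.2
  have h1 : ∫ t, inner ℝ (deriv w.x t) (deriv z.x t) ∂(timeMeasure P.T) =
      ∫ t, inner ℝ (fderiv ℝ P.F (ŵ.at t) (w.at t)) (y t) ∂(timeMeasure P.T) := by
    refine integral_congr_ae ?_
    filter_upwards [hw.2, hzy] with t h1 h2
    rw [h1.deriv, h2]
  rw [innerW2, h1]
  have e1 := integral_add ((i1.add i2).add i3) i4
  have e2 := integral_add (i1.add i2) i3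
  have e3 := integral_add i1 i2
  simp only [Pi.add_apply] at e1 e2 e3
  exact (e1.trans (by rw [e2, e3]; rfl)).symm

omit h in
lemma exists_deriv_of_memW {z : Triple n l m} (hz : MemW 2 P.T z) :
    ∃ y, MemLp y 2 (timeMeasure P.T) ∧ deriv z.x =ᵐ[timeMeasure P.T] y ∧
      MemLp z.x 2 (timeMeasure P.T) := by
  obtain ⟨y, hy, hp⟩ := hz.1.isPrim (by norm_num)
  refine ⟨y, hy, ?_, hp.memLp_top.mono_exponent le_top⟩
  filter_upwards [hp.ae_hasDerivAt] with t ht using ht.deriv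

lemma innerW2_sub {w w' z : Triple n l m} (hw : w ∈ P.linearized ŵ) (hw' : w' ∈ P.linearized ŵ)
    (hz : MemW 2 P.T z) : innerW2 P.T (w.sub w') z = innerW2 P.T w z - innerW2 P.T w' z := by
  obtain ⟨y, hy, hzy, hzx⟩ := exists_deriv_of_memW hz
  have hint : ∀ {w : Triple n l m}, w ∈ P.linearized ŵ →
      Integrable (fun t => inner ℝ (w.x t) (z.x t) +
      inner ℝ (fderiv ℝ P.F (ŵ.at t) (w.at t)) (y t) + inner ℝ (w.u t) (z.u t) +
      inner ℝ (w.v t) (z.v t)) (timeMeasure P.T) := fun {w} hw =>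
    (((integrable_inner (memLp_at_of_mem_linearized hw).fst hzx).add
      (integrable_inner (h.memLp_fderiv_at hw) hy)).add
      (integrable_inner hw.1.2.1 hz.2.1)).add (integrable_inner hw.1.2.2 hz.2.2)
  rw [h.innerW2_eq hw hz hy hzy hzx, h.innerW2_eq hw' hz hy hzy hzx,
    h.innerW2_eq (h.sub_mem_linearized hw hw') hz hy hzy hzx, ← integral_sub (hint hw) (hint hw')]
  refine integral_congr_ae (Eventually.of_forall fun t => ?_)
  have h3 : (w.sub w').at t = w.at t - w'.at t := rfl
  simp only [h3, map_sub, inner_sub_left]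
  simp only [Triple.sub, inner_sub_left]
  ring

/-- Null sequences converge weakly to zero. -/
lemma tendsto_innerW2 {d : ℕ → Triple n l m} (hd : ∀ k, d k ∈ P.linearized ŵ)
    (hn : IsNullSeq P.T d) {z : Triple n l m} (hz : MemW 2 P.T z) :
    Tendsto (fun k => innerW2 P.T (d k) z) atTop (𝓝 0) := by
  obtain ⟨y, hy, hzy, hzx⟩ := exists_deriv_of_memW hz
  obtain ⟨C, hC⟩ := h.exists_state_bound hd hn
  have hx : ∀ k, MemLp (d k).x 2 (timeMeasure P.T) := fun k =>
    (memLp_at_of_mem_linearized (hd k)).fst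
  have hw := hn.weakNull.memLp
  have hDy : MemLp (fun t => innerSL ℝ (y t) ∘L fderiv ℝ P.F (ŵ.at t)) 2 (timeMeasure P.T) :=
    (ContinuousLinearMap.compL ℝ (Vec n × Vec l × Vec m) (Vec n) ℝ).memLp_of_bilin 2
      (memLp_innerSL hy) (memLp_fderiv_F h.contDiff_F h.traj)
  have hgx : MemLp (fun t => innerSL ℝ (z.x t) + (innerSL ℝ (y t) ∘L fderiv ℝ P.F (ŵ.at t)) ∘L
      ContinuousLinearMap.inl ℝ (Vec n) (Vec l × Vec m)) 2 (timeMeasure P.T) :=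
    (memLp_innerSL hzx).add (hDy.continuousLinearMap_comp ((ContinuousLinearMap.compL ℝ (Vec n)
      (Vec n × Vec l × Vec m) ℝ).flip (ContinuousLinearMap.inl ℝ (Vec n) (Vec l × Vec m))))
  have hgw : MemLp (fun t => (innerSL ℝ (y t) ∘L fderiv ℝ P.F (ŵ.at t)) ∘L
      ContinuousLinearMap.inr ℝ (Vec n) (Vec l × Vec m) +
      (innerSL ℝ (z.u t) ∘L ContinuousLinearMap.fst ℝ (Vec l) (Vec m) +
      innerSL ℝ (z.v t) ∘L ContinuousLinearMap.snd ℝ (Vec l) (Vec m))) 2 (timeMeasure P.T) := by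
    refine (hDy.continuousLinearMap_comp ((ContinuousLinearMap.compL ℝ (Vec l × Vec m)
      (Vec n × Vec l × Vec m) ℝ).flip
        (ContinuousLinearMap.inr ℝ (Vec n) (Vec l × Vec m)))).add (MemLp.add ?_ ?_)
    · exact (memLp_innerSL hz.2.1).continuousLinearMap_comp ((ContinuousLinearMap.compL ℝ
        (Vec l × Vec m) (Vec l) ℝ).flip (ContinuousLinearMap.fst ℝ (Vec l) (Vec m)))
    · exact (memLp_innerSL hz.2.2).continuousLinearMap_comp ((ContinuousLinearMap.compL ℝ
        (Vec l × Vec m) (Vec m) ℝ).flip (ContinuousLinearMap.snd ℝ (Vec l) (Vec m)))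
  have h1 := tendsto_integral_of_bounded (fun k => (hx k).1) hC
    (fun t ht => h.tendsto_state hd hn ht) (hgx.integrable (by norm_num))
  have h2 := h1.add (hn.weakNull.weak _ hgw)
  rw [add_zero] at h2
  refine h2.congr fun k => ?_
  rw [h.innerW2_eq (hd k) hz hy hzy hzx,
    ← integral_add (integrable_bilin hgx (hx k)) (integrable_bilin hgw (hw k))]
  refine integral_congr_ae (Eventually.of_forall fun t => ?_)
  have h5 : (d k).at t = ((d k).x t, 0) + (0, (d k).controls t) := by
    simp [Triple.at, Triple.controls]
  simp only [h5, map_add, inner_add_left, add_apply, ContinuousLinearMap.comp_apply,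
    ContinuousLinearMap.inl_apply, ContinuousLinearMap.inr_apply, innerSL_apply_apply,
    ContinuousLinearMap.coe_fst', ContinuousLinearMap.coe_snd']
  have c1 := real_inner_comm (z.x t) ((d k).x t)
  have c2 := real_inner_comm (y t) (fderiv ℝ P.F (ŵ.at t) ((d k).x t, 0))
  have c3 := real_inner_comm (y t) (fderiv ℝ P.F (ŵ.at t) (0, (d k).controls t))
  have c4 := real_inner_comm (z.u t) ((d k).u t)
  have c5 := real_inner_comm (z.v t) ((d k).v t)
  simp only [Triple.controls] at c3 ⊢
  linarith

omit h in
lemma memW_cosh (e : Vec n) :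
    MemW 2 P.T (⟨fun t => Real.cosh (P.T - t) • e, 0, 0⟩ : Triple n l m) := by
  have hd : ∀ t, HasDerivAt (fun t => Real.cosh (P.T - t) • e) (-Real.sinh (P.T - t) • e) t :=
    fun t => by
      have := ((Real.hasDerivAt_cosh (P.T - t)).comp t ((hasDerivAt_id t).const_sub P.T)).smul_const e
      simpa using this
  have hc : Continuous fun t => -Real.sinh (P.T - t) • e := by fun_prop
  refine ⟨⟨fun t => -Real.sinh (P.T - t) • e, ?_, fun t _ => ?_⟩, MemLp.zero, MemLp.zero⟩
  · obtain ⟨C, hC⟩ := isCompact_Icc.exists_bound_of_continuousOn (s := Set.Icc 0 P.T) hc.continuousOn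
    exact MemLp.of_bound hc.aestronglyMeasurable C (ae_mem_Icc.mono hC)
  · rw [intervalIntegral.integral_eq_sub_of_hasDerivAt (fun s _ => hd s)
      (hc.intervalIntegrable 0 t)]
    simp

/-- Testing with a hyperbolic cosine yields the initial state. -/
lemma innerW2_cosh {w : Triple n l m} (hw : w ∈ P.linearized ŵ) (e : Vec n) :
    innerW2 P.T w ⟨fun t => Real.cosh (P.T - t) • e, 0, 0⟩ =
      Real.sinh P.T * inner ℝ (w.x 0) e := by
  have hc : Continuous fun t => Real.cosh (P.T - t) • e := by fun_prop
  have hs : ∀ t, HasDerivAt (fun t => -Real.sinh (P.T - t) • e) (Real.cosh (P.T - t) • e) t :=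
    fun t => by
      have := ((Real.hasDerivAt_sinh (P.T - t)).comp t
        ((hasDerivAt_id t).const_sub P.T)).neg.smul_const e
      simpa using this
  have hd : ∀ t, HasDerivAt (fun t => Real.cosh (P.T - t) • e) (-Real.sinh (P.T - t) • e) t :=
    fun t => by
      have := ((Real.hasDerivAt_cosh (P.T - t)).comp t
        ((hasDerivAt_id t).const_sub P.T)).smul_const e
      simpa using this
  have hp : IsPrim P.T (fun t => -Real.sinh (P.T - t) • e) (fun t => Real.cosh (P.T - t) • e) :=
    ⟨(hc.integrableOn_Icc), fun t _ => by
      rw [intervalIntegral.integral_eq_sub_of_hasDerivAt (fun s _ => hs s)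
        (hc.intervalIntegrable 0 t)]
      simp⟩
  obtain ⟨L, hL⟩ : ∃ L : Vec n →L[ℝ] Vec n →L[ℝ] ℝ, ∀ a b, L a b = inner ℝ a b :=
    ⟨innerSL ℝ, fun _ _ => rfl⟩
  -- The function ψ(t) = cosh(T − t) satisfies ψ'' = ψ and ψ'(T) = 0, so xψ + ẋψ' is the derivative
  -- of xψ' and only the endpoint 0 contributes.
  have h1 := ((isPrim_of_mem_linearized hw).bilin L hp).eq P.T (T_mem_Icc h.pos.le)
  have hcs : Continuous fun t => -Real.sinh (P.T - t) • e := by fun_prop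
  have hmem : ∀ {f : ℝ → Vec n}, Continuous f → MemLp f 2 (timeMeasure P.T) := fun {f} hf => by
    obtain ⟨C, hC⟩ := isCompact_Icc.exists_bound_of_continuousOn (s := Set.Icc 0 P.T) hf.continuousOn
    exact MemLp.of_bound hf.aestronglyMeasurable C (ae_mem_Icc.mono hC)
  rw [h.innerW2_eq hw (memW_cosh e) (hmem hcs)
    (Eventually.of_forall fun t => (hd t).deriv) (hmem hc), integral_timeMeasure h.pos.le]
  simp only [hL, sub_self, Real.sinh_zero, neg_zero, zero_smul, inner_zero_right,
    sub_zero, inner_smul_right] at h1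
  have h2 : ∀ I : ℝ, 0 = -Real.sinh P.T * inner ℝ (w.x 0) e + I →
      I = Real.sinh P.T * inner ℝ (w.x 0) e := fun I hI => by linarith
  refine h2 _ (h1.trans ?_)
  congr 1
  refine intervalIntegral.integral_congr fun t _ => ?_
  simp only [Pi.zero_apply, inner_zero_right, add_zero, inner_smul_right, Triple.at,
    Triple.controls]
  ring

/-- The deviations of a weakly convergent sequence form a null sequence. -/
lemma isNullSeq_sub {w : Triple n l m} {ws : ℕ → Triple n l m} (hw : w ∈ P.linearized ŵ)
    (hws : ∀ k, ws k ∈ P.linearized ŵ) (hconv : WeakConvW2 P.T ws w) :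
    IsNullSeq P.T fun k => (ws k).sub w := by
  have hd := fun k => h.sub_mem_linearized (hws k) hw
  have hlim : ∀ z : Triple n l m, MemW 2 P.T z →
      Tendsto (fun k => innerW2 P.T ((ws k).sub w) z) atTop (𝓝 0) := fun z hz => by
    have h1 := (hconv z hz).sub_const (innerW2 P.T w z)
    rw [sub_self] at h1
    exact h1.congr fun k => (h.innerW2_sub (hws k) hw hz).symm
  have hzero : MemW1 2 P.T (0 : ℝ → Vec n) := ⟨0, MemLp.zero, fun t _ => by simp⟩
  -- Test elements with zero state reduce the 𝒲₂ product to an L² product in a single control.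
  have hu : ∀ z : ℝ → Vec l, MemLp z 2 (timeMeasure P.T) → Tendsto
      (fun k => ∫ t, inner ℝ (((ws k).sub w).u t) (z t) ∂(timeMeasure P.T)) atTop (𝓝 0) :=
    fun z hz => (hlim ⟨0, z, 0⟩ ⟨hzero, hz, MemLp.zero⟩).congr fun k => by simp [innerW2]
  have hv : ∀ z : ℝ → Vec m, MemLp z 2 (timeMeasure P.T) → Tendsto
      (fun k => ∫ t, inner ℝ (((ws k).sub w).v t) (z t) ∂(timeMeasure P.T)) atTop (𝓝 0) :=
    fun z hz => (hlim ⟨0, 0, z⟩ ⟨hzero, MemLp.zero, hz⟩).congr fun k => by simp [innerW2]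
  have hmu := fun k => (hd k).1.2.1
  have hmv := fun k => (hd k).1.2.2
  refine ⟨⟨fun k => memLp_controls_of_mem_linearized (hd k), ?_, fun g hg => ?_⟩, ?_⟩
  · obtain ⟨Cu, hCu⟩ := exists_integral_sq_le_of_weak hmu hu
    obtain ⟨Cv, hCv⟩ := exists_integral_sq_le_of_weak hmv hv
    refine ⟨Cu + Cv, fun k => le_trans ?_ (add_le_add (hCu k) (hCv k))⟩
    rw [← integral_add (integrable_norm_sq (hmu k)) (integrable_norm_sq (hmv k))]
    refine integral_mono (integrable_norm_sq (memLp_controls_of_mem_linearized (hd k)))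
      ((integrable_norm_sq (hmu k)).add (integrable_norm_sq (hmv k))) fun t => ?_
    simp only [Triple.controls, Prod.norm_def]
    rcases max_cases ‖((ws k).sub w).u t‖ ‖((ws k).sub w).v t‖ with h1 | h1 <;> rw [h1.1] <;>
      nlinarith [sq_nonneg ‖((ws k).sub w).u t‖, sq_nonneg ‖((ws k).sub w).v t‖]
  · let zu : ℝ → Vec l := fun t => (InnerProductSpace.toDual ℝ (Vec l)).symm
      (g t ∘L ContinuousLinearMap.inl ℝ (Vec l) (Vec m))
    let zv : ℝ → Vec m := fun t => (InnerProductSpace.toDual ℝ (Vec m)).symm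
      (g t ∘L ContinuousLinearMap.inr ℝ (Vec l) (Vec m))
    have hgu : MemLp (fun t => g t ∘L ContinuousLinearMap.inl ℝ (Vec l) (Vec m)) 2
        (timeMeasure P.T) := hg.continuousLinearMap_comp ((ContinuousLinearMap.compL ℝ (Vec l)
          (Vec l × Vec m) ℝ).flip (ContinuousLinearMap.inl ℝ (Vec l) (Vec m)))
    have hgv : MemLp (fun t => g t ∘L ContinuousLinearMap.inr ℝ (Vec l) (Vec m)) 2
        (timeMeasure P.T) := hg.continuousLinearMap_comp ((ContinuousLinearMap.compL ℝ (Vec m)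
          (Vec l × Vec m) ℝ).flip (ContinuousLinearMap.inr ℝ (Vec l) (Vec m)))
    have hzu : MemLp zu 2 (timeMeasure P.T) :=
      hgu.of_le ((LinearIsometryEquiv.continuous _).comp_aestronglyMeasurable hgu.1)
        (Eventually.of_forall fun t => by simp [zu])
    have hzv : MemLp zv 2 (timeMeasure P.T) :=
      hgv.of_le ((LinearIsometryEquiv.continuous _).comp_aestronglyMeasurable hgv.1)
        (Eventually.of_forall fun t => by simp [zv])
    have h1 := (hu zu hzu).add (hv zv hzv)
    rw [add_zero] at h1
    refine h1.congr fun k => ?_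
    rw [← integral_add (integrable_inner (hmu k) hzu) (integrable_inner (hmv k) hzv)]
    refine integral_congr_ae (Eventually.of_forall fun t => ?_)
    have h2 : ((ws k).sub w).controls t = (((ws k).sub w).u t, 0) + (0, ((ws k).sub w).v t) := by
      simp [Triple.controls]
    simp only [h2, map_add]
    rw [real_inner_comm, real_inner_comm (zv t)]
    simp [zu, zv]
  · refine tendsto_of_forall_dual fun φ => ?_
    have hsinh : Real.sinh P.T ≠ 0 := (Real.sinh_pos_iff.2 h.pos).ne'
    have h1 := (hlim _ (memW_cosh ((InnerProductSpace.toDual ℝ (Vec n)).symm φ))).const_mul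
      (Real.sinh P.T)⁻¹
    rw [mul_zero] at h1
    rw [map_zero]
    refine h1.congr fun k => ?_
    rw [h.innerW2_cosh (hd k), inv_mul_cancel_left₀ hsinh, real_inner_comm]
    simp

end IsReference

end MayerProblem

/-! ### Weak lower semicontinuity and the pointwise Legendre conditions -/

namespace MayerProblem.IsReference

variable {P : MayerProblem n l m dφ dη} {ŵ : Triple n l m} {X Y : ℝ → Vec n →L[ℝ] Vec n}
  (h : P.IsReference ŵ X Y)
include h

lemma isNullSeq_concentration (t₀ : ℝ) (a : Vec l × Vec m) :
    IsNullSeq P.T fun k => P.linTriple ŵ X Y 0 (concentration t₀ a k) := by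
  refine ⟨weakNull_concentration t₀ a, ?_⟩
  simp only [linTriple, h.linState_zero]
  exact tendsto_const_nhds

lemma concentration_mem_linearized (t₀ : ℝ) (a : Vec l × Vec m) (k : ℕ) :
    P.linTriple ŵ X Y 0 (concentration t₀ a k) ∈ P.linearized ŵ :=
  h.linTriple_mem_linearized (memLp_concentration t₀ a k 2) 0

/-- Concentrating sequences converge weakly to 0, where Ω vanishes, while Ω along them tends to half
the Hessian value at t₀; lower semicontinuity at 0 forbids a negative limit. -/
lemma nonneg_of_weaklyLSCOn {lam : Multiplier n dφ dη} (hlam : lam ∈ P.multipliers ŵ)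
    (hlsc : WeaklyLSCOn P.T (P.Omega ŵ lam) (P.linearized ŵ)) :
    ∀ᵐ t ∂(timeMeasure P.T), ∀ a : Vec l × Vec m,
      0 ≤ pairingL lam.α lam.β (P.hess ŵ X Y t (0, a) (0, a)) := by
  filter_upwards [h.tendsto_secondVarBilin_concentration] with t₀ ht a
  have hd := h.concentration_mem_linearized t₀ a
  have hn := h.isNullSeq_concentration t₀ a
  have h1 := ht a _ hd hn fun k => EventuallyEq.rfl
  have h2 := (((pairingL lam.α lam.β).continuous.tendsto _).comp h1).const_mul (1 / 2)
  have h3 : ∀ k, 1 / 2 * (pairingL lam.α lam.β ∘ fun k => P.secondVarBilin ŵ X Y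
      (P.linTriple ŵ X Y 0 (concentration t₀ a k))
      (P.linTriple ŵ X Y 0 (concentration t₀ a k))) k =
      P.Omega ŵ lam (P.linTriple ŵ X Y 0 (concentration t₀ a k)) := fun k =>
    (h.Omega_eq hlam (hd k)).symm
  have h4 := h2.congr h3
  have hzero : P.Omega ŵ lam ⟨0, 0, 0⟩ = 0 := by
    have h0 : ∀ t, (⟨0, 0, 0⟩ : Triple n l m).at t = 0 := fun _ => rfl
    rw [h.Omega_eq hlam zero_mem_linearized, secondVarBilin]
    have h0' : P.endpoints (⟨0, 0, 0⟩ : Triple n l m) = 0 := rfl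
    simp [h0, h0']
  have hconv : WeakConvW2 P.T (fun k => P.linTriple ŵ X Y 0 (concentration t₀ a k))
      ⟨0, 0, 0⟩ := fun z hz => by
    have h5 : innerW2 P.T ⟨0, 0, 0⟩ z = 0 := by
      have : deriv (0 : ℝ → Vec n) = 0 := by ext1 t; simp
      simp [innerW2, this]
    rw [h5]
    exact h.tendsto_innerW2 hd hn hz
  by_contra! hneg
  obtain ⟨c, hc1, hc2⟩ := exists_between (show 1 / 2 * pairingL lam.α lam.β
    (P.hess ŵ X Y t₀ (0, a) (0, a)) < 0 by linarith)
  obtain ⟨k, hk1, hk2⟩ := ((hlsc _ zero_mem_linearized _ hd hconv c (by rwa [hzero])).and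
    (h4.eventually (eventually_lt_nhds hc1))).exists
  exact lt_asymm hk1 hk2

/-- Expanding Ω around the weak limit, the linear term tends to zero and the quadratic term equals,
up to a vanishing error, the integral of a nonnegative control form. -/
lemma weaklyLSCOn_of_nonneg {lam : Multiplier n dφ dη} (hlam : lam ∈ P.multipliers ŵ)
    (hnn : ∀ᵐ t ∂(timeMeasure P.T), ∀ a : Vec l × Vec m,
      0 ≤ pairingL lam.α lam.β (P.hess ŵ X Y t (0, a) (0, a))) :
    WeaklyLSCOn P.T (P.Omega ŵ lam) (P.linearized ŵ) := by
  intro w hw ws hws hconv c hc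
  have hn := h.isNullSeq_sub hw hws hconv
  have hd := fun k => h.sub_mem_linearized (hws k) hw
  set d : ℕ → Triple n l m := fun k => (ws k).sub w with hdef
  have h1 : ∀ k, P.Omega ŵ lam (ws k) = P.Omega ŵ lam w +
      pairingL lam.α lam.β (P.secondVarBilin ŵ X Y w (d k)) +
      1 / 2 * pairingL lam.α lam.β (P.secondVarBilin ŵ X Y (d k) (d k)) := fun k => by
    have e1 : ∀ t, (ws k).at t = w.at t + (d k).at t := fun t => by
      change _ = w.at t + ((ws k).at t - w.at t); abel
    have e2 : P.endpoints (ws k) = P.endpoints w + P.endpoints (d k) := by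
      change _ = P.endpoints w + (P.endpoints (ws k) - P.endpoints w); abel
    rw [h.Omega_eq hlam (hws k), h.Omega_eq hlam hw,
      h.secondVarBilin_add hw (hd k) (Eventually.of_forall e1) e2, map_add, map_add, map_smul,
      smul_eq_mul]
    ring
  have h2 := (((pairingL lam.α lam.β).continuous.tendsto 0).comp
    (h.tendsto_secondVarBilin_left hd hn hw)).add
    ((((pairingL lam.α lam.β).continuous.tendsto 0).comp
      (h.tendsto_secondVarBilin_diag hd hn)).const_mul (1 / 2))
  rw [map_zero, mul_zero, add_zero] at h2
  have h3 : ∀ k, 0 ≤ pairingL lam.α lam.β (∫ t, P.hess ŵ X Y t (0, (d k).controls t)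
      (0, (d k).controls t) ∂(timeMeasure P.T)) := fun k => by
    have hz : MemLp (fun t => ((0, (d k).controls t) : Vec n × Vec l × Vec m)) 2
      (timeMeasure P.T) := memLp_prod_iff.2 ⟨MemLp.zero, hn.weakNull.memLp k⟩
    rw [← ContinuousLinearMap.integral_comp_comm _ (h.integrable_hess hz hz)]
    refine integral_nonneg_of_ae ?_
    filter_upwards [hnn] with t ht using ht _
  filter_upwards [h2.eventually (eventually_gt_nhds (show c - P.Omega ŵ lam w < 0 by linarith))]
    with k hk
  simp only [Function.comp_apply, map_sub] at hk
  rw [h1]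
  linarith [h3 k]

/-- Legendre conditions characterize weak lower semicontinuity of the second variation. -/
lemma multipliersSharp_eq : P.multipliersSharp ŵ =
    {lam ∈ P.multipliers ŵ | ∀ᵐ t ∂(timeMeasure P.T),
      (∀ a, 0 ≤ P.Huu ŵ lam t a a) ∧ ∀ b a, P.Hvu ŵ lam t b a = 0} := by
  ext lam
  refine and_congr_right fun hlam => ?_
  rw [h.huu_hvu_ae_iff hlam]
  exact ⟨h.nonneg_of_weaklyLSCOn hlam, h.weaklyLSCOn_of_nonneg hlam⟩

end MayerProblem.IsReference

/-! ### Reduction of the control problem to a map between Banach spaces -/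

lemma Linf.eLpNorm_lt {E : Type} [NormedAddCommGroup E] {T ε : ℝ} (f : Linf T E) (hf : ‖f‖ < ε)
    {F : Type} [NormedAddCommGroup F] {g : ℝ → F} (hg : ∀ᵐ t ∂(timeMeasure T), ‖g t‖ ≤ ‖f t‖) :
    eLpNorm g ∞ (timeMeasure T) < ENNReal.ofReal ε := by
  refine (eLpNorm_mono_ae hg).trans_lt ?_
  rw [← Lp.enorm_def, ← ofReal_norm]
  exact (ENNReal.ofReal_lt_ofReal_iff ((norm_nonneg f).trans_lt hf)).2 hf

namespace MayerProblem

variable {P : MayerProblem n l m dφ dη} {ŵ : Triple n l m} {X Y : ℝ → Vec n →L[ℝ] Vec n}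

/-- A vector valued function of the initial state and of the controls that expresses local
optimality, together with its first two derivatives. -/
structure IsReduction (P : MayerProblem n l m dφ dη) (ŵ : Triple n l m)
    (X Y : ℝ → Vec n →L[ℝ] Vec n) (J : Vec n × Linf P.T (Vec l × Vec m) → CVal dφ dη)
    (u₀ : Vec n × Linf P.T (Vec l × Vec m)) : Prop where
  contDiffAt : ContDiffAt ℝ 2 J u₀
  eq : J u₀ = P.constraints (P.endpoints ŵ)
  fderiv_eq : ∀ ζ, fderiv ℝ J u₀ ζ = P.dConstraints ŵ (ζ.1, P.linState ŵ X Y ζ.1 ζ.2 P.T)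
  fderiv_fderiv_eq : ∀ ζ, fderiv ℝ (fderiv ℝ J) u₀ ζ ζ =
    P.secondVarBilin ŵ X Y (P.linTriple ŵ X Y ζ.1 ζ.2) (P.linTriple ŵ X Y ζ.1 ζ.2)
  not_decrease : P.IsWeakMinimum ŵ → (∀ i : Fin dφ, P.φ i.succ (P.endpoints ŵ) = 0) →
    ∀ᶠ u in 𝓝 u₀, ¬((J u).2 = 0 ∧ ∀ i, (J u).1 i < (J u₀).1 i)

variable (P) in
/-- The trajectory associated with the controls `u.2` and with the approximate state `x`. -/
def toTriple (hF : Continuous P.F) (u : Vec n × Linf P.T (Vec l × Vec m))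
    (x : Linf P.T (Vec n)) : Triple n l m :=
  ⟨fun t => u.1 + ∫ s in (0 : ℝ)..t, nemytskii P.T P.F hF (pairLinf P.T _ _ (x, u.2)) s,
    fun t => (u.2 t).1, fun t => (u.2 t).2⟩

lemma toTriple_x_ae {hF : Continuous P.F} {u : Vec n × Linf P.T (Vec l × Vec m)}
    {x : Linf P.T (Vec n)} (hres : stateResidual P.T hF (u, x) = 0) :
    (P.toTriple hF u x).x =ᵐ[timeMeasure P.T] x := by
  rw [stateResidual, sub_sub, sub_eq_zero] at hres
  have h1 : (x : ℝ → Vec n) =ᵐ[timeMeasure P.T] (constLinf P.T (Vec n) u.1 +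
      volterra P.T (Vec n) (nemytskii P.T P.F hF (pairLinf P.T _ _ (x, u.2))) :
      Linf P.T (Vec n)) := by
    exact congrArg (fun f : Linf P.T (Vec n) => (f : ℝ → Vec n)) hres ▸ EventuallyEq.rfl
  filter_upwards [h1, Lp.coeFn_add (constLinf P.T (Vec n) u.1)
    (volterra P.T (Vec n) (nemytskii P.T P.F hF (pairLinf P.T _ _ (x, u.2)))),
    constLinf_ae (T := P.T) u.1,
    volterra_ae (nemytskii P.T P.F hF (pairLinf P.T _ _ (x, u.2)))] with t h1 h2 h3 h4
  rw [h1, h2, Pi.add_apply, h3, h4]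
  rfl

lemma isTrajectory_toTriple {hF : Continuous P.F} {u : Vec n × Linf P.T (Vec l × Vec m)}
    {x : Linf P.T (Vec n)} (hres : stateResidual P.T hF (u, x) = 0) :
    P.IsTrajectory (P.toTriple hF u x) := by
  have hp : IsPrim P.T (P.toTriple hF u x).x
      (nemytskii P.T P.F hF (pairLinf P.T _ _ (x, u.2))) := Linf.isPrim _ _
  refine ⟨⟨hp.memW1 (Lp.memLp _), (Lp.memLp u.2).fst, (Lp.memLp u.2).snd⟩, ?_⟩
  refine (hp.congr ?_).ae_hasDerivAt
  filter_upwards [nemytskii_ae hF (pairLinf P.T _ _ (x, u.2)), pairLinf_ae x u.2,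
    toTriple_x_ae hres] with t h1 h2 h3
  rw [h1, h2, ← h3]
  rfl

lemma endpoints_toTriple (hT : 0 ≤ P.T) {hF : Continuous P.F}
    (ψ : Vec n × Linf P.T (Vec l × Vec m) → Linf P.T (Vec n))
    (u : Vec n × Linf P.T (Vec l × Vec m)) :
    P.endpoints (P.toTriple hF u (ψ u)) = endpointMap hF ψ u := by
  simp [endpoints, toTriple, endpointMap, integralLinf_apply, integral_timeMeasure hT]

namespace IsReference

variable (h : P.IsReference ŵ X Y)
include h

/-- J is the vector of endpoint functions composed with the endpoint map of the control-to-state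
map. A decrease of J near u₀ would give a feasible trajectory close to ŵ in L^∞ with smaller cost.
-/
lemma exists_isReduction : ∃ J u₀, P.IsReduction ŵ X Y J u₀ := by
  have hF := h.contDiff_F
  let ω : Linf P.T (Vec l × Vec m) := h.traj.memLp_controls.toLp
  let ξ : Linf P.T (Vec n) := h.traj.memLp_x.toLp
  let u₀ : Vec n × Linf P.T (Vec l × Vec m) := (ŵ.x 0, ω)
  have hω : ω =ᵐ[timeMeasure P.T] fun t => (ŵ.u t, ŵ.v t) := h.traj.memLp_controls.coeFn_toLp
  have hξ : ξ =ᵐ[timeMeasure P.T] ŵ.x := h.traj.memLp_x.coeFn_toLp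
  have hN : nemytskii P.T P.F hF.continuous (pairLinf P.T _ _ (ξ, ω)) =ᵐ[timeMeasure P.T]
      fun t => P.F (ŵ.at t) := by
    filter_upwards [nemytskii_ae hF.continuous (pairLinf P.T _ _ (ξ, ω)), pairLinf_ae ξ ω, hω,
      hξ] with t h1 h2 h3 h4
    rw [h1, h2, h3, h4]; rfl
  have hx : ∀ t ∈ Set.Icc 0 P.T, ŵ.x t = ŵ.x 0 + ∫ s in (0 : ℝ)..t,
      nemytskii P.T P.F hF.continuous (pairLinf P.T _ _ (ξ, ω)) s := fun t ht => by
    rw [h.traj.isPrim.eq t ht, intervalIntegral_congr_timeMeasure hN (zero_mem_Icc h.pos.le) ht]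
  have hres : stateResidual P.T hF.continuous (u₀, ξ) = 0 := by
    rw [stateResidual, sub_sub, sub_eq_zero]
    refine Lp.ext ?_
    filter_upwards [hξ, Lp.coeFn_add (constLinf P.T (Vec n) (ŵ.x 0)) (volterra P.T (Vec n)
      (nemytskii P.T P.F hF.continuous (pairLinf P.T _ _ (ξ, ω)))), constLinf_ae (T := P.T) (ŵ.x 0),
      volterra_ae (nemytskii P.T P.F hF.continuous (pairLinf P.T _ _ (ξ, ω))),
      ae_mem_Icc (T := P.T)] with t h1 h2 h3 h4 h5
    rw [h2, Pi.add_apply, h3, h4, h1, hx t h5]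
  obtain ⟨ψ, hψ, hψ0, hψres⟩ := exists_controlToState hF u₀ ξ hres
  have hE := contDiffAt_endpointMap hF hψ
  have hG := h.contDiff_constraints
  have hE0 : endpointMap hF.continuous ψ u₀ = P.endpoints ŵ := by
    rw [← endpoints_toTriple h.pos.le, hψ0]
    refine Prod.ext ?_ (hx P.T (T_mem_Icc h.pos.le)).symm
    simp [endpoints, toTriple, u₀]
  have hJ : ∀ ζ : Vec n × Linf P.T (Vec l × Vec m),
      fderiv ℝ (fun u => P.constraints (endpointMap hF.continuous ψ u)) u₀ ζ =
        P.dConstraints ŵ (ζ.1, P.linState ŵ X Y ζ.1 ζ.2 P.T) ∧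
      fderiv ℝ (fderiv ℝ fun u => P.constraints (endpointMap hF.continuous ψ u)) u₀ ζ ζ =
        P.secondVarBilin ŵ X Y (P.linTriple ŵ X Y ζ.1 ζ.2) (P.linTriple ŵ X Y ζ.1 ζ.2) := by
    intro ζ
    obtain ⟨x, y, hx1, hx2, hx3, hy1, hy2, hy3⟩ :=
      endpointMap_derivatives h.pos.le hF hψ hψres ζ
    have hat : ∀ᵐ t ∂(timeMeasure P.T), (ψ u₀ t, u₀.2 t) = ŵ.at t := by
      rw [hψ0]
      filter_upwards [hω, hξ] with t h1 h2
      exact Prod.ext h2 h1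
    have hlin : ∀ t ∈ Set.Icc 0 P.T, x t = P.linState ŵ X Y ζ.1 ζ.2 t := fun t ht => by
      rw [← hx2]
      exact h.eq_linState (hx1.congr (by filter_upwards [hat] with t ht; rw [ht])) ht
    have hend : (x 0, x P.T) = (ζ.1, P.linState ŵ X Y ζ.1 ζ.2 P.T) :=
      Prod.ext hx2 (hlin P.T (T_mem_Icc h.pos.le))
    -- y starts at 0 and solves the linearized equation with source F''(z,z), z being the linearized
    -- triple; duality with the costates converts its final value into the Hessian integral.
    have hdual : P.dConstraints ŵ (0, y P.T) = ∫ t, P.hess ŵ X Y t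
        ((P.linTriple ŵ X Y ζ.1 ζ.2).at t) ((P.linTriple ŵ X Y ζ.1 ζ.2).at t)
        ∂(timeMeasure P.T) := by
      have hy1' : IsPrim P.T y (fun t => P.stateMatrix ŵ t (y t) +
          P.hessF ŵ t ((P.linTriple ŵ X Y ζ.1 ζ.2).at t)
            ((P.linTriple ŵ X Y ζ.1 ζ.2).at t)) := by
        refine hy1.congr ?_
        filter_upwards [hat, ae_mem_Icc (T := P.T)] with t ht ht'
        have h1 : (P.linTriple ŵ X Y ζ.1 ζ.2).at t = (x t, ζ.2 t) := by
          rw [hlin t ht']; rfl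
        rw [h1, ht]
        rfl
      have h1 := (h.isPrim_costate.duality hy1').eq P.T (T_mem_Icc h.pos.le)
      rw [hy2, map_zero, zero_add, h.costate_final, ← integral_timeMeasure h.pos.le] at h1
      exact h1
    have hjet : HasJet (fun s : ℝ => endpointMap hF.continuous ψ (u₀ + s • ζ)) _ _ :=
      HasJet.comp_line hE ζ
    have hjet2 := HasJet.comp (f := P.constraints) hG.contDiffAt hjet
    have hjet3 := HasJet.comp_line (f := fun u => P.constraints (endpointMap hF.continuous ψ u))
      (hG.contDiffAt.comp u₀ hE) ζ
    obtain ⟨e1, e2⟩ := hjet3.unique hjet2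
    rw [zero_smul, add_zero, hE0, hx3, hend] at e1 e2
    rw [hy3] at e2
    refine ⟨e1, e2.trans ?_⟩
    have h1 : fderiv ℝ P.constraints (P.endpoints ŵ) (0, y P.T) = _ := hdual
    rw [h1, secondVarBilin]
    have h2 : P.endpoints (P.linTriple ŵ X Y ζ.1 ζ.2) =
        (ζ.1, P.linState ŵ X Y ζ.1 ζ.2 P.T) := Prod.ext (h.linState_zero _ _) rfl
    rw [h2]
    rfl
  refine ⟨fun u => P.constraints (endpointMap hF.continuous ψ u), u₀,
    hG.contDiffAt.comp u₀ hE, by rw [hE0], fun ζ => (hJ ζ).1, fun ζ => (hJ ζ).2, ?_⟩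
  rintro ⟨-, ε, hε, hmin⟩ hact
  have hcψ : ∀ᶠ u in 𝓝 u₀, ‖ψ u - ξ‖ < ε := by
    have h1 : Tendsto (fun u => ‖ψ u - ξ‖) (𝓝 u₀) (𝓝 0) := by
      have h2 : Tendsto (fun u => ‖ψ u - ξ‖) (𝓝 u₀) (𝓝 ‖ψ u₀ - ξ‖) :=
        (hψ.continuousAt.tendsto.sub_const ξ).norm
      rwa [hψ0, sub_self, norm_zero] at h2
    exact h1.eventually (eventually_lt_nhds hε)
  have hcω : ∀ᶠ u : Vec n × Linf P.T (Vec l × Vec m) in 𝓝 u₀, ‖u.2 - ω‖ < ε := by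
    have h1 : Tendsto (fun u : Vec n × Linf P.T (Vec l × Vec m) => ‖u.2 - ω‖) (𝓝 u₀) (𝓝 0) := by
      have h2 : Tendsto (fun u : Vec n × Linf P.T (Vec l × Vec m) => ‖u.2 - ω‖) (𝓝 u₀)
          (𝓝 ‖u₀.2 - ω‖) := (continuous_snd.sub continuous_const).norm.tendsto u₀
      have h3 : u₀.2 = ω := rfl
      rwa [h3, sub_self, norm_zero] at h2
    exact h1.eventually (eventually_lt_nhds hε)
  filter_upwards [hψres, hcψ, hcω] with u hu1 hu2 hu3
  rintro ⟨hη, hφ⟩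
  simp only [hE0] at hφ
  have hend := endpoints_toTriple h.pos.le (hF := hF.continuous) ψ u
  have hcost := hmin (P.toTriple hF.continuous u (ψ u)) ⟨isTrajectory_toTriple hu1, ?_, ?_⟩ ?_ ?_ ?_
  · have h1 := hφ 0
    rw [← hend] at h1
    exact absurd hcost (not_le.2 h1)
  · intro j
    rw [hend]
    exact congrFun hη j
  · intro i
    -- Activity is needed here: a decrease from the value 0 preserves φᵢ ≤ 0.
    rw [hend, ← hact i]
    exact (hφ i.succ).le
  · refine Linf.eLpNorm_lt (ψ u - ξ) hu2 ?_
    filter_upwards [toTriple_x_ae hu1, hξ, Lp.coeFn_sub (ψ u) ξ] with t h1 h2 h3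
    rw [h3, Pi.sub_apply, Pi.sub_apply, h1, h2]
  · refine Linf.eLpNorm_lt (u.2 - ω) hu3 ?_
    filter_upwards [hω, Lp.coeFn_sub u.2 ω] with t h1 h2
    rw [h2, Pi.sub_apply, Pi.sub_apply, h1]
    exact norm_fst_le (u.2 t - (ŵ.u t, ŵ.v t))
  · refine Linf.eLpNorm_lt (u.2 - ω) hu3 ?_
    filter_upwards [hω, Lp.coeFn_sub u.2 ω] with t h1 h2
    rw [h2, Pi.sub_apply, Pi.sub_apply, h1]
    exact norm_snd_le (u.2 t - (ŵ.u t, ŵ.v t))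

end IsReference

end MayerProblem

/-! ### Compact coefficient sets, approximation of critical directions and existence -/

lemma WeakNull.congr {W : Type} [NormedAddCommGroup W] [NormedSpace ℝ W] {T : ℝ}
    {w w' : ℕ → ℝ → W} (h : WeakNull T w) (hw : ∀ k, w k =ᵐ[timeMeasure T] w' k) :
    WeakNull T w' := by
  refine ⟨fun k => (h.memLp k).ae_eq (hw k), ?_, fun g hg => (h.weak g hg).congr fun k => ?_⟩
  · obtain ⟨C, hC⟩ := h.bound
    refine ⟨C, fun k => le_of_eq_of_le ?_ (hC k)⟩
    exact integral_congr_ae (by filter_upwards [hw k] with t ht; rw [ht])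
  · exact integral_congr_ae (by filter_upwards [hw k] with t ht; rw [ht])

/-- Bounded functions are dense in `L²`. -/
lemma exists_bounded_approx {W : Type} [NormedAddCommGroup W] [NormedSpace ℝ W] {T : ℝ}
    {c : ℝ → W} (hc : MemLp c 2 (timeMeasure T)) :
    ∃ g : ℕ → ℝ → W, (∀ k, MemLp (g k) ∞ (timeMeasure T)) ∧
      Tendsto (fun k => ∫ t, ‖g k t - c t‖ ^ 2 ∂(timeMeasure T)) atTop (𝓝 0) := by
  have h1 : ∀ k : ℕ, ∃ g : ℝ → W, MemLp g ∞ (timeMeasure T) ∧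
      ∫ t, ‖g t - c t‖ ^ 2 ∂(timeMeasure T) ≤ (1 / ((k : ℝ) + 1)) ^ 2 := fun k => by
    have hk : (0 : ℝ) < 1 / ((k : ℝ) + 1) := by positivity
    obtain ⟨g, hg, hg2⟩ := hc.exists_simpleFunc_eLpNorm_sub_lt (by simp)
      (ENNReal.ofReal_pos.2 hk).ne'
    refine ⟨g, g.memLp_top _, ?_⟩
    have h2 := (hc.sub hg2).eLpNorm_eq_integral_rpow_norm (by simp) (by simp)
    rw [h2, ENNReal.ofReal_lt_ofReal_iff hk] at hg
    simp only [ENNReal.toReal_ofNat, Real.rpow_ofNat, Pi.sub_apply] at hg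
    have h3 : ∫ t, ‖g t - c t‖ ^ 2 ∂(timeMeasure T) = ∫ t, ‖c t - g t‖ ^ 2 ∂(timeMeasure T) := by
      simp only [norm_sub_rev]
    have h4 : 0 ≤ ∫ t, ‖c t - g t‖ ^ 2 ∂(timeMeasure T) :=
      integral_nonneg fun _ => by positivity
    rw [h3, ← Real.sqrt_le_left hk.le, Real.sqrt_eq_rpow, one_div (2 : ℝ)]
    exact hg.le
  choose g hg hg2 using h1
  refine ⟨g, hg, squeeze_zero (fun k => integral_nonneg fun _ => by positivity) hg2 ?_⟩
  simpa using (tendsto_one_div_add_atTop_nhds_zero_nat (𝕜 := ℝ)).pow 2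

lemma continuous_pairingL : Continuous fun q : CVal dφ dη × CVal dφ dη =>
    pairingL q.1.1 q.1.2 q.2 := by
  simp only [pairingL_apply, pairing]
  fun_prop

lemma continuous_pairingL_left (s : CVal dφ dη) :
    Continuous fun q : CVal dφ dη => pairingL q.1 q.2 s := by
  simp only [pairingL_apply, pairing]
  fun_prop

lemma pairing_smul (c : ℝ) (q s : CVal dφ dη) :
    pairing (c • q).1 (c • q).2 s = c * pairing q.1 q.2 s := by
  simp only [pairing, Prod.smul_fst, Prod.smul_snd, Pi.smul_apply, smul_eq_mul, mul_add,
    Finset.mul_sum, mul_assoc]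

lemma exists_rightInverse_range {U E : Type*} [AddCommGroup U] [Module ℝ U] [AddCommGroup E]
    [Module ℝ E] (A : U →ₗ[ℝ] E) : ∃ B : LinearMap.range A →ₗ[ℝ] U, ∀ y, A (B y) = y := by
  obtain ⟨B, hB⟩ := A.rangeRestrict.exists_rightInverse_of_surjective A.range_rangeRestrict
  exact ⟨B, fun y => congrArg Subtype.val (DFunLike.congr_fun hB y)⟩

namespace MayerProblem

variable {P : MayerProblem n l m dφ dη} {ŵ : Triple n l m} {X Y : ℝ → Vec n →L[ℝ] Vec n}

variable (P ŵ X Y) in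
/-- The coefficients of the multipliers that satisfy the Legendre conditions. -/
def coefficients : Set (CVal dφ dη) :=
  {q | ∑ i, |q.1 i| + ∑ j, |q.2 j| = 1 ∧ (∀ i, 0 ≤ q.1 i) ∧
    (∀ (x₀ : Vec n) (w : ℝ → Vec l × Vec m), MemLp w ∞ (timeMeasure P.T) →
      pairingL q.1 q.2 (P.dConstraints ŵ (x₀, P.linState ŵ X Y x₀ w P.T)) = 0) ∧
    ∀ᵐ t ∂(timeMeasure P.T), ∀ a : Vec l × Vec m,
      0 ≤ pairingL q.1 q.2 (P.hess ŵ X Y t (0, a) (0, a))}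

/-- All conditions are closed and the normalization bounds the coefficients. Closedness is checked
along sequences, since the a.e. condition survives only countably many exceptional null sets. -/
lemma isCompact_coefficients : IsCompact (P.coefficients ŵ X Y) := by
  refine Metric.isCompact_of_isClosed_isBounded ?_ ?_
  · refine IsSeqClosed.isClosed fun q q₀ hq hlim => ?_
    have hp : ∀ s, Tendsto (fun k => pairingL (q k).1 (q k).2 s) atTop
        (𝓝 (pairingL q₀.1 q₀.2 s)) := fun s =>
      ((continuous_pairingL_left s).tendsto q₀).comp hlim
    have hc : Tendsto (fun k => ∑ i, |(q k).1 i| + ∑ j, |(q k).2 j|) atTop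
        (𝓝 (∑ i, |q₀.1 i| + ∑ j, |q₀.2 j|)) :=
      ((by fun_prop : Continuous fun q : CVal dφ dη =>
        ∑ i, |q.1 i| + ∑ j, |q.2 j|).tendsto q₀).comp hlim
    have hci : ∀ i, Tendsto (fun k => (q k).1 i) atTop (𝓝 (q₀.1 i)) := fun i =>
      ((by fun_prop : Continuous fun q : CVal dφ dη => q.1 i).tendsto q₀).comp hlim
    refine ⟨?_, fun i => ?_, fun x₀ w hw => ?_, ?_⟩
    · simp only [fun k => (hq k).1] at hc
      exact tendsto_nhds_unique hc tendsto_const_nhds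
    · exact ge_of_tendsto' (hci i) fun k => (hq k).2.1 i
    · have h1 := hp (P.dConstraints ŵ (x₀, P.linState ŵ X Y x₀ w P.T))
      simp only [fun k => (hq k).2.2.1 x₀ w hw] at h1
      exact tendsto_nhds_unique h1 tendsto_const_nhds
    · filter_upwards [ae_all_iff.2 fun k => (hq k).2.2.2] with t ht a
      exact ge_of_tendsto' (hp _) fun k => ht k a
  · refine (Metric.isBounded_closedBall (x := (0 : CVal dφ dη)) (r := 1)).subset fun q hq => ?_
    have h1 : ∀ i, |q.1 i| ≤ 1 := fun i => by
      have h2 := Finset.single_le_sum (fun i _ => abs_nonneg (q.1 i)) (Finset.mem_univ i)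
      have h3 := Finset.sum_nonneg fun j (_ : j ∈ Finset.univ) => abs_nonneg (q.2 j)
      linarith [hq.1]
    have h2 : ∀ j, |q.2 j| ≤ 1 := fun j => by
      have h2 := Finset.single_le_sum (fun j _ => abs_nonneg (q.2 j)) (Finset.mem_univ j)
      have h3 := Finset.sum_nonneg fun i (_ : i ∈ Finset.univ) => abs_nonneg (q.1 i)
      linarith [hq.1]
    rw [mem_closedBall_zero_iff, Prod.norm_def]
    exact max_le ((pi_norm_le_iff_of_nonneg zero_le_one).2 h1)
      ((pi_norm_le_iff_of_nonneg zero_le_one).2 h2)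

namespace IsReference

variable (h : P.IsReference ŵ X Y)
include h

/-- Together with `canon_mem_multipliersSharp` this replaces maximization over Λ^# by maximization
of a linear function over the compact set `coefficients`. -/
lemma coefficients_of_mem_multipliersSharp {lam : Multiplier n dφ dη}
    (hlam : lam ∈ P.multipliersSharp ŵ) : (lam.α, lam.β) ∈ P.coefficients ŵ X Y :=
  ⟨hlam.1.nontrivial, hlam.1.nonneg, fun x₀ _ hw =>
    h.pairingL_dConstraints_eq_zero hlam.1 x₀ (hw.integrable (by simp)),
    h.nonneg_of_weaklyLSCOn hlam.1 hlam.2⟩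

lemma canon_mem_multipliersSharp {q : CVal dφ dη} (hq : q ∈ P.coefficients ŵ X Y) :
    P.canon ŵ X Y q.1 q.2 ∈ P.multipliersSharp ŵ := by
  have h1 := h.canon_mem_multipliers hq.1 hq.2.1 hq.2.2.1
  exact ⟨h1, h.weaklyLSCOn_of_nonneg h1 hq.2.2.2⟩

/-- Expansion of the second variation around a solution of the linearized equation. -/
lemma secondVarBilin_linTriple_add {w : Triple n l m} (hw : w ∈ P.linearized ŵ)
    {c c₁ : ℝ → Vec l × Vec m} (hc₁ : MemLp c₁ 2 (timeMeasure P.T))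
    (hc : c =ᵐ[timeMeasure P.T] fun t => w.controls t + c₁ t) (x₁ : Vec n) :
    P.secondVarBilin ŵ X Y (P.linTriple ŵ X Y (w.x 0 + x₁) c)
      (P.linTriple ŵ X Y (w.x 0 + x₁) c) = P.secondVarBilin ŵ X Y w w +
      (2 : ℝ) • P.secondVarBilin ŵ X Y w (P.linTriple ŵ X Y x₁ c₁) +
      P.secondVarBilin ŵ X Y (P.linTriple ŵ X Y x₁ c₁) (P.linTriple ŵ X Y x₁ c₁) := by
  have hx : ∀ t ∈ Set.Icc 0 P.T, P.linState ŵ X Y (w.x 0 + x₁) c t =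
      w.x t + P.linState ŵ X Y x₁ c₁ t := fun t ht => by
    rw [h.linState_congr hc _ ht, h.linState_add
      ((memLp_controls_of_mem_linearized hw).integrable (by norm_num))
      (hc₁.integrable (by norm_num)) _ _ ht, ← h.eq_linState_of_mem_linearized hw ht]
  refine h.secondVarBilin_add hw (h.linTriple_mem_linearized hc₁ x₁) ?_ ?_
  · filter_upwards [hc, ae_mem_Icc (T := P.T)] with t h1 h2
    refine Prod.ext (hx t h2) ?_
    exact h1
  · exact Prod.ext (hx 0 (zero_mem_Icc h.pos.le)) (hx P.T (T_mem_Icc h.pos.le))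

section Reduction

variable {J : Vec n × Linf P.T (Vec l × Vec m) → CVal dφ dη}
  {u₀ : Vec n × Linf P.T (Vec l × Vec m)} (hJ : P.IsReduction ŵ X Y J u₀)
include hJ

/-- Polarization of the diagonal formula; off-diagonal values are needed for the orthogonality tests
in the curvature cone. -/
lemma fderiv_fderiv_reduction (ζ ξ : Vec n × Linf P.T (Vec l × Vec m)) :
    fderiv ℝ (fderiv ℝ J) u₀ ζ ξ =
      P.secondVarBilin ŵ X Y (P.linTriple ŵ X Y ζ.1 ζ.2) (P.linTriple ŵ X Y ξ.1 ξ.2) := by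
  have hmem : ∀ f : Linf P.T (Vec l × Vec m), MemLp f 2 (timeMeasure P.T) := fun f =>
    (Lp.memLp f).mono_exponent le_top
  have hw := h.linTriple_mem_linearized (hmem ζ.2) ζ.1
  have h1 := h.secondVarBilin_linTriple_add hw (hmem ξ.2) (c := (ζ.2 + ξ.2 : Linf P.T _))
    (Lp.coeFn_add ζ.2 ξ.2) ξ.1
  have h0 : (P.linTriple ŵ X Y ζ.1 ζ.2).x 0 = ζ.1 := h.linState_zero _ _
  have h2 := hJ.fderiv_fderiv_eq (ζ + ξ)
  have hs : fderiv ℝ (fderiv ℝ J) u₀ ξ ζ = fderiv ℝ (fderiv ℝ J) u₀ ζ ξ :=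
    (hJ.contDiffAt.isSymmSndFDerivAt (by simp)) ξ ζ
  rw [h0] at h1
  rw [Prod.fst_add, Prod.snd_add, h1, map_add] at h2
  simp only [map_add, add_apply, hs, hJ.fderiv_fderiv_eq] at h2
  have h3 : (2 : ℝ) • fderiv ℝ (fderiv ℝ J) u₀ ζ ξ = (2 : ℝ) • P.secondVarBilin ŵ X Y
      (P.linTriple ŵ X Y ζ.1 ζ.2) (P.linTriple ŵ X Y ξ.1 ξ.2) := by
    have h4 := sub_eq_zero.2 h2
    rw [← sub_eq_zero, ← h4, two_smul, two_smul]
    abel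
  exact smul_right_injective _ (two_ne_zero' ℝ) h3

/-- Concentrations at t₀ have first variations and second-order cross terms tending to zero, while
their second variations tend to the Hessian value at t₀. Their L^∞ norms may blow up; the asymptotic
criterion for the cone requires no norm bound. -/
lemma hess_mem_curvatureCone : ∀ᵐ t ∂(timeMeasure P.T), ∀ a : Vec l × Vec m,
    P.hess ŵ X Y t (0, a) (0, a) ∈
      curvatureCone (fderiv ℝ J u₀) (fderiv ℝ (fderiv ℝ J) u₀) := by
  filter_upwards [h.tendsto_secondVarBilin_concentration] with t₀ ht a
  let ω : ℕ → Linf P.T (Vec l × Vec m) := fun k => (memLp_concentration t₀ a k ∞).toLp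
  have hω : ∀ k, ω k =ᵐ[timeMeasure P.T] concentration t₀ a k := fun k =>
    (memLp_concentration t₀ a k ∞).coeFn_toLp
  let ξ : ℕ → Vec n × Linf P.T (Vec l × Vec m) := fun k => (0, ω k)
  have hd : ∀ k, P.linTriple ŵ X Y 0 (ω k) ∈ P.linearized ŵ := fun k =>
    h.linTriple_mem_linearized ((Lp.memLp (ω k)).mono_exponent le_top) 0
  have hn : IsNullSeq P.T fun k => P.linTriple ŵ X Y 0 (ω k) := by
    refine ⟨(weakNull_concentration t₀ a).congr fun k => (hω k).symm, ?_⟩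
    simp only [linTriple, h.linState_zero]
    exact tendsto_const_nhds
  refine mem_curvatureCone_of_tendsto (ξ := ξ)
    (fun a b => (hJ.contDiffAt.isSymmSndFDerivAt (by simp)) a b) ?_ (fun ζ => ?_) ?_
  · have h1 := ((P.dConstraints ŵ).continuous.tendsto 0).comp (h.tendsto_endpoints hd hn)
    rw [map_zero] at h1
    refine h1.congr fun k => ?_
    rw [hJ.fderiv_eq, Function.comp_apply]
    congr 1
    exact Prod.ext (h.linState_zero _ _) rfl
  · simp only [h.fderiv_fderiv_reduction hJ]
    exact h.tendsto_secondVarBilin_left hd hn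
      (h.linTriple_mem_linearized ((Lp.memLp ζ.2).mono_exponent le_top) ζ.1)
  · simp only [hJ.fderiv_fderiv_eq]
    exact ht a _ hd hn hω

/-- A solution of the linearized equation with square integrable controls is approximated by
directions with the same first variation. -/
lemma exists_approx_direction {w : Triple n l m} (hw : w ∈ P.linearized ŵ) :
    ∃ ζ : ℕ → Vec n × Linf P.T (Vec l × Vec m),
      (∀ k, fderiv ℝ J u₀ (ζ k) = P.dConstraints ŵ (P.endpoints w)) ∧
      Tendsto (fun k => fderiv ℝ (fderiv ℝ J) u₀ (ζ k) (ζ k)) atTop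
        (𝓝 (P.secondVarBilin ŵ X Y w w)) := by
  have hc := memLp_controls_of_mem_linearized hw
  obtain ⟨g, hg, hgc⟩ := exists_bounded_approx hc
  let ω : ℕ → Linf P.T (Vec l × Vec m) := fun k => (hg k).toLp
  have hω : ∀ k, ω k =ᵐ[timeMeasure P.T] g k := fun k => (hg k).coeFn_toLp
  have hgc2 : ∀ k, MemLp (fun t => g k t - w.controls t) 2 (timeMeasure P.T) := fun k =>
    ((hg k).mono_exponent le_top).sub hc
  -- the first variations converge
  have hlim : Tendsto (fun k => fderiv ℝ J u₀ (w.x 0, ω k)) atTop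
      (𝓝 (P.dConstraints ŵ (P.endpoints w))) := by
    have h1 := h.tendsto_linState (WeakNull.of_tendsto hgc2 hgc) (x₀ := fun _ => 0)
      tendsto_const_nhds (T_mem_Icc h.pos.le)
    have h2 : Tendsto (fun k => (w.x 0, w.x P.T + P.linState ŵ X Y 0
        (fun t => g k t - w.controls t) P.T)) atTop (𝓝 (P.endpoints w)) := by
      have := tendsto_const_nhds.add h1 (a := w.x P.T)
      rw [add_zero] at this
      exact tendsto_const_nhds.prodMk_nhds this
    refine (((P.dConstraints ŵ).continuous.tendsto _).comp h2).congr fun k => ?_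
    rw [hJ.fderiv_eq, Function.comp_apply]
    congr 2
    have h3 := h.linState_add (hc.integrable (by norm_num))
      ((hgc2 k).integrable (by norm_num)) (w.x 0) 0 (T_mem_Icc h.pos.le)
    rw [← h.eq_linState_of_mem_linearized hw (T_mem_Icc h.pos.le), add_zero] at h3
    rw [← h3]
    refine h.linState_congr ?_ _ (T_mem_Icc h.pos.le)
    filter_upwards [hω k] with t ht
    rw [ht]; abel
  -- a right inverse of the first variation
  let A : Vec n × Linf P.T (Vec l × Vec m) →ₗ[ℝ] CVal dφ dη := fderiv ℝ J u₀
  have hclosed : IsClosed (LinearMap.range A : Set (CVal dφ dη)) :=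
    (LinearMap.range A).closed_of_finiteDimensional
  -- The target is a limit of points of a finite-dimensional, hence closed, range, so small
  -- corrections can make the first variation exact. Exactness is what keeps every ζ k critical.
  have hmem : P.dConstraints ŵ (P.endpoints w) ∈ LinearMap.range A :=
    hclosed.mem_of_tendsto hlim (Eventually.of_forall fun k => ⟨(w.x 0, ω k), rfl⟩)
  obtain ⟨B, hAB⟩ := exists_rightInverse_range A
  let r : ℕ → LinearMap.range A := fun k =>
    ⟨P.dConstraints ŵ (P.endpoints w) - A (w.x 0, ω k), sub_mem hmem ⟨_, rfl⟩⟩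
  have hr : Tendsto r atTop (𝓝 0) := by
    rw [tendsto_subtype_rng]
    have := (tendsto_const_nhds (x := P.dConstraints ŵ (P.endpoints w))).sub hlim
    rw [sub_self] at this
    exact this
  let η : ℕ → Vec n × Linf P.T (Vec l × Vec m) := fun k => B (r k)
  have hη : Tendsto η atTop (𝓝 0) := by
    have := ((LinearMap.continuous_of_finiteDimensional B).tendsto 0).comp hr
    rw [map_zero] at this
    exact this
  refine ⟨fun k => (w.x 0, ω k) + η k, fun k => ?_, ?_⟩
  · have h1 : A (η k) = P.dConstraints ŵ (P.endpoints w) - A (w.x 0, ω k) := hAB (r k)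
    rw [map_add]
    exact add_eq_of_eq_sub' h1
  -- the deviation from `w` tends to zero
  let e : ℕ → ℝ → Vec l × Vec m := fun k t => g k t - w.controls t + (η k).2 t
  have hη2 : ∀ k, MemLp ((η k).2) 2 (timeMeasure P.T) := fun k =>
    (Lp.memLp (η k).2).mono_exponent le_top
  have he : ∀ k, MemLp (e k) 2 (timeMeasure P.T) := fun k => (hgc2 k).add (hη2 k)
  have hη0 : Tendsto (fun k => ‖(η k).2‖) atTop (𝓝 0) := by
    have := ((continuous_snd.norm).tendsto (0 : Vec n × Linf P.T (Vec l × Vec m))).comp hη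
    simpa [Function.comp_def] using this
  have he0 : Tendsto (fun k => ∫ t, ‖e k t‖ ^ 2 ∂(timeMeasure P.T)) atTop (𝓝 0) := by
    have h1 : Tendsto (fun k => 2 * (∫ t, ‖g k t - w.controls t‖ ^ 2 ∂(timeMeasure P.T)) +
        2 * (‖(η k).2‖ ^ 2 * (timeMeasure P.T).real Set.univ)) atTop (𝓝 0) := by
      have := (hgc.const_mul 2).add
        (((hη0.pow 2).mul_const ((timeMeasure P.T).real Set.univ)).const_mul 2)
      simpa using this
    refine squeeze_zero (fun k => integral_nonneg fun _ => by positivity) (fun k => ?_) h1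
    have i1 := (integrable_norm_sq (hgc2 k)).const_mul 2
    have i2 : Integrable (fun _ : ℝ => 2 * ‖(η k).2‖ ^ 2) (timeMeasure P.T) := integrable_const _
    have h2 : ∫ t, (2 * ‖g k t - w.controls t‖ ^ 2 + 2 * ‖(η k).2‖ ^ 2) ∂(timeMeasure P.T) =
        2 * (∫ t, ‖g k t - w.controls t‖ ^ 2 ∂(timeMeasure P.T)) +
        2 * (‖(η k).2‖ ^ 2 * (timeMeasure P.T).real Set.univ) := by
      rw [integral_add i1 i2, integral_const_mul, integral_const, smul_eq_mul]
      ring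
    rw [← h2]
    refine integral_mono_ae (integrable_norm_sq (he k)) (i1.add i2) ?_
    filter_upwards [Linf.ae_norm_le (η k).2] with t ht
    have h3 := norm_add_le (g k t - w.controls t) ((η k).2 t)
    have h4 := norm_nonneg ((η k).2 t)
    have h5 := norm_nonneg (e k t)
    have h6 := norm_nonneg (g k t - w.controls t)
    change ‖e k t‖ ^ 2 ≤ 2 * ‖g k t - w.controls t‖ ^ 2 + 2 * ‖(η k).2‖ ^ 2
    have h7 : ‖e k t‖ ≤ ‖g k t - w.controls t‖ + ‖(η k).2‖ := h3.trans (by gcongr)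
    nlinarith [sq_nonneg (‖g k t - w.controls t‖ - ‖(η k).2‖)]
  have hd := fun k => h.linTriple_mem_linearized (he k) (η k).1
  have hn : IsNullSeq P.T fun k => P.linTriple ŵ X Y (η k).1 (e k) := by
    refine ⟨WeakNull.of_tendsto he he0, ?_⟩
    simp only [linTriple, h.linState_zero]
    exact (continuous_fst.tendsto _).comp hη
  have hdiag : Tendsto (fun k => ∫ t, P.hess ŵ X Y t (0, e k t) (0, e k t)
      ∂(timeMeasure P.T)) atTop (𝓝 0) := by
    obtain ⟨K, hK0, hK⟩ := exists_ae_bound h.memLp_hess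
    have h1 := he0.const_mul K
    rw [mul_zero] at h1
    refine squeeze_zero_norm (fun k => ?_) h1
    rw [← integral_const_mul]
    refine norm_integral_le_of_norm_le ((integrable_norm_sq (he k)).const_mul K) ?_
    filter_upwards [hK] with t ht
    have n2 : ‖((0, e k t) : Vec n × Vec l × Vec m)‖ = ‖e k t‖ := by simp [Prod.norm_def]
    refine ((P.hess ŵ X Y t).le_opNorm₂ _ _).trans ?_
    rw [n2, mul_assoc, ← sq]
    gcongr
  have h1 := (h.tendsto_secondVarBilin_diag hd hn).add hdiag
  have h2 := ((h.tendsto_secondVarBilin_left hd hn hw).const_smul (2 : ℝ)).add h1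
  have h3 := (tendsto_const_nhds (x := P.secondVarBilin ŵ X Y w w)).add h2
  simp only [smul_zero, add_zero] at h3
  refine h3.congr fun k => ?_
  have h4 := h.secondVarBilin_linTriple_add hw (he k) (c := ((ω k + (η k).2 : Linf P.T _))) (by
    filter_upwards [Lp.coeFn_add (ω k) (η k).2, hω k] with t h1 h2
    rw [h1, Pi.add_apply, h2]
    simp only [e]
    abel) (η k).1
  rw [hJ.fderiv_fderiv_eq, Prod.fst_add, Prod.snd_add, h4, add_assoc]
  congr 2
  exact sub_add_cancel _ _

end Reduction

/-- The multiplier rule is applied to each bounded approximating direction; nonnegativity on the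
curvature cone supplies the Legendre conditions. After normalization, a convergent subsequence of
coefficients passes the sign of the second variation to the limit. -/
lemma exists_coefficients (hmin : P.IsWeakMinimum ŵ)
    (hactive : ∀ i : Fin dφ, P.φ i.succ (P.endpoints ŵ) = 0) {w : Triple n l m}
    (hw : w ∈ P.criticalCone ŵ) :
    ∃ q ∈ P.coefficients ŵ X Y, 0 ≤ pairingL q.1 q.2 (P.secondVarBilin ŵ X Y w w) := by
  obtain ⟨J, u₀, hJ⟩ := h.exists_isReduction
  obtain ⟨ζ, hζ, hlim⟩ := h.exists_approx_direction hJ hw.1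
  have hJ2 : (J u₀).2 = 0 := by
    rw [hJ.eq]
    exact funext hmin.1.2.1
  have key : ∀ k, ∃ q ∈ P.coefficients ŵ X Y,
      0 ≤ pairingL q.1 q.2 (fderiv ℝ (fderiv ℝ J) u₀ (ζ k) (ζ k)) := fun k => by
    obtain ⟨α, β, hne, hα, hA, hQ, hC⟩ := exists_multiplier_of_local_min hJ.contDiffAt hJ2
      (hJ.not_decrease hmin hactive) (h := ζ k)
      (fun i => by rw [hζ, h.dConstraints_fst]; exact hw.2.2 i)
      (funext fun j => by rw [hζ, h.dConstraints_snd]; exact hw.2.1 j)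
    have hN : 0 < ∑ i, |α i| + ∑ j, |β j| := by
      rcases hne with hne | hne
      · obtain ⟨i, hi⟩ := Function.ne_iff.1 hne
        exact add_pos_of_pos_of_nonneg (Finset.sum_pos' (fun _ _ => abs_nonneg _)
          ⟨i, Finset.mem_univ i, abs_pos.2 hi⟩) (Finset.sum_nonneg fun _ _ => abs_nonneg _)
      · obtain ⟨j, hj⟩ := Function.ne_iff.1 hne
        exact add_pos_of_nonneg_of_pos (Finset.sum_nonneg fun _ _ => abs_nonneg _)
          (Finset.sum_pos' (fun _ _ => abs_nonneg _) ⟨j, Finset.mem_univ j, abs_pos.2 hj⟩)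
    set N := ∑ i, |α i| + ∑ j, |β j| with hNdef
    have hpair : ∀ s, pairingL (N⁻¹ • ((α, β) : CVal dφ dη)).1 (N⁻¹ • ((α, β) : CVal dφ dη)).2 s =
        N⁻¹ * pairing α β s := fun s => by rw [pairingL_apply, pairing_smul]
    refine ⟨N⁻¹ • (α, β), ⟨?_, fun i => ?_, fun x₀ c hc => ?_, ?_⟩, ?_⟩
    · simp only [Prod.smul_fst, Prod.smul_snd, Pi.smul_apply, smul_eq_mul, abs_mul,
        ← Finset.mul_sum, ← mul_add, abs_of_pos (inv_pos.2 hN), ← hNdef]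
      exact inv_mul_cancel₀ hN.ne'
    · exact mul_nonneg (inv_pos.2 hN).le (hα i)
    · have h1 := hA (x₀, hc.toLp)
      rw [hJ.fderiv_eq] at h1
      rw [hpair, ← h.linState_congr hc.coeFn_toLp x₀ (T_mem_Icc h.pos.le), h1, mul_zero]
    · filter_upwards [h.hess_mem_curvatureCone hJ] with t ht a
      rw [hpair]
      exact mul_nonneg (inv_pos.2 hN).le (hC _ (ht a))
    · rw [hpair]
      exact mul_nonneg (inv_pos.2 hN).le hQ
  choose q hq hq0 using key
  obtain ⟨q₀, hq₀, σ, hσ, hlimq⟩ := isCompact_coefficients.tendsto_subseq hq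
  refine ⟨q₀, hq₀, ?_⟩
  exact ge_of_tendsto' ((continuous_pairingL.tendsto (q₀, P.secondVarBilin ŵ X Y w w)).comp
    (hlimq.prodMk_nhds (hlim.comp hσ.tendsto_atTop))) fun k => hq0 (σ k)

end IsReference

end MayerProblem

end PartiallyAffine

end

/-! ### Attainment and nonnegativity of the maximum -/

theorem mainTheorem1 {n l m dφ dη : ℕ}
    (P : PartiallyAffine.MayerProblem n l m dφ dη) (hT : 0 < P.T) (hreg : P.Regular)
    (ŵ : PartiallyAffine.Triple n l m) (hmin : P.IsWeakMinimum ŵ)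
    (hactive : ∀ i : Fin dφ, P.φ i.succ (P.endpoints ŵ) = 0) :
    P.multipliersSharp ŵ =
      {lam ∈ P.multipliers ŵ | ∀ᵐ t ∂(PartiallyAffine.timeMeasure P.T),
        (∀ a, 0 ≤ P.Huu ŵ lam t a a) ∧ (∀ b a, P.Hvu ŵ lam t b a = 0)} ∧
    ∀ w ∈ P.criticalCone ŵ, ∃ lam ∈ P.multipliersSharp ŵ,
      IsMaxOn (fun lam' => P.Omega ŵ lam' w) (P.multipliersSharp ŵ) lam ∧
      0 ≤ P.Omega ŵ lam w := by
  obtain ⟨X, Y, h⟩ := PartiallyAffine.MayerProblem.exists_isReference hT hreg hmin.1.1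
  refine ⟨h.multipliersSharp_eq, fun w hw => ?_⟩
  obtain ⟨q₀, hq₀, hq₀'⟩ := h.exists_coefficients hmin hactive hw
  -- On Λ^# the value Ω[λ](w) is a linear function of the coefficients alone, so it attains its
  -- maximum over the compact set, and this maximum is at least the nonnegative value at q₀.
  obtain ⟨q, hq, hmax⟩ := PartiallyAffine.MayerProblem.isCompact_coefficients.exists_isMaxOn
    ⟨q₀, hq₀⟩ ((PartiallyAffine.continuous_pairingL.comp (continuous_id.prodMk
      (continuous_const (y := P.secondVarBilin ŵ X Y w w)))).continuousOn)
  have hlam := h.canon_mem_multipliersSharp hq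
  refine ⟨P.canon ŵ X Y q.1 q.2, hlam, fun lam hl => ?_, ?_⟩
  · have h1 := hmax (h.coefficients_of_mem_multipliersSharp hl)
    simp only [Set.mem_ofPred_eq, Function.comp_apply, id_eq] at h1 ⊢
    rw [h.Omega_eq hl.1 hw.1, h.Omega_eq hlam.1 hw.1]
    exact mul_le_mul_of_nonneg_left h1 (by norm_num)
  · have h1 := hmax hq₀
    simp only [Set.mem_ofPred_eq, Function.comp_apply, id_eq] at h1
    rw [h.Omega_eq hlam.1 hw.1]
    exact mul_nonneg (by norm_num) (hq₀'.trans h1)
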